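/- Let $n\ge 1$ and write points of $\mathbb R^{n+1}$ as $Z=(z,t)$, $z\in\mathbb R^n$, $t\in\mathbb R$, with $\langle Z\rangle=(1+|z|^2+t^2)^{1/2}$, $\langle t\rangle=(1+t^2)^{1/2}$, $D=-i\partial$, $\mathrm{Rot}_{jl}=z_jD_{z_l}-z_lD_{z_j}$. Let $X=[\overline{\mathbb R^{n+1}};E]$ be the blow-up of the radial compactification $\overline{\mathbb R^{n+1}}=\{(z',s,h):|z'|^2+s^2+h^2=1,\ h\ge 0\}$ (with $Z\mapsto (z,t,1)/\langle Z\rangle$) at the equator $E=\{s=h=0\}$; elements of $C^\infty(X)$ are regarded as functions on the interior $\mathbb R^{n+1}$. Let $\rho_E=\langle t\rangle/\langle Z\rangle\in C^\infty(X)$, a boundary defining function of the front face $\tilde E$. The flat module $\mathcal F$ is the $C^\infty(X)$-span of the differential operators $$\mathrm{Id},\quad \langle t\rangle D_{z_j},\quad \rho_E^{-1},\quad \langle t\rangle D_t,\quad \mathrm{Rot}_{jl}\qquad(1\le j,l\le n).$$ The order of $\langle t\rangle D_t$ is $2$, that of the other generators is $1$, and that of elements of $C^\infty(X)$ is $0$.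 An operator has order at most $j$ if it is a finite sum of products of elements of $\mathcal F$ (with $C^\infty(X)$ coefficients) such that in each product the orders of the factors add up to at most $j$. Put $\mathcal F^{(k)}=\{A\in\mathcal F^k:\mathrm{ord}(A)\le k\}$. For $r\in\mathbb R$, $k\in\mathbb N$ let $$H^{0,r;k}_{\mathcal F}=\{u\in\langle Z\rangle^{-r}L^2(\mathbb R^{n+1}): Au\in\langle Z\rangle^{-r}L^2(\mathbb R^{n+1})\ \text{for all } A\in\mathcal F^{(k)}\},$$ where $Au$ is taken in the sense of distributions, with norm $\|u\|^2=\sum_\alpha\|\mathbf A^\alpha u\|^2_{\langle Z\rangle^{-r}L^2}$, the sum being over the products $\mathbf A^\alpha$ of powers of the non-identity generators (in a fixed order) of total order at most $k$. Let $H^{0,r;k}_{\mathcal F}(t\ge t_0)$ and $H^{0,r;k}_{\mathcal F}(t\le t_0)$ be the subspaces of those $u$ with $\operatorname{supp}u\subset\{t\ge t_0\}$, respectively $\operatorname{supp}u\subset\{t\le t_0\}$. For such spaces, $Y_1\cdot Y_2\subset Y$ means that $u_1u_2\in Y$ for all $u_1\in Y_1$, $u_2\in Y_2$ and that $\|u_1u_2\|_Y\le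 C\|u_1\|_{Y_1}\|u_2\|_{Y_2}$ with a constant $C$ independent of $u_1,u_2$. **Proposition.** Let $t_0,t_0',r_1,r_2\in\mathbb R$ and $k\in\mathbb N$ with $k>\max(n/2+2,3)$. Then $$H^{0,r_1;k}_{\mathcal F}(t\ge t_0)\cdot H^{0,r_2;k}_{\mathcal F}(t\ge t_0)\subset H^{0,r_1+r_2+(n+1)/2;k}_{\mathcal F}(t\ge t_0),$$ the same holds with $t\le t_0$ in place of $t\ge t_0$ everywhere, and $$H^{0,r_1;k}_{\mathcal F}(t\ge t_0)\cdot H^{0,r_2;k}_{\mathcal F}(t\le t_0')\subset H^{0,r_1+r_2+(n+1)/2;k}_{\mathcal F}(t\ge t_0).$$ -/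

import Mathlib

open MeasureTheory TopologicalSpace
open scoped ContDiff Distributions LineDeriv ENNReal NNReal

noncomputable section

/-- Spacetime `ℝⁿ⁺¹`, with points `Z = (z, t)`, `z ∈ ℝⁿ`, `t ∈ ℝ`. -/
abbrev Spacetime (n : ℕ) : Type := EuclideanSpace ℝ (Fin n) × ℝ

/-- `⟨Z⟩ = (1 + |z|² + t²)^{1/2}`. -/
def bracketZ {n : ℕ} (Z : Spacetime n) : ℝ := √(1 + ‖Z.1‖ ^ 2 + Z.2 ^ 2)

/-- `⟨t⟩ = (1 + t²)^{1/2}`. -/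
def bracketT {n : ℕ} (Z : Spacetime n) : ℝ := √(1 + Z.2 ^ 2)

theorem bracketZ_pos {n : ℕ} (Z : Spacetime n) : 0 < bracketZ Z :=
  Real.sqrt_pos.2 (by positivity)

theorem bracketT_pos {n : ℕ} (Z : Spacetime n) : 0 < bracketT Z :=
  Real.sqrt_pos.2 (by positivity)

theorem contDiff_bracketZ (n : ℕ) : ContDiff ℝ ∞ (bracketZ : Spacetime n → ℝ) := by
  unfold bracketZ
  refine ContDiff.sqrt ?_ fun Z => by positivity
  have h : ContDiff ℝ ∞ fun Z : Spacetime n => ‖Z.1‖ ^ 2 := contDiff_fst.norm_sq ℝ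
  fun_prop

theorem contDiff_bracketT (n : ℕ) : ContDiff ℝ ∞ (bracketT : Spacetime n → ℝ) := by
  unfold bracketT
  exact ContDiff.sqrt (by fun_prop) fun Z => by positivity

/-! ### The blow-up `X` of the radial compactification at the equator

The radial compactification of `ℝⁿ⁺¹` is the closed upper half sphere
`{(z', s, h) : |z'|² + s² + h² = 1, h ≥ 0}`, in which `Z = (z, t)` is the point `(z, t, 1)/⟨Z⟩`.
Its boundary is `h = 0`, and the equator `E` is cut out by the two functions `s = t/⟨Z⟩` and
`h = 1/⟨Z⟩`, whose differentials are independent along `E`. The blow-up of `E` introduces polar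
coordinates in `(s, h)`: it adds `r ≥ 0` and a point `θ` of the closed half circle `θ₂ ≥ 0` with
`(s, h) = r θ`. At the point `Z` these are `r = ⟨t⟩/⟨Z⟩` and `θ = (t, 1)/⟨t⟩`. -/

/-- The Euclidean space `ℝⁿ × ℝ × ℝ × ℝ × (ℝ × ℝ)`, with points `(z', s, h, r, θ)`. -/
abbrev BlowupAmbient (n : ℕ) : Type := EuclideanSpace ℝ (Fin n) × ℝ × ℝ × ℝ × (ℝ × ℝ)

/-- `X`, the blow-up at the equator of the radial compactification of `ℝⁿ⁺¹`, as a compact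
submanifold with corners of a Euclidean space. -/
def blowup (n : ℕ) : Set (BlowupAmbient n) :=
  {x | match x with
    | (z', s, h, r, θ) =>
      ‖z'‖ ^ 2 + s ^ 2 + h ^ 2 = 1 ∧ 0 ≤ h ∧
      0 ≤ r ∧ θ.1 ^ 2 + θ.2 ^ 2 = 1 ∧ 0 ≤ θ.2 ∧ s = r * θ.1 ∧ h = r * θ.2}

/-- The embedding of `ℝⁿ⁺¹` as the interior of `X`. -/
def toAmbient {n : ℕ} (Z : Spacetime n) : BlowupAmbient n :=
  ((bracketZ Z)⁻¹ • Z.1, Z.2 / bracketZ Z, 1 / bracketZ Z, bracketT Z / bracketZ Z,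
    (Z.2 / bracketT Z, 1 / bracketT Z))

theorem toAmbient_mem_blowup {n : ℕ} (Z : Spacetime n) : toAmbient Z ∈ blowup n := by
  have hZ := bracketZ_pos Z
  have hT := bracketT_pos Z
  have hZ2 : bracketZ Z ^ 2 = 1 + ‖Z.1‖ ^ 2 + Z.2 ^ 2 := Real.sq_sqrt (by positivity)
  have hT2 : bracketT Z ^ 2 = 1 + Z.2 ^ 2 := Real.sq_sqrt (by positivity)
  refine ⟨?_, by positivity, by positivity, ?_, by positivity, ?_, ?_⟩
  · rw [norm_smul, norm_inv, Real.norm_of_nonneg hZ.le]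
    field_simp
    rw [hZ2]
    ring
  · field_simp
    rw [hT2]
    ring
  · field_simp
  · field_simp

theorem contDiff_toAmbient (n : ℕ) : ContDiff ℝ ∞ (toAmbient : Spacetime n → BlowupAmbient n) := by
  have hZ := contDiff_bracketZ n
  have hT := contDiff_bracketT n
  have hZ0 : ∀ Z : Spacetime n, bracketZ Z ≠ 0 := fun Z => (bracketZ_pos Z).ne'
  have hT0 : ∀ Z : Spacetime n, bracketT Z ≠ 0 := fun Z => (bracketT_pos Z).ne'
  unfold toAmbient
  exact ((hZ.inv hZ0).smul contDiff_fst).prodMk <| (contDiff_snd.div hZ hZ0).prodMk <|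
    (contDiff_const.div hZ hZ0).prodMk <| (hT.div hZ hZ0).prodMk <|
    (contDiff_snd.div hT hT0).prodMk (contDiff_const.div hT hT0)

/-- A function on `X` is smooth (up to all boundary faces and corners) if it is the restriction
of a smooth function on the ambient Euclidean space. -/
def IsSmoothOnBlowup {n : ℕ} (f : blowup n → ℂ) : Prop :=
  ∃ F : BlowupAmbient n → ℂ, ContDiff ℝ ∞ F ∧ ∀ x : blowup n, f x = F x

/-- `C^∞(X)`, whose elements are regarded as functions on the interior `ℝⁿ⁺¹` of `X`. -/
def smoothX (n : ℕ) : Set (Spacetime n → ℂ) :=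
  {a | ∃ f : blowup n → ℂ, IsSmoothOnBlowup f ∧
    ∀ Z, a Z = f ⟨toAmbient Z, toAmbient_mem_blowup Z⟩}

theorem contDiff_of_mem_smoothX {n : ℕ} {a : Spacetime n → ℂ} (ha : a ∈ smoothX n) :
    ContDiff ℝ ∞ a := by
  obtain ⟨f, ⟨F, hF, hfF⟩, haf⟩ := ha
  have h : a = F ∘ toAmbient := funext fun Z => by rw [haf, hfF]; rfl
  exact h ▸ hF.comp (contDiff_toAmbient n)

/-! ### Differential operators acting on distributions -/

/-- Complex-valued test functions on `ℝⁿ⁺¹`. -/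
abbrev TestFn (n : ℕ) : Type := 𝓓((⊤ : Opens (Spacetime n)), ℂ)

/-- Linear functionals on test functions. The theory only uses differential operators with smooth
coefficients applied to locally integrable functions, all of which are distributions. -/
abbrev Distr (n : ℕ) : Type := Module.Dual ℂ (TestFn n)

/-- Operators on distributions. -/
abbrev DistrOp (n : ℕ) : Type := Module.End ℂ (Distr n)

/-- The locally integrable function `u` is the distribution `T`. -/
def Represents {n : ℕ} (u : Spacetime n → ℂ) (T : Distr n) : Prop :=
  LocallyIntegrable u ∧ ∀ φ : TestFn n, T φ = ∫ Z, u Z * φ Z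

/-- Multiplication of test functions by a smooth function. -/
def mulTest {n : ℕ} (a : Spacetime n → ℂ) (ha : ContDiff ℝ ∞ a) : TestFn n →ₗ[ℂ] TestFn n where
  toFun φ :=
    { toFun := fun Z => a Z * φ Z
      contDiff' := ha.mul φ.contDiff
      hasCompactSupport' := φ.hasCompactSupport.mul_left
      tsupport_subset' := fun _ _ => trivial }
  map_add' φ ψ := TestFunction.ext fun Z => by
    change a Z * (φ Z + ψ Z) = a Z * φ Z + a Z * ψ Z
    ring
  map_smul' c φ := TestFunction.ext fun Z => by
    change a Z * (c * φ Z) = c * (a Z * φ Z)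
    ring

/-- Multiplication of distributions by a smooth function, `(a T)(φ) = T(a φ)`. -/
def mulOp {n : ℕ} (a : Spacetime n → ℂ) (ha : ContDiff ℝ ∞ a) : DistrOp n :=
  (mulTest a ha).dualMap

/-- `D_v = -i ∂_v` on distributions, `(D_v T)(φ) = T(i ∂_v φ)`. -/
def dOp {n : ℕ} (v : Spacetime n) : DistrOp n :=
  (Complex.I • (TestFunction.lineDerivCLM ℂ v : TestFn n →L[ℂ] TestFn n).toLinearMap).dualMap

/-- `D_{z_j}`. -/
def dzOp {n : ℕ} (j : Fin n) : DistrOp n := dOp (EuclideanSpace.single j 1, 0)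

/-- `D_t`. -/
def dtOp (n : ℕ) : DistrOp n := dOp (0, 1)

/-- Multiplication by `⟨t⟩`. -/
def bracketTOp (n : ℕ) : DistrOp n :=
  mulOp (fun Z => (bracketT Z : ℂ)) (Complex.ofRealCLM.contDiff.comp (contDiff_bracketT n))

/-- Multiplication by `⟨Z⟩/⟨t⟩`. -/
def weightOp (n : ℕ) : DistrOp n :=
  mulOp (fun Z => ((bracketZ Z / bracketT Z : ℝ) : ℂ))
    (Complex.ofRealCLM.contDiff.comp
      ((contDiff_bracketZ n).div (contDiff_bracketT n) fun Z => (bracketT_pos Z).ne'))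

/-- Multiplication by `z_j`. -/
def zOp {n : ℕ} (j : Fin n) : DistrOp n :=
  mulOp (fun Z => (Z.1 j : ℂ)) (Complex.ofRealCLM.contDiff.comp
    ((EuclideanSpace.proj (𝕜 := ℝ) j).contDiff.comp contDiff_fst))

/-! ### The flat module and its reduced powers -/

/-- Labels of the generators `⟨t⟩ D_{z_j}`, `1/ρ_E`, `⟨t⟩ D_t`, `Rot_{jk}`. -/
inductive FlatGen (n : ℕ) : Type
  | dz (j : Fin n)
  | weight
  | dt
  | rot (j k : Fin n)

/-- The generators. Here `1/ρ_E = ⟨Z⟩/⟨t⟩`, where `ρ_E = ⟨t⟩/⟨Z⟩` is the polar radial function `r`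
of the blow-up: it is smooth on `X`, vanishes simply at the front face, and is positive
elsewhere. -/
def FlatGen.op {n : ℕ} : FlatGen n → DistrOp n
  | .dz j => bracketTOp n * dzOp j
  | .weight => weightOp n
  | .dt => bracketTOp n * dtOp n
  | .rot j k => zOp j * dzOp k - zOp k * dzOp j

/-- The order of a generator: `2` for `⟨t⟩ D_t` and `1` for the others. -/
def FlatGen.order {n : ℕ} : FlatGen n → ℕ
  | .dt => 2
  | _ => 1

/-- The `C^∞(X)`-span of the identity (of order `0`) and of the generators of order at
most `d`. -/
def flatModuleLE (n d : ℕ) : Submodule ℂ (DistrOp n) :=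
  Submodule.span ℂ {P | ∃ (a : Spacetime n → ℂ) (ha : a ∈ smoothX n),
    P = mulOp a (contDiff_of_mem_smoothX ha) ∨
    ∃ g : FlatGen n, g.order ≤ d ∧ P = mulOp a (contDiff_of_mem_smoothX ha) * g.op}

/-- The flat module `𝓕`, the `C^∞(X)`-span of the identity and of all the generators. -/
def flatModule (n : ℕ) : Submodule ℂ (DistrOp n) := flatModuleLE n 2

/-- The operators of order at most `j`: finite sums of products of elements of `𝓕`, where in each
product the orders of the factors add up to at most `j`. The coefficients in `C^∞(X)` are factors
of order `0`. -/
def flatOrdLE (n j : ℕ) : Submodule ℂ (DistrOp n) :=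
  Submodule.span ℂ {P | ∃ l : List (ℕ × DistrOp n),
    (∀ p ∈ l, p.1 ≤ 2 ∧ p.2 ∈ flatModuleLE n p.1) ∧
    (l.map Prod.fst).sum ≤ j ∧ P = (l.map Prod.snd).prod}

/-- The reduced power `𝓕^{(k)} = {A ∈ 𝓕^k : ord A ≤ k}`. -/
def flatReduced (n k : ℕ) : Submodule ℂ (DistrOp n) := flatModule n ^ k ⊓ flatOrdLE n k

/-! ### The flat module regularity spaces -/

/-- `u ∈ ⟨Z⟩^{-r} L²(ℝⁿ⁺¹)`. -/
def MemWeightedL2 {n : ℕ} (r : ℝ) (u : Spacetime n → ℂ) : Prop :=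
  MemLp (fun Z => ((bracketZ Z ^ r : ℝ) : ℂ) * u Z) 2

/-- `A u = v` in the sense of distributions. -/
def WeakEq {n : ℕ} (A : DistrOp n) (u v : Spacetime n → ℂ) : Prop :=
  ∃ T : Distr n, Represents u T ∧ Represents v (A T)

/-- `H^{0,r;k}_𝓕`: the functions `u ∈ ⟨Z⟩^{-r} L²` with `A u ∈ ⟨Z⟩^{-r} L²` for every
`A ∈ 𝓕^{(k)}`. -/
def flatSpace (n : ℕ) (r : ℝ) (k : ℕ) : Set (Spacetime n → ℂ) :=
  {u | MemWeightedL2 r u ∧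
    ∀ A ∈ flatReduced n k, ∃ v : Spacetime n → ℂ, MemWeightedL2 r v ∧ WeakEq A u v}

/-- `H^{0,r;k}_𝓕(t ≥ t₀)`. -/
def flatSpaceGE (n : ℕ) (r : ℝ) (k : ℕ) (t₀ : ℝ) : Set (Spacetime n → ℂ) :=
  {u | u ∈ flatSpace n r k ∧ ∀ᵐ Z : Spacetime n, Z.2 < t₀ → u Z = 0}

/-- `H^{0,r;k}_𝓕(t ≤ t₀)`. -/
def flatSpaceLE (n : ℕ) (r : ℝ) (k : ℕ) (t₀ : ℝ) : Set (Spacetime n → ℂ) :=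
  {u | u ∈ flatSpace n r k ∧ ∀ᵐ Z : Spacetime n, t₀ < Z.2 → u Z = 0}

/-- The generators, listed in a fixed order. -/
def flatGens (n : ℕ) : List (FlatGen n) :=
  (List.finRange n).map FlatGen.dz ++ [FlatGen.weight, FlatGen.dt] ++
    (List.finRange n).flatMap fun j => (List.finRange n).map (FlatGen.rot j)

/-- The ordered product `𝐀^α` of powers of the generators. -/
def flatMonomial {n : ℕ} (α : FlatGen n → ℕ) : DistrOp n :=
  ((flatGens n).map fun g => g.op ^ α g).prod

/-- The order `∑ α_g ord(A_g)` of `𝐀^α`. -/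
def flatMonomialOrder {n : ℕ} (α : FlatGen n → ℕ) : ℕ :=
  ((flatGens n).map fun g => α g * g.order).sum

/-- `‖A u‖` in `⟨Z⟩^{-r} L²`, with value `∞` if `A u` is not in that space. The function `A u` is
unique up to null sets, so the infimum is over one value. -/
def weakNorm {n : ℕ} (r : ℝ) (A : DistrOp n) (u : Spacetime n → ℂ) : ℝ≥0∞ :=
  ⨅ (v : Spacetime n → ℂ) (_ : WeakEq A u v),
    eLpNorm (fun Z => ((bracketZ Z ^ r : ℝ) : ℂ) * v Z) 2 volume

/-- The norm of `H^{0,r;k}_𝓕`: `‖u‖² = ∑ ‖𝐀^α u‖²`, the sum being over the finitely many products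
of generators of order at most `k`. -/
def flatNorm {n : ℕ} (r : ℝ) (k : ℕ) (u : Spacetime n → ℂ) : ℝ≥0∞ :=
  (∑' α : {α : FlatGen n → ℕ // flatMonomialOrder α ≤ k},
    weakNorm r (flatMonomial α.1) u ^ 2) ^ (1 / 2 : ℝ)

/-- `Y₁ · Y₂ ⊂ Y` with continuous multiplication, for the norms `N₁`, `N₂`, `N` of the three
spaces. -/
def ProductContained {n : ℕ} (Y₁ Y₂ Y : Set (Spacetime n → ℂ))
    (N₁ N₂ N : (Spacetime n → ℂ) → ℝ≥0∞) : Prop :=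
  (∀ u₁ ∈ Y₁, ∀ u₂ ∈ Y₂, (fun Z => u₁ Z * u₂ Z) ∈ Y) ∧
  ∃ C : ℝ≥0, ∀ u₁ ∈ Y₁, ∀ u₂ ∈ Y₂, N (fun Z => u₁ Z * u₂ Z) ≤ C * N₁ u₁ * N₂ u₂

end

/-!
The flat module spaces are multiplicative because they are, locally in suitable coordinates,
anisotropic Sobolev spaces in which a time derivative counts twice, so that the effective dimension
is `n + 2`.

*Algebra.* The vector fields of the generators extend smoothly to the blow-up `X`
(`fderiv_toAmbient`), so they act on `C^∞(X)`, and the commutator of two generators has order less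
than the sum of their orders (`commutator_mem`). Therefore an operator of order at most `k` is a
combination, with bounded coefficients, of words of order at most `k` in the generators, and a word
is such a combination of the ordered monomials which enter the norm (`exists_coeff_of_mem_wordSpan`,
`exists_coeff_wordOp`). It remains to bound words applied to a product, and the Leibniz rule
(`exists_leibniz`) splits these into products of words applied to the two factors, of orders adding
up to at most `k`.

*Coordinates.* Put `t = sinh τ` and take polar coordinates for `z / ⟨t⟩`, with slopes in place of
angles, around a tip `-ε e_p` with `ε = ± 1`. Finitely many such cones cover spacetime
(`exists_coneHeight_ge`); moving the tip away from the origin makes the coordinates regular where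
`z = 0`. In these coordinates `∂_τ` has order `2`, and the other coordinate fields have order `1`,
as combinations of generators (`fieldOrdLE_coneField`), and the volume is comparable to
`⟨Z⟩^(n-1) ⟨t⟩²` times Lebesgue measure. So `f ↦ J f`, `J = ⟨Z⟩^(r+(n-1)/2) ⟨t⟩`, turns
the norm of `⟨Z⟩^{-r} L²` into the `L²` norm, and words into coordinate derivatives of the
corresponding order (`exists_eLpNorm_coordDeriv_coneChart_le`).

*The product estimate.* On flat space a product is estimated in `L²` by distributing the derivatives
available on the factors over tensor products of one-dimensional weights on the Fourier side
(`exists_eLpNorm_mul_le_coordDeriv`): it suffices that the two factors have more than `n / 2 + 1`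
derivatives together. If words of orders adding up to at most `k` have been applied, `k` derivatives
are left. The densities for `r₁`, `r₂` and `r₁ + r₂ + (n + 1) / 2` match up to the factor
`⟨Z⟩ / ⟨t⟩`, which is a generator and costs one derivative; this is why `k > n / 2 + 2` is needed
(`exists_weightedNorm_mul_le`).

*Approximation.* The estimate for test functions passes to the weak derivatives in the definition of
the spaces. Coordinate derivatives belong to the module because `1 / ⟨t⟩` is smooth on `X`; they
commute with mollification, so words applied to mollifications converge in `L²` on compact sets
(`tendsto_wordAct_mollify`). The generators are bounded on cutoffs in `⟨Z⟩`, so cutting off costs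
only a constant (`exists_approx`). Products of the approximations converge in `L¹` on compact sets,
which identifies the weak derivatives of the limit, and the weighted norms are lower semicontinuous
(`weightedNorm_le_of_tendsto`). The support conditions are immediate from those on the first factor.
-/

noncomputable section

/-! ### Operators on distributions -/

theorem mulOp_apply {n : ℕ} {a : Spacetime n → ℂ} (ha : ContDiff ℝ ∞ a) (T : Distr n)
    (φ : TestFn n) : mulOp a ha T φ = T (mulTest a ha φ) := rfl

theorem mulTest_apply {n : ℕ} {a : Spacetime n → ℂ} (ha : ContDiff ℝ ∞ a)
    (φ : TestFn n) (Z : Spacetime n) : mulTest a ha φ Z = a Z * φ Z := rfl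

theorem dOp_apply {n : ℕ} (v : Spacetime n) (T : Distr n) (φ : TestFn n) :
    dOp v T φ = T (Complex.I • (TestFunction.lineDerivCLM ℂ v φ : TestFn n)) := rfl

theorem lineDeriv_testFn {n : ℕ} (v : Spacetime n) (φ : TestFn n) (Z : Spacetime n) :
    (TestFunction.lineDerivCLM ℂ v φ : TestFn n) Z = fderiv ℝ φ Z v := by
  rw [TestFunction.lineDerivCLM_eq_fderivCLM, TestFunction.fderivCLM_apply_of_le _ (by simp)]

theorem smul_testFn_apply {n : ℕ} (c : ℂ) (φ : TestFn n) (Z : Spacetime n) :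
    (c • φ) Z = c * φ Z := rfl

theorem add_testFn_apply {n : ℕ} (φ ψ : TestFn n) (Z : Spacetime n) :
    (φ + ψ) Z = φ Z + ψ Z := rfl

theorem TestFn.differentiable {n : ℕ} (φ : TestFn n) : Differentiable ℝ φ :=
  φ.contDiff.differentiable (by simp)

theorem mulOp_mul {n : ℕ} {a b : Spacetime n → ℂ} (ha : ContDiff ℝ ∞ a) (hb : ContDiff ℝ ∞ b) :
    mulOp a ha * mulOp b hb = mulOp (fun Z => a Z * b Z) (ha.mul hb) := by
  refine LinearMap.ext fun T => LinearMap.ext fun φ => ?_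
  change T (mulTest b hb (mulTest a ha φ)) = T (mulTest _ _ φ)
  congr 1
  refine TestFunction.ext fun Z => ?_
  simp only [mulTest_apply]
  ring

theorem mulOp_add {n : ℕ} {a b : Spacetime n → ℂ} (ha : ContDiff ℝ ∞ a) (hb : ContDiff ℝ ∞ b) :
    mulOp (fun Z => a Z + b Z) (ha.add hb) = mulOp a ha + mulOp b hb := by
  refine LinearMap.ext fun T => LinearMap.ext fun φ => ?_
  change T (mulTest _ _ φ) = T (mulTest a ha φ) + T (mulTest b hb φ)
  rw [← map_add]
  congr 1
  refine TestFunction.ext fun Z => ?_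
  simp only [mulTest_apply, add_testFn_apply]
  ring

theorem mulOp_const {n : ℕ} (c : ℂ) (h : ContDiff ℝ ∞ (fun _ : Spacetime n => c)) :
    mulOp (fun _ : Spacetime n => c) h = c • (1 : DistrOp n) := by
  refine LinearMap.ext fun T => LinearMap.ext fun φ => ?_
  change T (mulTest _ _ φ) = c * T φ
  rw [← smul_eq_mul, ← map_smul]
  rfl

theorem mulOp_congr {n : ℕ} {a b : Spacetime n → ℂ} (ha : ContDiff ℝ ∞ a) (hb : ContDiff ℝ ∞ b)
    (h : ∀ Z, a Z = b Z) : mulOp a ha = mulOp b hb := by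
  obtain rfl : a = b := funext h
  rfl

theorem mulOp_comm {n : ℕ} {a b : Spacetime n → ℂ} (ha : ContDiff ℝ ∞ a) (hb : ContDiff ℝ ∞ b) :
    mulOp a ha * mulOp b hb = mulOp b hb * mulOp a ha := by
  rw [mulOp_mul, mulOp_mul]
  exact mulOp_congr _ _ fun Z => mul_comm _ _

theorem ContDiff.fderiv_field {n : ℕ} {a : Spacetime n → ℂ} (ha : ContDiff ℝ ∞ a)
    {V : Spacetime n → Spacetime n} (hV : ContDiff ℝ ∞ V) :
    ContDiff ℝ ∞ fun Z => -Complex.I * fderiv ℝ a Z (V Z) :=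
  contDiff_const.mul ((ha.fderiv_right (m := ∞) (by simp)).clm_apply hV)

/-- The Leibniz rule. -/
theorem dOp_mul_mulOp {n : ℕ} (v : Spacetime n) {a : Spacetime n → ℂ} (ha : ContDiff ℝ ∞ a) :
    dOp v * mulOp a ha = mulOp a ha * dOp v +
      mulOp (fun Z => -Complex.I * fderiv ℝ a Z v) (ha.fderiv_field contDiff_const) := by
  refine LinearMap.ext fun T => LinearMap.ext fun φ => ?_
  change T (mulTest _ _ _) = T (Complex.I • (TestFunction.lineDerivCLM ℂ v _ : TestFn n)) +
    T (mulTest _ _ φ)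
  rw [← map_add]
  congr 1
  refine TestFunction.ext fun Z => ?_
  simp only [mulTest_apply, add_testFn_apply, LinearMap.smul_apply, ContinuousLinearMap.coe_coe,
    smul_testFn_apply, lineDeriv_testFn]
  have : fderiv ℝ (mulTest a ha φ) Z v = a Z * fderiv ℝ φ Z v + φ Z * fderiv ℝ a Z v := by
    change fderiv ℝ (fun Z => a Z * φ Z) Z v = _
    rw [fderiv_fun_mul (ha.differentiable (by simp) Z) (φ.differentiable Z)]
    simp
  rw [this]
  ring

theorem dOp_comm {n : ℕ} (v w : Spacetime n) : dOp v * dOp w = dOp w * dOp v := by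
  refine LinearMap.ext fun T => LinearMap.ext fun φ => ?_
  change T (Complex.I • (TestFunction.lineDerivCLM ℂ w
      (Complex.I • (TestFunction.lineDerivCLM ℂ v φ : TestFn n)) : TestFn n)) =
    T (Complex.I • (TestFunction.lineDerivCLM ℂ v
      (Complex.I • (TestFunction.lineDerivCLM ℂ w φ : TestFn n)) : TestFn n))
  congr 1
  rw [map_smul, map_smul]
  congr 2
  refine TestFunction.ext fun Z => ?_
  have key : ∀ v w : Spacetime n, (TestFunction.lineDerivCLM ℂ w
      (TestFunction.lineDerivCLM ℂ v φ : TestFn n) : TestFn n) Z =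
      fderiv ℝ (fderiv ℝ φ) Z w v := fun v w => by
    have h : ((TestFunction.lineDerivCLM ℂ v φ : TestFn n) : Spacetime n → ℂ) =
        fun Z => fderiv ℝ φ Z v := funext fun Z => lineDeriv_testFn v φ Z
    rw [lineDeriv_testFn, h, fderiv_clm_apply _ (differentiableAt_const _)]
    · simp
    · exact (φ.contDiff.fderiv_right (m := ∞) (by simp)).differentiable (by simp) Z
  rw [key, key]
  refine (φ.contDiff.contDiffAt.isSymmSndFDerivAt ?_).eq _ _
  rw [minSmoothness_of_isRCLikeNormedField]
  exact WithTop.coe_le_coe.2 (le_top : (2 : ℕ∞) ≤ ⊤)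

/-! ### The generators as first order operators -/

/-- The real vector field of a generator; it vanishes for the weight. -/
def FlatGen.vec {n : ℕ} : FlatGen n → Spacetime n → Spacetime n
  | .dz j, Z => (bracketT Z • EuclideanSpace.single j 1, 0)
  | .weight, _ => 0
  | .dt, Z => (0, bracketT Z)
  | .rot j k, Z => (Z.1 j • EuclideanSpace.single k 1 - Z.1 k • EuclideanSpace.single j 1, 0)

/-- The term of order zero of a generator: `⟨Z⟩/⟨t⟩` for the weight and `0` otherwise. -/
def FlatGen.pot {n : ℕ} : FlatGen n → Spacetime n → ℂ
  | .weight, Z => ((bracketZ Z / bracketT Z : ℝ) : ℂ)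
  | _, _ => 0

/-- The derivation part `-i V` of a generator, on functions. -/
def FlatGen.der {n : ℕ} (g : FlatGen n) (f : Spacetime n → ℂ) (Z : Spacetime n) : ℂ :=
  -Complex.I * fderiv ℝ f Z (g.vec Z)

/-- A generator acting on functions. -/
def FlatGen.act {n : ℕ} (g : FlatGen n) (f : Spacetime n → ℂ) (Z : Spacetime n) : ℂ :=
  g.der f Z + g.pot Z * f Z

theorem ContDiff.ofReal_comp {n : ℕ} {a : Spacetime n → ℝ} (ha : ContDiff ℝ ∞ a) :
    ContDiff ℝ ∞ fun Z => (a Z : ℂ) := Complex.ofRealCLM.contDiff.comp ha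

theorem contDiff_coord {n : ℕ} (j : Fin n) : ContDiff ℝ ∞ fun Z : Spacetime n => Z.1 j :=
  (EuclideanSpace.proj (𝕜 := ℝ) j).contDiff.comp contDiff_fst

theorem FlatGen.contDiff_vec {n : ℕ} (g : FlatGen n) : ContDiff ℝ ∞ g.vec := by
  cases g with
  | dz j =>
    have h := contDiff_bracketT n
    change ContDiff ℝ ∞ fun Z : Spacetime n =>
      (bracketT Z • EuclideanSpace.single j (1 : ℝ), (0 : ℝ))
    fun_prop
  | weight => exact contDiff_const
  | dt => exact contDiff_const.prodMk (contDiff_bracketT n)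
  | rot j k =>
    have h1 := contDiff_coord j
    have h2 := contDiff_coord k
    change ContDiff ℝ ∞ fun Z : Spacetime n =>
      (Z.1 j • EuclideanSpace.single k (1 : ℝ) - Z.1 k • EuclideanSpace.single j (1 : ℝ), (0 : ℝ))
    fun_prop

theorem FlatGen.contDiff_pot {n : ℕ} (g : FlatGen n) : ContDiff ℝ ∞ g.pot := by
  cases g with
  | weight =>
    exact ((contDiff_bracketZ n).div (contDiff_bracketT n)
      fun Z => (bracketT_pos Z).ne').ofReal_comp
  | _ => exact contDiff_const

theorem ContDiff.genDer {n : ℕ} {f : Spacetime n → ℂ} (hf : ContDiff ℝ ∞ f) (g : FlatGen n) :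
    ContDiff ℝ ∞ (g.der f) := hf.fderiv_field g.contDiff_vec

theorem ContDiff.genAct {n : ℕ} {f : Spacetime n → ℂ} (hf : ContDiff ℝ ∞ f) (g : FlatGen n) :
    ContDiff ℝ ∞ (g.act f) := (hf.genDer g).add (g.contDiff_pot.mul hf)

theorem bracketTOp_eq (n : ℕ) : bracketTOp n = mulOp (fun Z => (bracketT Z : ℂ))
    (contDiff_bracketT n).ofReal_comp := rfl

theorem weightOp_eq (n : ℕ) : weightOp n = mulOp (FlatGen.pot .weight)
    (FlatGen.contDiff_pot .weight) := rfl

theorem zOp_eq {n : ℕ} (j : Fin n) : zOp j = mulOp (fun Z : Spacetime n => (Z.1 j : ℂ))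
    (contDiff_coord j).ofReal_comp := rfl

theorem FlatGen.op_mul_mulOp {n : ℕ} (g : FlatGen n) {a : Spacetime n → ℂ}
    (ha : ContDiff ℝ ∞ a) :
    g.op * mulOp a ha = mulOp a ha * g.op + mulOp (g.der a) (ha.genDer g) := by
  have hd : ∀ Z, DifferentiableAt ℝ a Z := ha.differentiable (by simp)
  cases g with
  | dz j =>
    simp only [FlatGen.op, bracketTOp_eq, dzOp]
    rw [mul_assoc, dOp_mul_mulOp, mul_add, ← mul_assoc, ← mul_assoc, mulOp_comm _ ha,
      mulOp_mul _ (ha.fderiv_field contDiff_const)]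
    congr 1
    refine mulOp_congr _ _ fun Z => ?_
    have : (FlatGen.dz j).vec Z =
      bracketT Z • ((EuclideanSpace.single j 1, 0) : Spacetime n) := by
        simp [FlatGen.vec]
    rw [FlatGen.der, this, map_smul]
    simp only [Complex.real_smul]
    ring
  | weight =>
    simp only [FlatGen.op, weightOp_eq]
    rw [mulOp_comm]
    have : mulOp (FlatGen.weight.der a) (ha.genDer _) = 0 := by
      rw [mulOp_congr (b := fun _ => 0) _ contDiff_const fun Z => by
        simp [FlatGen.der, FlatGen.vec], mulOp_const]
      simp
    rw [this, add_zero]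
  | dt =>
    simp only [FlatGen.op, bracketTOp_eq, dtOp]
    rw [mul_assoc, dOp_mul_mulOp, mul_add, ← mul_assoc, ← mul_assoc, mulOp_comm _ ha,
      mulOp_mul _ (ha.fderiv_field contDiff_const)]
    congr 1
    refine mulOp_congr _ _ fun Z => ?_
    have : FlatGen.dt.vec Z = bracketT Z • ((0, 1) : Spacetime n) := by
        simp [FlatGen.vec]
    rw [FlatGen.der, this, map_smul]
    simp only [Complex.real_smul]
    ring
  | rot j k =>
    simp only [FlatGen.op, zOp_eq, dzOp]
    rw [sub_mul, mul_sub, mul_assoc, dOp_mul_mulOp, mul_assoc, dOp_mul_mulOp, mul_add, mul_add,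
      ← mul_assoc, ← mul_assoc, ← mul_assoc, ← mul_assoc, mulOp_comm _ ha, mulOp_comm _ ha,
      mulOp_mul _ (ha.fderiv_field contDiff_const), mulOp_mul _ (ha.fderiv_field contDiff_const)]
    have : mulOp ((FlatGen.rot j k).der a) (ha.genDer _) =
        mulOp (fun Z => ((Z.1 j : ℝ) : ℂ) *
          (-Complex.I * fderiv ℝ a Z (EuclideanSpace.single k 1, 0)))
          ((contDiff_coord j).ofReal_comp.mul
            (ha.fderiv_field contDiff_const)) -
        mulOp (fun Z => ((Z.1 k : ℝ) : ℂ) *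
          (-Complex.I * fderiv ℝ a Z (EuclideanSpace.single j 1, 0)))
          ((contDiff_coord k).ofReal_comp.mul
            (ha.fderiv_field contDiff_const)) := by
      rw [eq_sub_iff_add_eq, ← mulOp_add]
      refine mulOp_congr _ _ fun Z => ?_
      have : (FlatGen.rot j k).vec Z =
        Z.1 j • ((EuclideanSpace.single k 1, 0) : Spacetime n) -
          Z.1 k • ((EuclideanSpace.single j 1, 0) : Spacetime n) := by
          simp [FlatGen.vec]
      rw [FlatGen.der, this, map_sub, map_smul, map_smul]
      simp only [Complex.real_smul]
      ring
    rw [this]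
    abel

/-! ### The coefficient algebra `C^∞(X)` -/

theorem mem_smoothX_iff {n : ℕ} {a : Spacetime n → ℂ} : a ∈ smoothX n ↔
    ∃ F : BlowupAmbient n → ℂ, ContDiff ℝ ∞ F ∧ ∀ Z, a Z = F (toAmbient Z) := by
  constructor
  · rintro ⟨f, ⟨F, hF, hfF⟩, haf⟩
    exact ⟨F, hF, fun Z => by rw [haf, hfF]⟩
  · rintro ⟨F, hF, h⟩
    exact ⟨fun x => F x, ⟨F, hF, fun _ => rfl⟩, h⟩

theorem smoothX_const {n : ℕ} (c : ℂ) : (fun _ => c) ∈ smoothX n :=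
  mem_smoothX_iff.2 ⟨fun _ => c, contDiff_const, fun _ => rfl⟩

theorem smoothX_mul {n : ℕ} {a b : Spacetime n → ℂ} (ha : a ∈ smoothX n) (hb : b ∈ smoothX n) :
    (fun Z => a Z * b Z) ∈ smoothX n := by
  obtain ⟨F, hF, h⟩ := mem_smoothX_iff.1 ha
  obtain ⟨G, hG, h'⟩ := mem_smoothX_iff.1 hb
  exact mem_smoothX_iff.2 ⟨fun x => F x * G x, hF.mul hG, fun Z => by rw [h, h']⟩

theorem smoothX_add {n : ℕ} {a b : Spacetime n → ℂ} (ha : a ∈ smoothX n) (hb : b ∈ smoothX n) :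
    (fun Z => a Z + b Z) ∈ smoothX n := by
  obtain ⟨F, hF, h⟩ := mem_smoothX_iff.1 ha
  obtain ⟨G, hG, h'⟩ := mem_smoothX_iff.1 hb
  exact mem_smoothX_iff.2 ⟨fun x => F x + G x, hF.add hG, fun Z => by rw [h, h']⟩

theorem smoothX_of_real {n : ℕ} {F : BlowupAmbient n → ℝ} (hF : ContDiff ℝ ∞ F)
    {a : Spacetime n → ℝ} (h : ∀ Z, a Z = F (toAmbient Z)) :
    (fun Z => (a Z : ℂ)) ∈ smoothX n :=
  mem_smoothX_iff.2 ⟨fun x => (F x : ℂ), Complex.ofRealCLM.contDiff.comp hF, fun Z => by rw [h]⟩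

theorem bracketT_le_bracketZ {n : ℕ} (Z : Spacetime n) : bracketT Z ≤ bracketZ Z :=
  Real.sqrt_le_sqrt (by nlinarith [sq_nonneg ‖Z.1‖])

theorem one_le_bracketT {n : ℕ} (Z : Spacetime n) : 1 ≤ bracketT Z :=
  Real.one_le_sqrt.2 (by nlinarith [sq_nonneg Z.2])

theorem norm_fst_le_bracketZ {n : ℕ} (Z : Spacetime n) : ‖Z.1‖ ≤ bracketZ Z :=
  Real.le_sqrt_of_sq_le (by nlinarith [sq_nonneg Z.2])

theorem abs_snd_le_bracketT {n : ℕ} (Z : Spacetime n) : |Z.2| ≤ bracketT Z :=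
  Real.le_sqrt_of_sq_le (by nlinarith [sq_abs Z.2])

/-- Elements of `C^∞(X)` are bounded, as `X` is compact. -/
theorem smoothX_bounded {n : ℕ} {a : Spacetime n → ℂ} (ha : a ∈ smoothX n) :
    ∃ C : ℝ, 0 ≤ C ∧ ∀ Z, ‖a Z‖ ≤ C := by
  obtain ⟨F, hF, h⟩ := mem_smoothX_iff.1 ha
  obtain ⟨C, hC⟩ := (isCompact_closedBall (0 : BlowupAmbient n) 1).exists_bound_of_continuousOn
    hF.continuous.continuousOn
  have hC' : ∀ Z, ‖a Z‖ ≤ C := fun Z => by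
    rw [h]
    refine hC _ ?_
    have hR := bracketZ_pos Z
    have hT := bracketT_pos Z
    have hTR := bracketT_le_bracketZ Z
    have h1 := one_le_bracketT Z
    have h2 := norm_fst_le_bracketZ Z
    have h3 := abs_snd_le_bracketT Z
    simp only [mem_closedBall_zero_iff, toAmbient, Prod.norm_def, sup_le_iff, norm_smul, norm_inv,
      Real.norm_eq_abs, abs_div, abs_of_pos hR, abs_of_pos hT, abs_one]
    refine ⟨?_, ?_, ?_, ?_, ?_, ?_⟩
    · rw [inv_mul_le_iff₀ hR]; linarith
    all_goals rw [div_le_one (by assumption)]; linarith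
  exact ⟨C, (norm_nonneg _).trans (hC' 0), hC'⟩

/-- `V⟨Z⟩/⟨Z⟩` for the vector field `V` of a generator, in the coordinates of `X`. -/
def FlatGen.logZ {n : ℕ} : FlatGen n → BlowupAmbient n → ℝ
  | .dz j, x => x.2.2.2.1 * x.1 j
  | .dt, x => x.2.2.2.1 * x.2.1
  | _, _ => 0

/-- `V⟨t⟩/⟨t⟩` for the vector field `V` of a generator, in the coordinates of `X`. -/
def FlatGen.logT {n : ℕ} : FlatGen n → BlowupAmbient n → ℝ
  | .dt, x => x.2.2.2.2.1
  | _, _ => 0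

/-- `Vz/⟨Z⟩` for the vector field `V` of a generator, in the coordinates of `X`. -/
def FlatGen.velZ {n : ℕ} : FlatGen n → BlowupAmbient n → EuclideanSpace ℝ (Fin n)
  | .dz j, x => x.2.2.2.1 • EuclideanSpace.single j 1
  | .rot j k, x => x.1 j • EuclideanSpace.single k 1 - x.1 k • EuclideanSpace.single j 1
  | _, _ => 0

/-- `Vt/⟨t⟩` for the vector field `V` of a generator. -/
def FlatGen.velT {n : ℕ} : FlatGen n → ℝ
  | .dt => 1
  | _ => 0

/-- The extension of the vector field of a generator to the ambient space of `X`. -/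
def FlatGen.lift {n : ℕ} (g : FlatGen n) (x : BlowupAmbient n) : BlowupAmbient n :=
  (g.velZ x - g.logZ x • x.1, g.velT * x.2.2.2.1 - g.logZ x * x.2.1, -(g.logZ x * x.2.2.1),
    x.2.2.2.1 * (g.logT x - g.logZ x),
    (g.velT - g.logT x * x.2.2.2.2.1, -(g.logT x * x.2.2.2.2.2)))

theorem contDiff_ambient_coord {n : ℕ} (j : Fin n) :
    ContDiff ℝ ∞ fun x : BlowupAmbient n => x.1 j :=
  (EuclideanSpace.proj (𝕜 := ℝ) j).contDiff.comp contDiff_fst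

theorem FlatGen.contDiff_logZ {n : ℕ} (g : FlatGen n) : ContDiff ℝ ∞ g.logZ := by
  cases g with
  | dz j => exact ContDiff.mul (by fun_prop) (contDiff_ambient_coord _)
  | dt => exact ContDiff.mul (by fun_prop) (by fun_prop)
  | _ => exact contDiff_const

theorem FlatGen.contDiff_logT {n : ℕ} (g : FlatGen n) : ContDiff ℝ ∞ g.logT := by
  cases g with
  | dt => change ContDiff ℝ ∞ fun x : BlowupAmbient n => x.2.2.2.2.1; fun_prop
  | _ => exact contDiff_const

theorem FlatGen.contDiff_velZ {n : ℕ} (g : FlatGen n) : ContDiff ℝ ∞ g.velZ := by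
  cases g with
  | rot j k =>
    have h1 := contDiff_ambient_coord j
    have h2 := contDiff_ambient_coord k
    change ContDiff ℝ ∞ fun x : BlowupAmbient n =>
      x.1 j • EuclideanSpace.single k (1 : ℝ) - x.1 k • EuclideanSpace.single j (1 : ℝ)
    fun_prop
  | dz j =>
    change ContDiff ℝ ∞ fun x : BlowupAmbient n =>
      x.2.2.2.1 • (EuclideanSpace.single j (1 : ℝ) : EuclideanSpace ℝ (Fin n))
    fun_prop
  | _ => exact contDiff_const

theorem FlatGen.contDiff_lift {n : ℕ} (g : FlatGen n) : ContDiff ℝ ∞ g.lift := by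
  have h1 := g.contDiff_logZ
  have h2 := g.contDiff_logT
  have h3 := g.contDiff_velZ
  unfold FlatGen.lift
  fun_prop

theorem hasDerivAt_bracketT_line {n : ℕ} (Z v : Spacetime n) :
    HasDerivAt (fun s : ℝ => bracketT (Z + s • v)) (Z.2 * v.2 / bracketT Z) 0 := by
  have h : HasDerivAt (fun s : ℝ => 1 + (Z + s • v).2 ^ 2) (2 * Z.2 * v.2) 0 := by
    have h1 : HasDerivAt (fun s : ℝ => Z.2 + s * v.2) v.2 0 := by
      simpa using ((hasDerivAt_id (0 : ℝ)).mul_const v.2).const_add Z.2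
    simpa [mul_comm, mul_assoc] using (h1.pow 2).const_add 1
  refine (h.sqrt (by positivity)).congr_deriv ?_
  rw [zero_smul, add_zero, bracketT]
  field_simp

theorem hasDerivAt_bracketZ_line {n : ℕ} (Z v : Spacetime n) :
    HasDerivAt (fun s : ℝ => bracketZ (Z + s • v))
      ((inner ℝ Z.1 v.1 + Z.2 * v.2) / bracketZ Z) 0 := by
  have h : HasDerivAt (fun s : ℝ => 1 + ‖(Z + s • v).1‖ ^ 2 + (Z + s • v).2 ^ 2)
      (2 * inner ℝ Z.1 v.1 + 2 * Z.2 * v.2) 0 := by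
    have h1 : HasDerivAt (fun s : ℝ => Z.2 + s * v.2) v.2 0 := by
      simpa using ((hasDerivAt_id (0 : ℝ)).mul_const v.2).const_add Z.2
    have h2 : HasDerivAt (fun s : ℝ => Z.1 + s • v.1) v.1 0 := by
      simpa using ((hasDerivAt_id (0 : ℝ)).smul_const v.1).const_add Z.1
    have h3 := h2.norm_sq
    refine ((h3.const_add 1).add (h1.pow 2)).congr_deriv ?_
    simp
  refine (h.sqrt (by positivity)).congr_deriv ?_
  rw [zero_smul, add_zero, bracketZ]
  field_simp

theorem fderiv_eq_of_hasDerivAt_line {n : ℕ} {F : Type*} [NormedAddCommGroup F] [NormedSpace ℝ F]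
    {f : Spacetime n → F} {Z v : Spacetime n} {d : F} (hf : DifferentiableAt ℝ f Z)
    (h : HasDerivAt (fun s : ℝ => f (Z + s • v)) d 0) : fderiv ℝ f Z v = d := by
  rw [← hf.lineDeriv_eq_fderiv]
  exact h.deriv

theorem hasDerivAt_bracketT_gen {n : ℕ} (g : FlatGen n) (Z : Spacetime n) :
    HasDerivAt (fun s : ℝ => bracketT (Z + s • g.vec Z))
      (bracketT Z * g.logT (toAmbient Z)) 0 := by
  refine (hasDerivAt_bracketT_line Z (g.vec Z)).congr_deriv ?_
  have hT := bracketT_pos Z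
  cases g <;> simp [FlatGen.logT, FlatGen.vec, toAmbient]
  field_simp

theorem hasDerivAt_bracketZ_gen {n : ℕ} (g : FlatGen n) (Z : Spacetime n) :
    HasDerivAt (fun s : ℝ => bracketZ (Z + s • g.vec Z))
      (bracketZ Z * g.logZ (toAmbient Z)) 0 := by
  refine (hasDerivAt_bracketZ_line Z (g.vec Z)).congr_deriv ?_
  have hT := bracketT_pos Z
  have hR := bracketZ_pos Z
  cases g with
  | dz j => simp [FlatGen.logZ, FlatGen.vec, toAmbient, inner_smul_right,
      EuclideanSpace.inner_single_right]; field_simp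
  | dt => simp [FlatGen.logZ, FlatGen.vec, toAmbient]; field_simp
  | weight => simp [FlatGen.logZ, FlatGen.vec]
  | rot j k => simp [FlatGen.logZ, FlatGen.vec, inner_smul_right, inner_sub_right,
      EuclideanSpace.inner_single_right]; ring_nf; simp

/-- The vector fields of the generators extend to smooth fields on the ambient space of `X`. -/
theorem fderiv_toAmbient {n : ℕ} (g : FlatGen n) (Z : Spacetime n) :
    fderiv ℝ toAmbient Z (g.vec Z) = g.lift (toAmbient Z) := by
  refine fderiv_eq_of_hasDerivAt_line ((contDiff_toAmbient n).differentiable (by simp) Z) ?_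
  have hT := bracketT_pos Z
  have hR := bracketZ_pos Z
  have dT := hasDerivAt_bracketT_gen g Z
  have dR := hasDerivAt_bracketZ_gen g Z
  have dz : HasDerivAt (fun s : ℝ => (Z + s • g.vec Z).1)
      (bracketZ Z • g.velZ (toAmbient Z)) 0 := by
    have h2 : HasDerivAt (fun s : ℝ => Z.1 + s • (g.vec Z).1) (g.vec Z).1 0 := by
      simpa using ((hasDerivAt_id (0 : ℝ)).smul_const (g.vec Z).1).const_add Z.1
    refine h2.congr_deriv ?_
    cases g with
    | dz j => simp [FlatGen.velZ, FlatGen.vec, toAmbient, smul_smul, mul_div_cancel₀ _ hR.ne']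
    | rot j k => simp [FlatGen.velZ, FlatGen.vec, toAmbient, smul_smul, smul_sub,
        mul_inv_cancel_left₀ hR.ne']
    | _ => simp [FlatGen.velZ, FlatGen.vec]
  have dt : HasDerivAt (fun s : ℝ => (Z + s • g.vec Z).2) (bracketT Z * g.velT) 0 := by
    have h2 : HasDerivAt (fun s : ℝ => Z.2 + s * (g.vec Z).2) (g.vec Z).2 0 := by
      simpa using ((hasDerivAt_id (0 : ℝ)).mul_const (g.vec Z).2).const_add Z.2
    refine h2.congr_deriv ?_
    cases g <;> simp [FlatGen.velT, FlatGen.vec]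
  have hR0 : bracketZ (Z + (0 : ℝ) • g.vec Z) ≠ 0 := (bracketZ_pos _).ne'
  have hT0 : bracketT (Z + (0 : ℝ) • g.vec Z) ≠ 0 := (bracketT_pos _).ne'
  have key := ((dR.inv hR0).smul dz).prodMk <| (dt.div dR hR0).prodMk <|
    ((hasDerivAt_const (0 : ℝ) (1 : ℝ)).div dR hR0).prodMk <| (dT.div dR hR0).prodMk <|
    (dt.div dT hT0).prodMk ((hasDerivAt_const (0 : ℝ) (1 : ℝ)).div dT hT0)
  refine key.congr_deriv ?_
  simp only [zero_smul, add_zero, FlatGen.lift, Pi.inv_apply]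
  generalize g.velZ (toAmbient Z) = A
  generalize g.logZ (toAmbient Z) = B
  generalize g.logT (toAmbient Z) = C
  simp only [toAmbient]
  ext i
  · simp
    field_simp
    ring
  all_goals simp
  all_goals field_simp

theorem smoothX_der {n : ℕ} (g : FlatGen n) {a : Spacetime n → ℂ} (ha : a ∈ smoothX n) :
    g.der a ∈ smoothX n := by
  obtain ⟨F, hF, h⟩ := mem_smoothX_iff.1 ha
  refine mem_smoothX_iff.2 ⟨fun x => -Complex.I * fderiv ℝ F x (g.lift x),
    contDiff_const.mul ((hF.fderiv_right (m := ∞) (by simp)).clm_apply g.contDiff_lift),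
    fun Z => ?_⟩
  obtain rfl : a = F ∘ toAmbient := funext h
  rw [FlatGen.der, fderiv_comp _ (hF.differentiable (by simp) _)
    ((contDiff_toAmbient n).differentiable (by simp) _), ContinuousLinearMap.comp_apply,
    fderiv_toAmbient]

/-! ### Commutators of the generators -/

/-- Multiplication of distributions by an element of `C^∞(X)`. -/
def mulX {n : ℕ} (a : Spacetime n → ℂ) (ha : a ∈ smoothX n) : DistrOp n :=
  mulOp a (contDiff_of_mem_smoothX ha)

theorem mulX_mem_flatModuleLE {n d : ℕ} {a : Spacetime n → ℂ} (ha : a ∈ smoothX n) :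
    mulX a ha ∈ flatModuleLE n d := Submodule.subset_span ⟨a, ha, Or.inl rfl⟩

theorem mulX_mul_op_mem_flatModuleLE {n d : ℕ} {a : Spacetime n → ℂ} (ha : a ∈ smoothX n)
    {g : FlatGen n} (hg : g.order ≤ d) : mulX a ha * g.op ∈ flatModuleLE n d :=
  Submodule.subset_span ⟨a, ha, Or.inr ⟨g, hg, rfl⟩⟩

theorem mulX_one {n : ℕ} : mulX (fun _ : Spacetime n => 1) (smoothX_const 1) = 1 :=
  (mulOp_const 1 _).trans (one_smul _ _)

theorem op_mem_flatModuleLE {n d : ℕ} {g : FlatGen n} (hg : g.order ≤ d) :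
    g.op ∈ flatModuleLE n d := by
  simpa [mulX_one] using mulX_mul_op_mem_flatModuleLE (smoothX_const 1) hg

theorem one_mem_flatModuleLE {n d : ℕ} : (1 : DistrOp n) ∈ flatModuleLE n d := by
  simpa [mulX_one] using mulX_mem_flatModuleLE (d := d) (smoothX_const (n := n) 1)

theorem mulX_mul {n : ℕ} {a b : Spacetime n → ℂ} (ha : a ∈ smoothX n) (hb : b ∈ smoothX n) :
    mulX a ha * mulX b hb = mulX _ (smoothX_mul ha hb) := mulOp_mul _ _

theorem FlatGen.op_mul_mulX {n : ℕ} (g : FlatGen n) {a : Spacetime n → ℂ} (ha : a ∈ smoothX n) :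
    g.op * mulX a ha = mulX a ha * g.op + mulX (g.der a) (smoothX_der g ha) :=
  g.op_mul_mulOp _

theorem mulOp_eq_zero {n : ℕ} {a : Spacetime n → ℂ} (ha : ContDiff ℝ ∞ a) (h : ∀ Z, a Z = 0) :
    mulOp a ha = 0 := by
  rw [mulOp_congr ha contDiff_const h, mulOp_const, zero_smul]

theorem dzOp_mul_zOp {n : ℕ} (j k : Fin n) :
    dzOp j * zOp k = zOp k * dzOp j + (if k = j then -Complex.I else 0) • (1 : DistrOp n) := by
  rw [dzOp, zOp_eq, dOp_mul_mulOp]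
  congr 1
  rw [← mulOp_const _ contDiff_const]
  refine mulOp_congr _ _ fun Z => ?_
  have : fderiv ℝ (fun Z : Spacetime n => (Z.1 k : ℂ)) Z (EuclideanSpace.single j 1, 0) =
      if k = j then 1 else 0 := by
    let L : Spacetime n →L[ℝ] ℂ := Complex.ofRealCLM ∘L (EuclideanSpace.proj (𝕜 := ℝ) k) ∘L
      ContinuousLinearMap.fst ℝ _ _
    change fderiv ℝ L Z _ = _
    rw [L.fderiv]
    simp [L, apply_ite]
  rw [this]
  split_ifs <;> simp

theorem dtOp_mul_zOp {n : ℕ} (k : Fin n) : dtOp n * zOp k = zOp k * dtOp n := by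
  rw [dtOp, zOp_eq, dOp_mul_mulOp]
  have : fderiv ℝ (fun Z : Spacetime n => (Z.1 k : ℂ)) = fun _ => Complex.ofRealCLM ∘L
      (EuclideanSpace.proj (𝕜 := ℝ) k) ∘L ContinuousLinearMap.fst ℝ _ ℝ := by
    funext Z
    let L : Spacetime n →L[ℝ] ℂ := Complex.ofRealCLM ∘L (EuclideanSpace.proj (𝕜 := ℝ) k) ∘L
      ContinuousLinearMap.fst ℝ _ _
    exact L.fderiv
  exact add_eq_left.2 (mulOp_eq_zero _ fun Z => by rw [this]; simp)

theorem dzOp_mul_bracketTOp {n : ℕ} (j : Fin n) :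
    dzOp j * bracketTOp n = bracketTOp n * dzOp j := by
  rw [dzOp, bracketTOp_eq, dOp_mul_mulOp]
  refine add_eq_left.2 (mulOp_eq_zero _ fun Z => ?_)
  rw [fderiv_eq_of_hasDerivAt_line
    ((contDiff_bracketT n).ofReal_comp.differentiable (by simp) Z)
    (hasDerivAt_bracketT_line Z _).ofReal_comp]
  simp

/-- `t/⟨t⟩` as an element of `C^∞(X)`. -/
theorem timeRatio_mem_smoothX (n : ℕ) :
    (fun Z : Spacetime n => ((Z.2 / bracketT Z : ℝ) : ℂ)) ∈ smoothX n :=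
  smoothX_of_real (F := fun x => x.2.2.2.2.1) (by fun_prop) fun _ => rfl

theorem dtOp_mul_bracketTOp (n : ℕ) :
    dtOp n * bracketTOp n = bracketTOp n * dtOp n +
      mulX _ (smoothX_mul (smoothX_const (-Complex.I)) (timeRatio_mem_smoothX n)) := by
  rw [dtOp, bracketTOp_eq, dOp_mul_mulOp]
  congr 1
  refine mulOp_congr _ _ fun Z => ?_
  rw [fderiv_eq_of_hasDerivAt_line
      ((contDiff_bracketT n).ofReal_comp.differentiable (by simp) Z)
      (hasDerivAt_bracketT_line Z _).ofReal_comp]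
  simp

theorem der_weight {n : ℕ} (g : FlatGen n) (Z : Spacetime n) :
    g.der (FlatGen.pot .weight) Z = -Complex.I *
      (((bracketZ Z / bracketT Z) *
        (g.logZ (toAmbient Z) - g.logT (toAmbient Z)) : ℝ) : ℂ) := by
  have hT := bracketT_pos Z
  rw [FlatGen.der, fderiv_eq_of_hasDerivAt_line (f := FlatGen.pot (n := n) .weight)
    ((FlatGen.contDiff_pot _).differentiable (by simp) Z)
    (((hasDerivAt_bracketZ_gen g Z).div (hasDerivAt_bracketT_gen g Z)
      (bracketT_pos _).ne').ofReal_comp)]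
  congr 2
  simp only [zero_smul, add_zero]
  field_simp

theorem commutator_weight {n : ℕ} (g : FlatGen n) :
    g.op * FlatGen.weight.op - FlatGen.weight.op * g.op ∈
      flatModuleLE n (g.order + FlatGen.weight.order (n := n) - 1) := by
  have h : g.op * FlatGen.weight.op - FlatGen.weight.op * g.op =
      mulOp _ ((FlatGen.contDiff_pot (n := n) .weight).genDer g) := by
    change g.op * weightOp n - weightOp n * g.op = _
    rw [weightOp_eq, g.op_mul_mulOp, add_sub_cancel_left]
  rw [h]
  cases g with
  | dz j =>
    have hm : (fun Z : Spacetime n => -Complex.I * ((Z.1 j / bracketZ Z : ℝ) : ℂ)) ∈ smoothX n :=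
      smoothX_mul (smoothX_const _) (smoothX_of_real (contDiff_ambient_coord j) fun Z => by
        simp [toAmbient]; ring)
    rw [mulOp_congr _ (contDiff_of_mem_smoothX hm) fun Z => ?_]
    · exact mulX_mem_flatModuleLE hm
    · rw [der_weight]
      have hT := bracketT_pos Z
      have hZ := bracketZ_pos Z
      congr 2
      simp [FlatGen.logZ, FlatGen.logT, toAmbient]
      field_simp
  | dt =>
    have hm : (fun Z : Spacetime n => -Complex.I * ((Z.2 / bracketZ Z : ℝ) : ℂ)) ∈ smoothX n :=
      smoothX_mul (smoothX_const _) (smoothX_of_real (F := fun x => x.2.1) (by fun_prop)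
        fun Z => rfl)
    have hm' : (fun Z : Spacetime n => Complex.I * ((Z.2 / bracketT Z : ℝ) : ℂ)) ∈ smoothX n :=
      smoothX_mul (smoothX_const _) (timeRatio_mem_smoothX n)
    have h2 : mulOp _ ((FlatGen.contDiff_pot (n := n) .weight).genDer .dt) =
        mulX _ hm + mulX _ hm' * FlatGen.weight.op := by
      change _ = _ + _ * weightOp n
      rw [weightOp_eq, mulX, mulX, mulOp_mul, ← mulOp_add]
      refine mulOp_congr _ _ fun Z => ?_
      rw [der_weight]
      have hT := bracketT_pos Z
      have hZ := bracketZ_pos Z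
      simp only [FlatGen.logZ, FlatGen.logT, toAmbient, FlatGen.pot]
      have e : bracketZ Z / bracketT Z * (bracketT Z / bracketZ Z * (Z.2 / bracketZ Z) -
          Z.2 / bracketT Z) = Z.2 / bracketZ Z - Z.2 / bracketT Z * (bracketZ Z / bracketT Z) := by
        field_simp
      rw [e]
      push_cast
      ring
    rw [h2]
    exact add_mem (mulX_mem_flatModuleLE hm)
      (mulX_mul_op_mem_flatModuleLE hm' (by simp [FlatGen.order]))
  | _ =>
    have h2 : ∀ g : FlatGen n, (∀ x, g.logZ x = 0) → (∀ x, g.logT x = 0) →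
        mulOp _ ((FlatGen.contDiff_pot (n := n) .weight).genDer g) = 0 := fun g h1 h2 =>
      mulOp_eq_zero _ fun Z => by rw [der_weight, h1, h2]; simp
    rw [h2 _ (fun _ => rfl) fun _ => rfl]
    exact zero_mem _

theorem zOp_comm {n : ℕ} (j k : Fin n) : zOp j * zOp k = zOp k * zOp j := mulOp_comm _ _

theorem zOp_bracketTOp_comm {n : ℕ} (j : Fin n) :
    zOp j * bracketTOp n = bracketTOp n * zOp j := mulOp_comm _ _

theorem dzOp_comm {n : ℕ} (j k : Fin n) : dzOp j * dzOp k = dzOp k * dzOp j := dOp_comm _ _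

theorem dtOp_dzOp_comm {n : ℕ} (k : Fin n) : dtOp n * dzOp k = dzOp k * dtOp n := dOp_comm _ _

theorem commutator_dz_dz {n : ℕ} (j k : Fin n) :
    (FlatGen.dz j).op * (FlatGen.dz k).op - (FlatGen.dz k).op * (FlatGen.dz j).op = 0 := by
  simp only [FlatGen.op]
  rw [mul_assoc, ← mul_assoc (dzOp j), dzOp_mul_bracketTOp, mul_assoc (bracketTOp n) (dzOp k),
    ← mul_assoc (dzOp k) (bracketTOp n), dzOp_mul_bracketTOp, mul_assoc _ (dzOp j),
    dzOp_comm, mul_assoc _ (dzOp k), sub_self]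

theorem commutator_dt_dz {n : ℕ} (k : Fin n) :
    FlatGen.dt.op * (FlatGen.dz k).op - (FlatGen.dz k).op * FlatGen.dt.op =
      mulX _ (smoothX_mul (smoothX_const (-Complex.I)) (timeRatio_mem_smoothX n)) *
        (FlatGen.dz k).op := by
  simp only [FlatGen.op]
  rw [mul_assoc, ← mul_assoc (dtOp n), dtOp_mul_bracketTOp, mul_assoc (bracketTOp n) (dzOp k),
    ← mul_assoc (dzOp k) (bracketTOp n), dzOp_mul_bracketTOp, add_mul, mul_add,
    mul_assoc _ (dtOp n), dtOp_dzOp_comm, mul_assoc _ (dzOp k), add_sub_cancel_left,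
    ← mul_assoc, ← mul_assoc, bracketTOp_eq, mulX, mulOp_comm]

theorem zOp_mul_dzOp_mul_dzOp {n : ℕ} (j k l : Fin n) :
    zOp j * dzOp k * (bracketTOp n * dzOp l) = bracketTOp n * dzOp l * (zOp j * dzOp k) +
      (if j = l then Complex.I else 0) • (bracketTOp n * dzOp k) := by
  have h : dzOp l * (zOp j * dzOp k) = zOp j * dzOp k * dzOp l +
      (if j = l then -Complex.I else 0) • dzOp k := by
    rw [← mul_assoc, dzOp_mul_zOp, add_mul, mul_assoc, mul_assoc, dzOp_comm l k, smul_mul_assoc,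
      one_mul]
  rw [mul_assoc (bracketTOp n), h, mul_add, mul_smul_comm, mul_assoc (zOp j),
    ← mul_assoc (dzOp k), dzOp_mul_bracketTOp, mul_assoc (bracketTOp n), ← mul_assoc (zOp j),
    zOp_bracketTOp_comm, mul_assoc, mul_assoc, add_assoc, ← add_smul]
  split_ifs <;> simp

theorem zOp_mul_dzOp_mul_dtOp {n : ℕ} (j k : Fin n) :
    zOp j * dzOp k * (bracketTOp n * dtOp n) = bracketTOp n * dtOp n * (zOp j * dzOp k) := by
  have h : dtOp n * (zOp j * dzOp k) = zOp j * dzOp k * dtOp n := by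
    rw [← mul_assoc, dtOp_mul_zOp, mul_assoc, dtOp_dzOp_comm, mul_assoc]
  rw [mul_assoc (bracketTOp n), h, mul_assoc (zOp j),
    ← mul_assoc (dzOp k), dzOp_mul_bracketTOp, mul_assoc (bracketTOp n), ← mul_assoc (zOp j),
    zOp_bracketTOp_comm, mul_assoc, mul_assoc]

theorem zOp_mul_dzOp_comm {n : ℕ} (j k l m : Fin n) :
    zOp j * dzOp k * (zOp l * dzOp m) = zOp l * dzOp m * (zOp j * dzOp k) +
      ((if l = k then -Complex.I else 0) • (zOp j * dzOp m) -
      (if j = m then -Complex.I else 0) • (zOp l * dzOp k)) := by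
  have h : ∀ j k l m : Fin n, zOp j * dzOp k * (zOp l * dzOp m) =
      zOp j * zOp l * (dzOp k * dzOp m) +
        (if l = k then -Complex.I else 0) • (zOp j * dzOp m) := fun j k l m => by
    rw [mul_assoc, ← mul_assoc (dzOp k), dzOp_mul_zOp, add_mul, mul_add, smul_mul_assoc, one_mul,
      mul_smul_comm]
    simp only [mul_assoc]
  rw [h, h, zOp_comm j l, dzOp_comm k m]
  abel

/-- The commutator of two generators has order less than the sum of their orders. -/
theorem commutator_mem {n : ℕ} (g h : FlatGen n) :
    g.op * h.op - h.op * g.op ∈ flatModuleLE n (g.order + h.order - 1) := by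
  have symm : ∀ {g h : FlatGen n},
      g.op * h.op - h.op * g.op ∈ flatModuleLE n (g.order + h.order - 1) →
      h.op * g.op - g.op * h.op ∈ flatModuleLE n (h.order + g.order - 1) := fun {g h} hm => by
    rw [← neg_sub, add_comm]
    exact neg_mem hm
  have rot_dz : ∀ j k l : Fin n, (FlatGen.rot j k).op * (FlatGen.dz l).op -
      (FlatGen.dz l).op * (FlatGen.rot j k).op ∈
      flatModuleLE n ((FlatGen.rot j k).order + (FlatGen.dz l).order - 1) := fun j k l => by
    have : (FlatGen.rot j k).op * (FlatGen.dz l).op - (FlatGen.dz l).op * (FlatGen.rot j k).op =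
        (if j = l then Complex.I else 0) • (FlatGen.dz k).op -
          (if k = l then Complex.I else 0) • (FlatGen.dz j).op := by
      simp only [FlatGen.op]
      rw [sub_mul, zOp_mul_dzOp_mul_dzOp, zOp_mul_dzOp_mul_dzOp, mul_sub]
      abel
    rw [this]
    exact sub_mem (Submodule.smul_mem _ _ (op_mem_flatModuleLE (by simp [FlatGen.order])))
      (Submodule.smul_mem _ _ (op_mem_flatModuleLE (by simp [FlatGen.order])))
  have rot_dt : ∀ j k : Fin n, (FlatGen.rot j k).op * FlatGen.dt.op -
      FlatGen.dt.op * (FlatGen.rot j k).op ∈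
      flatModuleLE n ((FlatGen.rot j k).order + FlatGen.dt.order (n := n) - 1) := fun j k => by
    have : (FlatGen.rot j k).op * FlatGen.dt.op - FlatGen.dt.op * (FlatGen.rot j k).op = 0 := by
      simp only [FlatGen.op]
      rw [sub_mul, zOp_mul_dzOp_mul_dtOp, zOp_mul_dzOp_mul_dtOp, mul_sub, sub_self]
    rw [this]
    exact zero_mem _
  have dt_dz : ∀ k : Fin n, FlatGen.dt.op * (FlatGen.dz k).op -
      (FlatGen.dz k).op * FlatGen.dt.op ∈
      flatModuleLE n (FlatGen.dt.order (n := n) + (FlatGen.dz k).order - 1) := fun k => by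
    rw [commutator_dt_dz]
    exact mulX_mul_op_mem_flatModuleLE _ (by simp [FlatGen.order])
  cases g with
  | weight => exact symm (commutator_weight h)
  | dz j =>
    cases h with
    | weight => exact commutator_weight _
    | dz k => rw [commutator_dz_dz]; exact zero_mem _
    | dt => exact symm (dt_dz j)
    | rot k l => exact symm (rot_dz k l j)
  | dt =>
    cases h with
    | weight => exact commutator_weight _
    | dz k => exact dt_dz k
    | dt => rw [sub_self]; exact zero_mem _
    | rot k l => exact symm (rot_dt k l)
  | rot j k =>
    cases h with
    | weight => exact commutator_weight _
    | dz l => exact rot_dz j k l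
    | dt => exact rot_dt j k
    | rot l m =>
      have : (FlatGen.rot j k).op * (FlatGen.rot l m).op -
          (FlatGen.rot l m).op * (FlatGen.rot j k).op =
          (if l = k then -Complex.I else 0) • (FlatGen.rot j m).op +
          (if j = m then -Complex.I else 0) • (FlatGen.rot k l).op -
          (if m = k then -Complex.I else 0) • (FlatGen.rot j l).op -
          (if j = l then -Complex.I else 0) • (FlatGen.rot k m).op := by
        simp only [FlatGen.op]
        rw [sub_mul, mul_sub, mul_sub, zOp_mul_dzOp_comm j k l m, zOp_mul_dzOp_comm j k m l,
          zOp_mul_dzOp_comm k j l m, zOp_mul_dzOp_comm k j m l, sub_mul, mul_sub, mul_sub]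
        simp only [eq_comm (a := k), eq_comm (a := j)]
        module
      rw [this]
      have hm : ∀ a b : Fin n, (FlatGen.rot a b).op ∈ flatModuleLE n
          ((FlatGen.rot j k).order + (FlatGen.rot l m).order - 1) := fun a b =>
        op_mem_flatModuleLE (by simp [FlatGen.order])
      exact sub_mem (sub_mem (add_mem (Submodule.smul_mem _ _ (hm _ _))
        (Submodule.smul_mem _ _ (hm _ _))) (Submodule.smul_mem _ _ (hm _ _)))
        (Submodule.smul_mem _ _ (hm _ _))

/-! ### Words in the generators -/

/-- The product of the generators in a list. -/
def wordOp {n : ℕ} (l : List (FlatGen n)) : DistrOp n := (l.map FlatGen.op).prod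

/-- The total order of a list of generators. -/
def wordOrd {n : ℕ} (l : List (FlatGen n)) : ℕ := (l.map FlatGen.order).sum

theorem wordOp_cons {n : ℕ} (g : FlatGen n) (l : List (FlatGen n)) :
    wordOp (g :: l) = g.op * wordOp l := by simp [wordOp]

theorem wordOrd_cons {n : ℕ} (g : FlatGen n) (l : List (FlatGen n)) :
    wordOrd (g :: l) = g.order + wordOrd l := by simp [wordOrd]

theorem FlatGen.one_le_order {n : ℕ} (g : FlatGen n) : 1 ≤ g.order := by
  cases g <;> simp [FlatGen.order]

theorem FlatGen.order_le_two {n : ℕ} (g : FlatGen n) : g.order ≤ 2 := by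
  cases g <;> simp [FlatGen.order]

theorem length_le_wordOrd {n : ℕ} (l : List (FlatGen n)) : l.length ≤ wordOrd l := by
  induction l with
  | nil => simp
  | cons g l ih =>
    rw [wordOrd_cons, List.length_cons]
    have := g.one_le_order
    omega

/-- The span over `C^∞(X)` of the words of order at most `m`. -/
def wordSpan (n m : ℕ) : Submodule ℂ (DistrOp n) :=
  Submodule.span ℂ {P | ∃ (a : Spacetime n → ℂ) (ha : a ∈ smoothX n) (l : List (FlatGen n)),
    wordOrd l ≤ m ∧ P = mulX a ha * wordOp l}

theorem mulX_mul_wordOp_mem {n m : ℕ} {a : Spacetime n → ℂ} (ha : a ∈ smoothX n)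
    {l : List (FlatGen n)} (hl : wordOrd l ≤ m) : mulX a ha * wordOp l ∈ wordSpan n m :=
  Submodule.subset_span ⟨a, ha, l, hl, rfl⟩

theorem wordOp_mem {n m : ℕ} {l : List (FlatGen n)} (hl : wordOrd l ≤ m) :
    wordOp l ∈ wordSpan n m := by
  simpa [mulX_one] using mulX_mul_wordOp_mem (smoothX_const 1) hl

theorem wordSpan_mono {n m m' : ℕ} (h : m ≤ m') : wordSpan n m ≤ wordSpan n m' :=
  Submodule.span_mono fun _ ⟨a, ha, l, hl, hP⟩ => ⟨a, ha, l, hl.trans h, hP⟩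

theorem mulX_mul_mem {n m : ℕ} {a : Spacetime n → ℂ} (ha : a ∈ smoothX n) {P : DistrOp n}
    (hP : P ∈ wordSpan n m) : mulX a ha * P ∈ wordSpan n m := by
  induction hP using Submodule.span_induction with
  | mem P h =>
    obtain ⟨b, hb, l, hl, rfl⟩ := h
    rw [← mul_assoc, mulX_mul]
    exact mulX_mul_wordOp_mem _ hl
  | zero => rw [mul_zero]; exact zero_mem _
  | add P Q _ _ hP hQ => rw [mul_add]; exact add_mem hP hQ
  | smul c P _ hP => rw [mul_smul_comm]; exact Submodule.smul_mem _ _ hP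

/-- A generator is commuted past the coefficients by the Leibniz rule. -/
theorem op_mul_mem {n m : ℕ} (g : FlatGen n) {P : DistrOp n} (hP : P ∈ wordSpan n m) :
    g.op * P ∈ wordSpan n (g.order + m) := by
  induction hP using Submodule.span_induction with
  | mem P h =>
    obtain ⟨b, hb, l, hl, rfl⟩ := h
    rw [← mul_assoc, g.op_mul_mulX, add_mul, mul_assoc, ← wordOp_cons]
    exact add_mem (mulX_mul_wordOp_mem _ (by rw [wordOrd_cons]; omega))
      (mulX_mul_wordOp_mem _ (by omega))
  | zero => rw [mul_zero]; exact zero_mem _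
  | add P Q _ _ hP hQ => rw [mul_add]; exact add_mem hP hQ
  | smul c P _ hP => rw [mul_smul_comm]; exact Submodule.smul_mem _ _ hP

theorem flatModuleLE_mul_mem {n m d : ℕ} {Q P : DistrOp n} (hQ : Q ∈ flatModuleLE n d)
    (hP : P ∈ wordSpan n m) : Q * P ∈ wordSpan n (d + m) := by
  induction hQ using Submodule.span_induction with
  | mem Q h =>
    obtain ⟨b, hb, rfl | ⟨g, hg, rfl⟩⟩ := h
    · exact wordSpan_mono (by omega) (mulX_mul_mem hb hP)
    · rw [mul_assoc]
      exact mulX_mul_mem hb (wordSpan_mono (by omega) (op_mul_mem g hP))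
  | zero => rw [zero_mul]; exact zero_mem _
  | add P Q _ _ hP hQ => rw [add_mul]; exact add_mem hP hQ
  | smul c P _ hP => rw [smul_mul_assoc]; exact Submodule.smul_mem _ _ hP

theorem one_mem_wordSpan {n m : ℕ} : (1 : DistrOp n) ∈ wordSpan n m :=
  wordOp_mem (l := []) (Nat.zero_le _)

/-- Moving all coefficients to the left, an operator of order at most `j` is a combination of
words of order at most `j`. -/
theorem flatOrdLE_le_wordSpan (n j : ℕ) : flatOrdLE n j ≤ wordSpan n j := by
  refine Submodule.span_le.2 ?_
  rintro P ⟨l, hl, hj, rfl⟩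
  refine wordSpan_mono hj ?_
  clear hj
  induction l with
  | nil => exact one_mem_wordSpan
  | cons p l ih =>
    simp only [List.map_cons, List.prod_cons, List.sum_cons]
    exact flatModuleLE_mul_mem (hl p (by simp)).2 (ih fun q hq => hl q (by simp [hq]))

theorem one_mem_flatModule (n : ℕ) : (1 : DistrOp n) ∈ flatModule n := one_mem_flatModuleLE

theorem flatModule_pow_mono {n j k : ℕ} (h : j ≤ k) : flatModule n ^ j ≤ flatModule n ^ k := by
  induction k, h using Nat.le_induction with
  | base => exact le_rfl
  | succ k _ ih =>
    refine ih.trans fun P hP => ?_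
    rw [Submodule.pow_succ, ← mul_one P]
    exact Submodule.mul_mem_mul hP (one_mem_flatModule n)

/-- Products of elements of the flat module of total order at most `k`, each factor of order at
least one, belong to the reduced power. -/
theorem prod_mem_flatReduced {n k : ℕ} (l : List (ℕ × DistrOp n))
    (hl : ∀ p ∈ l, 1 ≤ p.1 ∧ p.1 ≤ 2 ∧ p.2 ∈ flatModuleLE n p.1)
    (hk : (l.map Prod.fst).sum ≤ k) : (l.map Prod.snd).prod ∈ flatReduced n k := by
  refine ⟨?_, Submodule.subset_span ⟨l, fun p hp => (hl p hp).2, hk, rfl⟩⟩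
  have h : l.length ≤ (l.map Prod.fst).sum := by
    clear hk
    induction l with
    | nil => simp
    | cons p l ih =>
      have h1 := (hl p (by simp)).1
      have h2 := ih fun q hq => hl q (by simp [hq])
      simp only [List.length_cons, List.map_cons, List.sum_cons]
      omega
  refine flatModule_pow_mono (h.trans hk) ?_
  clear h hk
  induction l with
  | nil => exact Submodule.one_le.1 le_rfl
  | cons p l ih =>
    have e : flatModule n ^ (l.length + 1) = flatModule n * flatModule n ^ l.length :=
      if h : l.length = 0 then by
        rw [h, zero_add, Submodule.pow_one, Submodule.pow_zero, Submodule.mul_one]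
      else Submodule.pow_succ' _ h
    rw [List.map_cons, List.prod_cons, List.length_cons, e]
    refine Submodule.mul_mem_mul ?_ (ih fun q hq => hl q (by simp [hq]))
    obtain ⟨_, h2, h3⟩ := hl p (by simp)
    refine Submodule.span_mono ?_ h3
    rintro Q ⟨a, ha, h⟩
    exact ⟨a, ha, h.imp id fun ⟨g, _, hQ⟩ => ⟨g, g.order_le_two, hQ⟩⟩

theorem wordOp_mem_flatReduced {n k : ℕ} {l : List (FlatGen n)} (hl : wordOrd l ≤ k) :
    wordOp l ∈ flatReduced n k := by
  have := prod_mem_flatReduced (k := k) (l.map fun g => (g.order, g.op))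
    (by
      intro p hp
      obtain ⟨g, _, rfl⟩ := List.mem_map.1 hp
      exact ⟨g.one_le_order, g.order_le_two, op_mem_flatModuleLE le_rfl⟩)
    (by simpa [wordOrd, Function.comp_def] using hl)
  simpa [wordOp, Function.comp_def] using this

/-- Reordering a word changes it by words of smaller order. -/
theorem wordOp_sub_mem_of_perm {n : ℕ} {l l' : List (FlatGen n)} (h : l.Perm l') :
    ∀ m, wordOrd l ≤ m + 1 → wordOp l - wordOp l' ∈ wordSpan n m := by
  induction h with
  | nil => intro m _; rw [sub_self]; exact zero_mem _
  | @cons g l l' h ih =>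
    intro m hm
    rw [wordOp_cons, wordOp_cons, ← mul_sub]
    rw [wordOrd_cons] at hm
    rcases Nat.eq_zero_or_pos (wordOrd l) with h0 | h0
    · have : l = [] := List.length_eq_zero_iff.1 (by have := length_le_wordOrd l; omega)
      subst this
      rw [List.nil_perm.1 h, sub_self, mul_zero]
      exact zero_mem _
    · exact wordSpan_mono (by omega) (op_mul_mem g (ih (wordOrd l - 1) (by omega)))
  | swap g h l =>
    intro m hm
    simp only [wordOp_cons]
    rw [wordOrd_cons, wordOrd_cons] at hm
    rw [← mul_assoc, ← mul_assoc, ← sub_mul]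
    have := g.one_le_order
    exact wordSpan_mono (by omega) (flatModuleLE_mul_mem (commutator_mem h g)
      (wordOp_mem le_rfl))
  | @trans l₁ l₂ l₃ h₁ h₂ ih₁ ih₂ =>
    intro m hm
    have : wordOrd l₂ = wordOrd l₁ := ((h₁.map _).sum_eq).symm
    rw [← sub_add_sub_cancel _ (wordOp l₂)]
    exact add_mem (ih₁ m hm) (ih₂ m (this ▸ hm))

theorem mem_flatGens {n : ℕ} (g : FlatGen n) : g ∈ flatGens n := by
  cases g <;> simp [flatGens]

theorem nodup_flatGens (n : ℕ) : (flatGens n).Nodup := by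
  unfold flatGens
  refine List.Nodup.append (List.Nodup.append ?_ (by simp) ?_) ?_ ?_
  · exact (List.nodup_finRange n).map fun _ _ h => by simpa using h
  · intro g h1 h2
    obtain ⟨j, _, rfl⟩ := List.mem_map.1 h1
    simp at h2
  · refine List.nodup_flatMap.2 ⟨fun j _ => (List.nodup_finRange n).map
      fun _ _ h => by simpa using h, ?_⟩
    refine (List.nodup_finRange n).imp fun {j k} hjk g h1 h2 => hjk ?_
    obtain ⟨_, _, rfl⟩ := List.mem_map.1 h1
    obtain ⟨_, _, h⟩ := List.mem_map.1 h2
    simp at h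
    exact h.1.symm
  · intro g h1 h2
    simp only [List.mem_flatMap, List.mem_map] at h2
    obtain ⟨j, _, k, _, rfl⟩ := h2
    simp at h1

instance (n : ℕ) : Finite (FlatGen n) :=
  Set.finite_univ_iff.1 ((List.finite_toSet (flatGens n)).subset fun g _ => mem_flatGens g)

/-- The ordered word with prescribed multiplicities. -/
def sortedWord {n : ℕ} (α : FlatGen n → ℕ) : List (FlatGen n) :=
  (flatGens n).flatMap fun g => List.replicate (α g) g

theorem wordOp_sortedWord {n : ℕ} (α : FlatGen n → ℕ) : wordOp (sortedWord α) = flatMonomial α := by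
  unfold wordOp sortedWord flatMonomial
  induction flatGens n with
  | nil => rfl
  | cons g l ih => simp [ih]

theorem wordOrd_sortedWord {n : ℕ} (α : FlatGen n → ℕ) :
    wordOrd (sortedWord α) = flatMonomialOrder α := by
  unfold wordOrd sortedWord flatMonomialOrder
  induction flatGens n with
  | nil => rfl
  | cons g l ih => simp [ih]

open Classical in
theorem perm_sortedWord {n : ℕ} (l : List (FlatGen n)) :
    l.Perm (sortedWord fun g => l.count g) := by
  refine List.perm_iff_count.2 fun g => ?_
  have key : ∀ L : List (FlatGen n), L.Nodup →
      (L.flatMap fun g' => List.replicate (l.count g') g').count g =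
      if g ∈ L then l.count g else 0 := by
    intro L
    induction L with
    | nil => simp
    | cons a L ih =>
      intro h
      rw [List.nodup_cons] at h
      rw [List.flatMap_cons, List.count_append, ih h.2, List.count_replicate]
      by_cases hg : a = g
      · subst hg; simp [h.1]
      · simp [hg, Ne.symm hg]
  rw [sortedWord, key _ (nodup_flatGens n), if_pos (mem_flatGens g)]

/-- The span over `C^∞(X)` of the ordered monomials of order at most `m`. -/
def monomialSpan (n m : ℕ) : Submodule ℂ (DistrOp n) :=
  Submodule.span ℂ {P | ∃ (a : Spacetime n → ℂ) (ha : a ∈ smoothX n) (α : FlatGen n → ℕ),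
    flatMonomialOrder α ≤ m ∧ P = mulX a ha * flatMonomial α}

theorem mulX_mul_mem_monomialSpan {n m : ℕ} {a : Spacetime n → ℂ} (ha : a ∈ smoothX n)
    {P : DistrOp n} (hP : P ∈ monomialSpan n m) : mulX a ha * P ∈ monomialSpan n m := by
  induction hP using Submodule.span_induction with
  | mem P h =>
    obtain ⟨b, hb, α, hα, rfl⟩ := h
    rw [← mul_assoc, mulX_mul]
    exact Submodule.subset_span ⟨_, _, α, hα, rfl⟩
  | zero => rw [mul_zero]; exact zero_mem _
  | add P Q _ _ hP hQ => rw [mul_add]; exact add_mem hP hQ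
  | smul c P _ hP => rw [mul_smul_comm]; exact Submodule.smul_mem _ _ hP

/-- Sorting the letters and induction on the order: words are combinations of ordered
monomials. -/
theorem wordSpan_le_monomialSpan (n m : ℕ) : wordSpan n m ≤ monomialSpan n m := by
  classical
  induction m using Nat.strong_induction_on with
  | _ m ih =>
  refine Submodule.span_le.2 ?_
  rintro P ⟨a, ha, l, hl, rfl⟩
  refine mulX_mul_mem_monomialSpan ha ?_
  have hp := perm_sortedWord l
  have h1 : wordOp (sortedWord fun g => l.count g) ∈ monomialSpan n m := by
    refine Submodule.subset_span ⟨_, smoothX_const 1, fun g => l.count g, ?_, ?_⟩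
    · rw [← wordOrd_sortedWord]
      exact ((hp.map _).sum_eq).symm.trans_le hl
    · rw [mulX_one, one_mul, wordOp_sortedWord]
  rcases Nat.eq_zero_or_pos m with rfl | hm
  · have : l = [] := List.length_eq_zero_iff.1 (by have := length_le_wordOrd l; omega)
    have h2 : sortedWord (fun g => l.count g) = [] := List.nil_perm.1 (this ▸ hp)
    rwa [h2, ← this] at h1
  · rw [← sub_add_cancel (wordOp l) (wordOp (sortedWord fun g => l.count g))]
    refine add_mem ?_ h1
    have h2 := ih (m - 1) (by omega) (wordOp_sub_mem_of_perm hp (m - 1) (by omega))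
    refine Submodule.span_mono ?_ h2
    rintro Q ⟨a, ha, α, hα, hQ⟩
    exact ⟨a, ha, α, by omega, hQ⟩

theorem finite_words (n m : ℕ) : {l : List (FlatGen n) | wordOrd l ≤ m}.Finite :=
  (List.finite_length_le (FlatGen n) m).subset fun l hl => (length_le_wordOrd l).trans hl

/-- The finitely many words of order at most `m`. -/
def words (n m : ℕ) : Finset (List (FlatGen n)) := (finite_words n m).toFinset

theorem mem_words {n m : ℕ} {l : List (FlatGen n)} : l ∈ words n m ↔ wordOrd l ≤ m := by
  simp [words]

theorem finite_monomials (n m : ℕ) : {α : FlatGen n → ℕ | flatMonomialOrder α ≤ m}.Finite := by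
  refine Set.Finite.subset (Set.Finite.pi' fun _ => Set.finite_Iic m) fun α hα g => ?_
  refine le_trans ?_ (show flatMonomialOrder α ≤ m from hα)
  refine le_trans ?_ (List.single_le_sum (fun _ _ => Nat.zero_le _) _
    (List.mem_map.2 ⟨g, mem_flatGens g, rfl⟩))
  exact Nat.le_mul_of_pos_right _ g.one_le_order

/-- Membership in a `C^∞(X)`-span of finitely many operators, with explicit coefficients. -/
theorem exists_coeff_of_mem_span {n : ℕ} {ι : Type*} (s : Finset ι) (f : ι → DistrOp n)
    {P : DistrOp n} (hP : P ∈ Submodule.span ℂ {P | ∃ (a : Spacetime n → ℂ) (ha : a ∈ smoothX n)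
      (i : ι), i ∈ s ∧ P = mulX a ha * f i}) :
    ∃ (a : ι → Spacetime n → ℂ) (ha : ∀ i, a i ∈ smoothX n),
      P = ∑ i ∈ s, mulX (a i) (ha i) * f i := by
  classical
  induction hP using Submodule.span_induction with
  | mem P h =>
    obtain ⟨b, hb, i, hi, rfl⟩ := h
    have h0 : ∀ i', (if i' = i then b else fun _ => 0) ∈ smoothX n := fun i' => by
      split_ifs
      exacts [hb, smoothX_const 0]
    refine ⟨fun i' => if i' = i then b else fun _ => 0, h0, ?_⟩
    rw [Finset.sum_eq_single_of_mem i hi]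
    · simp
    · intro i' _ hne
      have : mulX _ (h0 i') = 0 := mulOp_eq_zero _ fun Z => by simp [hne]
      rw [this, zero_mul]
  | zero =>
    refine ⟨fun _ _ => 0, fun _ => smoothX_const 0, ?_⟩
    have : mulX (fun _ : Spacetime n => 0) (smoothX_const 0) = 0 := mulOp_eq_zero _ fun Z => rfl
    simp [this]
  | add P Q _ _ hP hQ =>
    obtain ⟨a, ha, rfl⟩ := hP
    obtain ⟨b, hb, rfl⟩ := hQ
    refine ⟨fun i Z => a i Z + b i Z, fun i => smoothX_add (ha i) (hb i), ?_⟩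
    rw [← Finset.sum_add_distrib]
    refine Finset.sum_congr rfl fun i _ => ?_
    rw [← add_mul]
    congr 1
    exact (mulOp_add _ _).symm
  | smul c P _ hP =>
    obtain ⟨a, ha, rfl⟩ := hP
    refine ⟨fun i Z => c * a i Z, fun i => smoothX_mul (smoothX_const c) (ha i), ?_⟩
    rw [Finset.smul_sum]
    refine Finset.sum_congr rfl fun i _ => ?_
    rw [← smul_mul_assoc]
    congr 1
    change _ = mulOp _ _
    rw [← mulOp_mul (contDiff_const (c := c)) (contDiff_of_mem_smoothX (ha i)), mulOp_const,
      smul_mul_assoc, one_mul]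
    rfl

theorem exists_coeff_of_mem_wordSpan {n m : ℕ} {P : DistrOp n} (hP : P ∈ wordSpan n m) :
    ∃ (a : List (FlatGen n) → Spacetime n → ℂ) (ha : ∀ l, a l ∈ smoothX n),
      P = ∑ l ∈ words n m, mulX (a l) (ha l) * wordOp l := by
  refine exists_coeff_of_mem_span _ _ ?_
  simp only [mem_words]
  exact hP

/-- The finitely many exponents of ordered monomials of order at most `m`. -/
def monomials (n m : ℕ) : Finset (FlatGen n → ℕ) := (finite_monomials n m).toFinset

theorem mem_monomials {n m : ℕ} {α : FlatGen n → ℕ} :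
    α ∈ monomials n m ↔ flatMonomialOrder α ≤ m := by
  simp [monomials]

/-- The norm of the flat module spaces involves only ordered monomials; this recovers all words. -/
theorem exists_coeff_wordOp {n m : ℕ} {l : List (FlatGen n)} (hl : wordOrd l ≤ m) :
    ∃ (a : (FlatGen n → ℕ) → Spacetime n → ℂ) (ha : ∀ α, a α ∈ smoothX n),
      wordOp l = ∑ α ∈ monomials n m, mulX (a α) (ha α) * flatMonomial α := by
  refine exists_coeff_of_mem_span _ _ ?_
  simp only [mem_monomials]
  exact wordSpan_le_monomialSpan n m (wordOp_mem hl)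

/-! ### A product estimate by Fourier analysis -/

section

open scoped FourierTransform

theorem eLpNorm_two_sq {α : Type*} [MeasurableSpace α] (μ : Measure α) {F : Type*}
    [NormedAddCommGroup F] (f : α → F) :
    eLpNorm f 2 μ ^ 2 = ∫⁻ x, ‖f x‖ₑ ^ 2 ∂μ := by
  have := eLpNorm_nnreal_pow_eq_lintegral (f := f) (μ := μ) (p := 2) (by norm_num)
  norm_cast at this
  exact_mod_cast this

theorem eLpNorm_le_sum_of_norm_le {α κ : Type*} [MeasurableSpace α] {μ : Measure α} {F G : Type*}
    [NormedAddCommGroup F] [NormedAddCommGroup G] {f : α → F} {g : κ → α → G} (L : Finset κ)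
    {c : ℝ} (hc : 0 ≤ c) (hg : ∀ l ∈ L, AEStronglyMeasurable (g l) μ)
    (h : ∀ᵐ x ∂μ, ‖f x‖ ≤ c * ∑ l ∈ L, ‖g l x‖) :
    eLpNorm f 2 μ ≤ ENNReal.ofReal c * ∑ l ∈ L, eLpNorm (g l) 2 μ := by
  have h1 : eLpNorm f 2 μ ≤ eLpNorm (c • ∑ l ∈ L, fun x => ‖g l x‖) 2 μ := by
    refine eLpNorm_mono_ae (h.mono fun x hx => hx.trans (le_of_eq ?_))
    simp only [Pi.smul_apply, Finset.sum_apply, smul_eq_mul, norm_mul]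
    rw [Real.norm_of_nonneg hc, Real.norm_of_nonneg (Finset.sum_nonneg fun _ _ => norm_nonneg _)]
  refine h1.trans ?_
  rw [eLpNorm_const_smul, ← ofReal_norm, Real.norm_of_nonneg hc]
  gcongr
  refine (eLpNorm_sum_le (fun l hl => (hg l hl).norm) (by norm_num)).trans_eq ?_
  exact Finset.sum_congr rfl fun l _ => eLpNorm_norm _

theorem lintegral_mul_sq_le {α : Type*} [MeasurableSpace α] (μ : Measure α) {f g : α → ℝ≥0∞}
    (hf : AEMeasurable f μ) (hg : AEMeasurable g μ) :
    (∫⁻ x, f x * g x ∂μ) ^ 2 ≤ (∫⁻ x, f x ^ 2 ∂μ) * ∫⁻ x, g x ^ 2 ∂μ := by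
  have h := ENNReal.lintegral_mul_le_Lp_mul_Lq μ Real.HolderConjugate.two_two hf hg
  simp only [Pi.mul_apply, ENNReal.rpow_two] at h
  calc _ ≤ ((∫⁻ x, f x ^ 2 ∂μ) ^ (1 / 2 : ℝ) * (∫⁻ x, g x ^ 2 ∂μ) ^ (1 / 2 : ℝ)) ^ 2 := by gcongr
    _ = _ := by
      rw [mul_pow, ← ENNReal.rpow_two, ← ENNReal.rpow_two, ← ENNReal.rpow_mul, ← ENNReal.rpow_mul]
      norm_num

variable {ι : Type*} [Fintype ι]

/-- The tensor weight `∏ (1 + |ξᵢ|)^{cᵢ}`. -/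
def tensorWeight (c : ι → ℝ) (ξ : EuclideanSpace ℝ ι) : ℝ := ∏ i, (1 + |ξ i|) ^ c i

theorem tensorWeight_pos (c : ι → ℝ) (ξ : EuclideanSpace ℝ ι) : 0 < tensorWeight c ξ :=
  Finset.prod_pos fun i _ => by positivity

theorem measurable_tensorWeight (c : ι → ℝ) : Measurable (tensorWeight c) := by
  unfold tensorWeight
  fun_prop

/-- The reciprocal square of a product of two tensor weights is integrable along convolutions,
uniformly in the output frequency, as soon as the exponents add up to more than `1/2` in each
variable. -/
theorem exists_tensorWeight_bound (c d : ι → ℝ) (hc : ∀ i, 0 ≤ c i) (hd : ∀ i, 0 ≤ d i)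
    (h : ∀ i, 1 / 2 < c i + d i) :
    ∃ K : ℝ≥0, ∀ ξ : EuclideanSpace ℝ ι,
      ∫⁻ η, ENNReal.ofReal ((tensorWeight c η * tensorWeight d (ξ - η))⁻¹) ^ 2 ≤ K := by
  let q : ι → ℝ → ℝ := fun i x => (1 + ‖x‖) ^ (-(2 * (c i + d i)))
  have hq : ∀ i, Integrable (q i) := fun i => integrable_one_add_norm (by
    have := h i; simp; linarith)
  let K : ℝ := ∏ i, (2 * ∫ x, q i x)
  refine ⟨K.toNNReal, fun ξ => ?_⟩
  have hint : ∀ i, Integrable fun x => q i x + q i (ξ i - x) := fun i =>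
    (hq i).add ((hq i).comp_sub_left (ξ i))
  have key : ∀ η : EuclideanSpace ℝ ι, ((tensorWeight c η * tensorWeight d (ξ - η))⁻¹) ^ 2 ≤
      ∏ i, (q i (η i) + q i (ξ i - η i)) := fun η => by
    rw [tensorWeight, tensorWeight, ← Finset.prod_mul_distrib, ← Finset.prod_inv_distrib,
      ← Finset.prod_pow]
    refine Finset.prod_le_prod (fun i _ => by positivity) fun i _ => ?_
    simp only [PiLp.sub_apply, q, Real.norm_eq_abs]
    set x := 1 + |η i| with hx
    set y := 1 + |ξ i - η i| with hy
    have hx1 : 1 ≤ x := by simp [hx]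
    have hy1 : 1 ≤ y := by simp [hy]
    have hx0 : 0 < x := by linarith
    have hy0 : 0 < y := by linarith
    have e : ((x ^ c i * y ^ d i)⁻¹) ^ 2 = x ^ (-(2 * c i)) * y ^ (-(2 * d i)) := by
      rw [mul_inv, mul_pow, ← Real.rpow_neg hx0.le, ← Real.rpow_neg hy0.le, ← Real.rpow_natCast,
        ← Real.rpow_natCast, ← Real.rpow_mul hx0.le, ← Real.rpow_mul hy0.le]
      push_cast
      ring_nf
    rw [e]
    -- The smaller of `x` and `y` takes over the exponent of the other one.
    rcases le_total x y with hxy | hxy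
    · have : y ^ (-(2 * d i)) ≤ x ^ (-(2 * d i)) :=
        Real.rpow_le_rpow_of_nonpos hx0 hxy (by linarith [hd i])
      calc _ ≤ x ^ (-(2 * c i)) * x ^ (-(2 * d i)) := by gcongr
        _ = x ^ (-(2 * (c i + d i))) := by rw [← Real.rpow_add hx0]; ring_nf
        _ ≤ _ := le_add_of_nonneg_right (by positivity)
    · have : x ^ (-(2 * c i)) ≤ y ^ (-(2 * c i)) :=
        Real.rpow_le_rpow_of_nonpos hy0 hxy (by linarith [hc i])
      calc _ ≤ y ^ (-(2 * c i)) * y ^ (-(2 * d i)) := by gcongr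
        _ = y ^ (-(2 * (c i + d i))) := by rw [← Real.rpow_add hy0]; ring_nf
        _ ≤ _ := le_add_of_nonneg_left (by positivity)
  calc ∫⁻ η, ENNReal.ofReal ((tensorWeight c η * tensorWeight d (ξ - η))⁻¹) ^ 2
      ≤ ∫⁻ η : EuclideanSpace ℝ ι, ENNReal.ofReal (∏ i, (q i (η i) + q i (ξ i - η i))) := by
        refine lintegral_mono fun η => ?_
        rw [← ENNReal.ofReal_pow (inv_nonneg.2 (mul_nonneg (tensorWeight_pos _ _).le
          (tensorWeight_pos _ _).le))]
        exact ENNReal.ofReal_le_ofReal (key η)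
    _ = ∫⁻ x : ι → ℝ, ENNReal.ofReal (∏ i, (q i (x i) + q i (ξ i - x i))) :=
        (PiLp.volume_preserving_ofLp ι).lintegral_comp
          (f := fun x : ι → ℝ => ENNReal.ofReal (∏ i, (q i (x i) + q i (ξ i - x i))))
          (by unfold q; fun_prop)
    _ = ENNReal.ofReal (∫ x : ι → ℝ, ∏ i, (q i (x i) + q i (ξ i - x i))) :=
        (ofReal_integral_eq_lintegral_ofReal (Integrable.fintype_prod hint)
          (Filter.Eventually.of_forall fun x => Finset.prod_nonneg fun i _ => by
            simp only [q]; positivity)).symm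
    _ = ENNReal.ofReal K := by
        rw [integral_fintype_prod_volume_eq_prod (fun i x => q i x + q i (ξ i - x))]
        congr 1
        refine Finset.prod_congr rfl fun i _ => ?_
        rw [integral_add (hq i) ((hq i).comp_sub_left (ξ i)), integral_sub_left_eq_self, two_mul]
    _ = _ := rfl

/-- Weighted `L²` bound for a convolution: by Cauchy-Schwarz the kernel only enters through
`∫ (m₁(η) m₂(ξ - η))⁻² dη`. -/
theorem lintegral_convolution_sq_le (c d : ι → ℝ) {K : ℝ≥0}
    (hK : ∀ ξ : EuclideanSpace ℝ ι,
      ∫⁻ η, ENNReal.ofReal ((tensorWeight c η * tensorWeight d (ξ - η))⁻¹) ^ 2 ≤ K)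
    {f g : EuclideanSpace ℝ ι → ℂ} (hf : Measurable f) (hg : Measurable g) :
    ∫⁻ ξ, (∫⁻ η, ‖f η‖ₑ * ‖g (ξ - η)‖ₑ) ^ 2 ≤
      K * (∫⁻ ξ, (ENNReal.ofReal (tensorWeight c ξ) * ‖f ξ‖ₑ) ^ 2) *
        ∫⁻ ξ, (ENNReal.ofReal (tensorWeight d ξ) * ‖g ξ‖ₑ) ^ 2 := by
  have mc := measurable_tensorWeight c
  have md := measurable_tensorWeight d
  let A : EuclideanSpace ℝ ι → ℝ≥0∞ := fun ξ => ENNReal.ofReal (tensorWeight c ξ) * ‖f ξ‖ₑ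
  let B : EuclideanSpace ℝ ι → ℝ≥0∞ := fun ξ => ENNReal.ofReal (tensorWeight d ξ) * ‖g ξ‖ₑ
  have mA : Measurable A := by fun_prop
  have mB : Measurable B := by fun_prop
  have step : ∀ ξ, (∫⁻ η, ‖f η‖ₑ * ‖g (ξ - η)‖ₑ) ^ 2 ≤ K * ∫⁻ η, (A η * B (ξ - η)) ^ 2 := by
    intro ξ
    have e : ∀ η, ‖f η‖ₑ * ‖g (ξ - η)‖ₑ =
        ENNReal.ofReal ((tensorWeight c η * tensorWeight d (ξ - η))⁻¹) * (A η * B (ξ - η)) := by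
      intro η
      have h1 := mul_pos (tensorWeight_pos c η) (tensorWeight_pos d (ξ - η))
      simp only [A, B]
      rw [mul_mul_mul_comm, ← mul_assoc, ← ENNReal.ofReal_mul (tensorWeight_pos c η).le,
        ← ENNReal.ofReal_mul (inv_pos.2 h1).le, inv_mul_cancel₀ h1.ne']
      simp
    simp_rw [e]
    refine (lintegral_mul_sq_le _ (by fun_prop) (by fun_prop)).trans ?_
    gcongr
    exact hK ξ
  calc _ ≤ ∫⁻ ξ, K * ∫⁻ η, (A η * B (ξ - η)) ^ 2 := lintegral_mono step
    _ = K * ∫⁻ ξ, ∫⁻ η, (A η * B (ξ - η)) ^ 2 := lintegral_const_mul' _ _ (by simp)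
    _ = K * ∫⁻ η, ∫⁻ ξ, (A η * B (ξ - η)) ^ 2 := by
        rw [lintegral_lintegral_swap]
        exact Measurable.aemeasurable (by fun_prop)
    _ = K * ∫⁻ η, A η ^ 2 * ∫⁻ ξ, B ξ ^ 2 := by
        congr 1
        refine lintegral_congr fun η => ?_
        simp_rw [mul_pow]
        rw [lintegral_const_mul _ (by fun_prop)]
        congr 1
        exact lintegral_sub_right_eq_self (fun ξ => B ξ ^ 2) η
    _ = _ := by
        rw [lintegral_mul_const _ (by fun_prop), mul_assoc]

theorem SchwartzMap.eLpNorm_fourierInv {V : Type*} [NormedAddCommGroup V] [InnerProductSpace ℝ V]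
    [FiniteDimensional ℝ V] [MeasurableSpace V] [BorelSpace V] (f : SchwartzMap V ℂ) :
    eLpNorm (𝓕⁻ f : SchwartzMap V ℂ) 2 volume = eLpNorm f 2 volume := by
  have h := SchwartzMap.norm_fourier_toL2_eq (𝓕⁻ f : SchwartzMap V ℂ)
  have h1 : eLpNorm f 2 volume ≠ ⊤ := (f.memLp 2 volume).2.ne
  have h2 : eLpNorm (𝓕⁻ f : SchwartzMap V ℂ) 2 volume ≠ ⊤ :=
    ((𝓕⁻ f : SchwartzMap V ℂ).memLp 2 volume).2.ne
  rw [FourierTransform.fourier_fourierInv_eq, SchwartzMap.norm_toLp, SchwartzMap.norm_toLp,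
    ENNReal.toReal_eq_toReal_iff' h1 h2] at h
  exact h.symm

/-- A product in `L²`, by the convolution estimate on the Fourier side. -/
theorem SchwartzMap.eLpNorm_mul_le (c d : ι → ℝ) (hc : ∀ i, 0 ≤ c i) (hd : ∀ i, 0 ≤ d i)
    (h : ∀ i, 1 / 2 < c i + d i) :
    ∃ K : ℝ≥0, ∀ F G : SchwartzMap (EuclideanSpace ℝ ι) ℂ,
      eLpNorm (fun x => F x * G x) 2 ≤ K *
        eLpNorm (fun ξ => (tensorWeight c ξ : ℂ) * 𝓕⁻ F ξ) 2 *
        eLpNorm (fun ξ => (tensorWeight d ξ : ℂ) * 𝓕⁻ G ξ) 2 := by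
  obtain ⟨K, hK⟩ := exists_tensorWeight_bound c d hc hd h
  refine ⟨NNReal.sqrt K, fun F G => ?_⟩
  have e1 : (fun x => F x * G x) =
      SchwartzMap.pairing (ContinuousLinearMap.mul ℂ ℂ) F G := by
    funext x
    simp [SchwartzMap.pairing_apply_apply]
  have e2 : SchwartzMap.pairing (ContinuousLinearMap.mul ℂ ℂ) F G =
      𝓕 (SchwartzMap.convolution (ContinuousLinearMap.mul ℂ ℂ) (𝓕⁻ F) (𝓕⁻ G)) := by
    rw [SchwartzMap.fourier_convolution, FourierTransform.fourier_fourierInv_eq,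
      FourierTransform.fourier_fourierInv_eq]
  have e3 := SchwartzMap.eLpNorm_fourierInv (SchwartzMap.pairing (ContinuousLinearMap.mul ℂ ℂ) F G)
  rw [e1, ← e3, e2, FourierTransform.fourierInv_fourier_eq]
  rw [← ENNReal.pow_le_pow_left_iff (n := 2) (by norm_num), mul_pow, mul_pow, eLpNorm_two_sq,
    eLpNorm_two_sq, eLpNorm_two_sq]
  have hw : ∀ (c : ι → ℝ) (f : SchwartzMap (EuclideanSpace ℝ ι) ℂ) ξ,
      ‖(tensorWeight c ξ : ℂ) * f ξ‖ₑ = ENNReal.ofReal (tensorWeight c ξ) * ‖f ξ‖ₑ := by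
    intro c f ξ
    rw [enorm_mul]
    congr 1
    rw [← ofReal_norm, Complex.norm_real, Real.norm_of_nonneg (tensorWeight_pos _ _).le]
  have hsq : ((NNReal.sqrt K : ℝ≥0) : ℝ≥0∞) ^ 2 = K := by
    rw [← ENNReal.coe_pow, NNReal.sq_sqrt]
  simp_rw [hw]
  rw [hsq]
  refine le_trans (lintegral_mono fun ξ => ?_)
    (lintegral_convolution_sq_le c d hK (𝓕⁻ F).continuous.measurable (𝓕⁻ G).continuous.measurable)
  rw [SchwartzMap.convolution_apply]
  gcongr
  refine (enorm_integral_le_lintegral_enorm _).trans_eq ?_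
  refine lintegral_congr fun η => ?_
  simp [enorm_mul]

/-- Iterated coordinate derivatives of a function on `ℝ^ι`; the head of the list acts last. -/
def coordDeriv [DecidableEq ι] (l : List ι) (F : EuclideanSpace ℝ ι → ℂ) :
    EuclideanSpace ℝ ι → ℂ :=
  l.foldr (fun i f x => fderiv ℝ f x (EuclideanSpace.single i 1)) F

theorem exists_schwartz_coordDeriv [DecidableEq ι] (F : SchwartzMap (EuclideanSpace ℝ ι) ℂ)
    (l : List ι) : ∃ G : SchwartzMap (EuclideanSpace ℝ ι) ℂ, (⇑G = coordDeriv l F) ∧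
      ∀ ξ, ‖𝓕⁻ G ξ‖ = (l.map fun i => 2 * Real.pi * |ξ i|).prod * ‖𝓕⁻ F ξ‖ := by
  induction l with
  | nil => exact ⟨F, rfl, fun ξ => by simp⟩
  | cons i l ih =>
    obtain ⟨G, hG, hG'⟩ := ih
    refine ⟨∂_{(EuclideanSpace.single i 1 : EuclideanSpace ℝ ι)} G, ?_, fun ξ => ?_⟩
    · funext x
      rw [SchwartzMap.lineDerivOp_apply_eq_fderiv, hG]
      rfl
    · have ht : (fun x : EuclideanSpace ℝ ι => inner ℝ x (EuclideanSpace.single i (1 : ℝ))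
        ).HasTemperateGrowth := by fun_prop
      rw [SchwartzMap.fourierInv_lineDerivOp_eq]
      simp only [smul_apply, neg_smul, neg_apply, norm_neg, norm_smul,
        SchwartzMap.smulLeftCLM_apply_apply ht, hG', List.map_cons, List.prod_cons]
      simp [EuclideanSpace.inner_single_right, abs_of_pos Real.pi_pos]
      ring

/-- A weight bounded by finitely many monomials `|ξ^l|` is controlled by the corresponding
derivatives. -/
theorem eLpNorm_weight_le [DecidableEq ι] {w : EuclideanSpace ℝ ι → ℝ} (hw0 : ∀ ξ, 0 ≤ w ξ)
    (L : Finset (List ι)) {c : ℝ} (hc : 0 ≤ c)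
    (hw : ∀ ξ, w ξ ≤ c * ∑ l ∈ L, (l.map fun i => |ξ i|).prod)
    (F : SchwartzMap (EuclideanSpace ℝ ι) ℂ) {A : ℝ≥0∞}
    (hA : ∀ l ∈ L, eLpNorm (coordDeriv l F) 2 ≤ A) :
    eLpNorm (fun ξ => (w ξ : ℂ) * 𝓕⁻ F ξ) 2 ≤ ENNReal.ofReal c * L.card * A := by
  choose G hG hG' using exists_schwartz_coordDeriv F
  have hle : ∀ l : List ι, ∀ ξ : EuclideanSpace ℝ ι,
      (l.map fun i => |ξ i|).prod * ‖𝓕⁻ F ξ‖ ≤ ‖𝓕⁻ (G l) ξ‖ := fun l ξ => by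
    rw [hG']
    refine mul_le_mul_of_nonneg_right ?_ (norm_nonneg _)
    induction l with
    | nil => simp
    | cons i l ih =>
      simp only [List.map_cons, List.prod_cons]
      have h0 : 0 ≤ (l.map fun i => |ξ i|).prod :=
        List.prod_nonneg fun a ha => by
          obtain ⟨i, _, rfl⟩ := List.mem_map.1 ha
          exact abs_nonneg _
      have hpi : (1 : ℝ) ≤ 2 * Real.pi := by nlinarith [Real.pi_gt_three]
      refine mul_le_mul ?_ ih h0 (by positivity)
      nlinarith [abs_nonneg (ξ i)]
  have h1 : eLpNorm (fun ξ => (w ξ : ℂ) * 𝓕⁻ F ξ) 2 ≤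
      ENNReal.ofReal c * ∑ l ∈ L, eLpNorm (𝓕⁻ (G l) : SchwartzMap (EuclideanSpace ℝ ι) ℂ) 2 := by
    refine eLpNorm_le_sum_of_norm_le L hc
      (fun l _ => (SchwartzMap.continuous _).aestronglyMeasurable)
      (Filter.Eventually.of_forall fun ξ => ?_)
    rw [norm_mul, Complex.norm_real, Real.norm_of_nonneg (hw0 ξ)]
    calc _ ≤ (c * ∑ l ∈ L, (l.map fun i => |ξ i|).prod) * ‖𝓕⁻ F ξ‖ := by
          gcongr; exact hw ξ
      _ = c * ∑ l ∈ L, (l.map fun i => |ξ i|).prod * ‖𝓕⁻ F ξ‖ := by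
          rw [mul_assoc, Finset.sum_mul]
      _ ≤ _ := by gcongr with l _; exact hle l ξ
  refine h1.trans ?_
  rw [mul_assoc, ← nsmul_eq_mul, ← Finset.sum_const]
  gcongr with l hl
  rw [SchwartzMap.eLpNorm_fourierInv, hG]
  exact hA l hl

end

section

open scoped FourierTransform

/-- The order of a word in the coordinate derivatives of `ℝ × ℝⁿ`: the derivative along the
time axis `none` counts twice. -/
def coordOrd {n : ℕ} (l : List (Option (Fin n))) : ℕ :=
  (l.map fun i => if i = none then 2 else 1).sum

@[simp] theorem coordOrd_nil {n : ℕ} : coordOrd ([] : List (Option (Fin n))) = 0 := rfl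

@[simp] theorem coordOrd_none_cons {n : ℕ} (l : List (Option (Fin n))) :
    coordOrd (none :: l) = 2 + coordOrd l := by simp [coordOrd]

@[simp] theorem coordOrd_some_cons {n : ℕ} (j : Fin n) (l : List (Option (Fin n))) :
    coordOrd (some j :: l) = 1 + coordOrd l := by simp [coordOrd]

theorem coordOrd_replicate {n : ℕ} (j : Fin n) (s : ℕ) :
    coordOrd (List.replicate s (some j)) = s := by simp [coordOrd]

theorem length_le_coordOrd {n : ℕ} (l : List (Option (Fin n))) : l.length ≤ coordOrd l := by
  induction l with
  | nil => simp
  | cons i l ih => cases i <;> simp <;> omega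

theorem finite_coordWords (n s : ℕ) : {l : List (Option (Fin n)) | coordOrd l ≤ s}.Finite :=
  (List.finite_length_le (Option (Fin n)) s).subset fun l hl => (length_le_coordOrd l).trans hl

/-- The anisotropic weight with exponent `5 / 8` in time and total exponent `s - 2 * (5 / 8)` in
space is controlled by the monomials of order at most `s`. Any time exponent between `1 / 2`
and `3 / 4` would serve. -/
theorem tensorWeight_le_time {n : ℕ} (hn : 1 ≤ n) {s : ℕ} (hs : 2 ≤ s) :
    ∀ ξ : EuclideanSpace ℝ (Option (Fin n)),
      tensorWeight (fun i => Option.elim i (5 / 8) fun _ => ((s : ℝ) - 5 / 4) / n) ξ ≤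
        (3 * (n + 1) ^ s : ℝ) * ∑ l ∈ (finite_coordWords n s).toFinset,
          (l.map fun i => |ξ i|).prod := by
  intro ξ
  have hn0 : (0 : ℝ) < n := by exact_mod_cast hn
  have hs' : (2 : ℝ) ≤ s := by exact_mod_cast hs
  set S : ℝ := ∑ l ∈ (finite_coordWords n s).toFinset, (l.map fun i => |ξ i|).prod with hS
  have hword : ∀ l : List (Option (Fin n)), coordOrd l ≤ s → (l.map fun i => |ξ i|).prod ≤ S := by
    intro l hl
    exact Finset.single_le_sum (f := fun l : List (Option (Fin n)) => (l.map fun i => |ξ i|).prod)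
      (fun l _ => List.prod_nonneg (by simp)) (by simpa using hl)
  have hne : (Finset.univ : Finset (Fin n)).Nonempty := ⟨⟨0, hn⟩, Finset.mem_univ _⟩
  obtain ⟨j, -, hj⟩ := Finset.exists_max_image Finset.univ (fun j : Fin n => |ξ (some j)|) hne
  set X : ℝ := 1 + ∑ j : Fin n, |ξ (some j)| with hX
  have hX1 : 1 ≤ X := by
    have : 0 ≤ ∑ j : Fin n, |ξ (some j)| := Finset.sum_nonneg fun _ _ => abs_nonneg _
    linarith
  set Y : ℝ := 1 + |ξ none| with hY
  have hY1 : 1 ≤ Y := by simp [hY]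
  -- `X` is at most `n + 1` times the largest of `1` and the `|ξ j|`.
  obtain ⟨m, hm1, hXm, hm⟩ : ∃ m : ℝ, 1 ≤ m ∧ X ≤ (n + 1) * m ∧
      (m = 1 ∨ m = |ξ (some j)|) := by
    have h1 : ∑ i : Fin n, |ξ (some i)| ≤ n * |ξ (some j)| := by
      refine (Finset.sum_le_card_nsmul _ _ _ fun i hi => hj i hi).trans (by simp)
    rcases le_total |ξ (some j)| 1 with h | h
    · exact ⟨1, le_rfl, by nlinarith, Or.inl rfl⟩
    · exact ⟨_, h, by nlinarith, Or.inr rfl⟩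
  have hp : ∀ q : ℕ, q ≤ s → m ^ q ≤ S := by
    intro q hq
    rcases hm with hm | hm
    · rw [hm, one_pow]
      simpa using hword [] (by simp)
    · rw [hm]
      simpa using hword (List.replicate q (some j)) (by rwa [coordOrd_replicate])
  have hpt : m ^ (s - 2) * |ξ none| ≤ S := by
    rcases hm with hm | hm
    · rw [hm, one_pow, one_mul]
      simpa using hword [none] (by simpa using hs)
    · rw [hm]
      have := hword (none :: List.replicate (s - 2) (some j))
        (by rw [coordOrd_none_cons, coordOrd_replicate]; omega)
      simpa [mul_comm] using this
  have hc0 : 0 ≤ ((s : ℝ) - 5 / 4) / n := div_nonneg (by linarith) hn0.le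
  have h1 : tensorWeight (fun i => Option.elim i (5 / 8) fun _ => ((s : ℝ) - 5 / 4) / n) ξ ≤
      Y ^ (5 / 8 : ℝ) * X ^ ((s : ℝ) - 5 / 4) := by
    rw [tensorWeight, Fintype.prod_option]
    simp only [Option.elim]
    gcongr
    calc ∏ i : Fin n, (1 + |ξ (some i)|) ^ (((s : ℝ) - 5 / 4) / n)
        ≤ ∏ i : Fin n, X ^ (((s : ℝ) - 5 / 4) / n) := by
          refine Finset.prod_le_prod (fun i _ => by positivity) fun i _ => ?_
          refine Real.rpow_le_rpow (by positivity) ?_ hc0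
          rw [hX]
          gcongr
          exact Finset.single_le_sum (f := fun i : Fin n => |ξ (some i)|)
            (fun _ _ => abs_nonneg _) (Finset.mem_univ i)
      _ = X ^ ((s : ℝ) - 5 / 4) := by
          rw [Finset.prod_const, Finset.card_univ, Fintype.card_fin, ← Real.rpow_natCast,
            ← Real.rpow_mul (by linarith)]
          congr 1
          field_simp
  have hX0 : 0 < X := by linarith
  have hY0 : 0 < Y := by linarith
  have h2 : Y ^ (5 / 8 : ℝ) * X ^ ((s : ℝ) - 5 / 4) ≤ X ^ s + X ^ (s - 2) * Y := by
    have hB : 0 ≤ Y / X ^ 2 := by positivity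
    have h3 : (Y / X ^ 2) ^ (5 / 8 : ℝ) ≤ 1 + Y / X ^ 2 := by
      rcases le_total (Y / X ^ 2) 1 with h | h
      · exact (Real.rpow_le_one hB h (by norm_num)).trans (by linarith)
      · refine (Real.rpow_le_rpow_of_exponent_le h (by norm_num : (5 / 8 : ℝ) ≤ 1)).trans ?_
        rw [Real.rpow_one]
        linarith
    have h4 : Y ^ (5 / 8 : ℝ) * X ^ ((s : ℝ) - 5 / 4) = X ^ s * (Y / X ^ 2) ^ (5 / 8 : ℝ) := by
      rw [Real.div_rpow hY0.le (by positivity), ← Real.rpow_natCast X 2, ← Real.rpow_mul hX0.le,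
        Real.rpow_sub hX0, Real.rpow_natCast]
      norm_num
      ring
    have h5 : X ^ s = X ^ (s - 2) * X ^ 2 := by rw [← pow_add]; congr 1; omega
    calc _ = X ^ s * (Y / X ^ 2) ^ (5 / 8 : ℝ) := h4
      _ ≤ X ^ s * (1 + Y / X ^ 2) := by gcongr
      _ = X ^ s + X ^ (s - 2) * Y := by rw [h5]; field_simp
  have hn1 : (1 : ℝ) ≤ n + 1 := by linarith
  have hXp : ∀ q : ℕ, q ≤ s → X ^ q ≤ (n + 1) ^ s * m ^ q := fun q hq => by
    calc X ^ q ≤ ((n + 1) * m) ^ q := by gcongr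
      _ = (n + 1) ^ q * m ^ q := mul_pow _ _ _
      _ ≤ (n + 1) ^ s * m ^ q := by gcongr
  calc _ ≤ X ^ s + X ^ (s - 2) * Y := h1.trans h2
    _ ≤ (n + 1) ^ s * m ^ s + (n + 1) ^ s * m ^ (s - 2) * Y := by
        gcongr
        · exact hXp s le_rfl
        · exact hXp _ (by omega)
    _ = (n + 1) ^ s * (m ^ s + m ^ (s - 2) + m ^ (s - 2) * |ξ none|) := by rw [hY]; ring
    _ ≤ (n + 1) ^ s * (S + S + S) := by
        gcongr
        · exact hp s le_rfl
        · exact hp _ (by omega)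
    _ = _ := by ring

theorem tensorWeight_le_space {n : ℕ} (hn : 1 ≤ n) (s : ℕ) :
    ∀ ξ : EuclideanSpace ℝ (Option (Fin n)),
      tensorWeight (fun i => Option.elim i 0 fun _ => (s : ℝ) / n) ξ ≤
        ((n + 1) ^ s : ℝ) * ∑ l ∈ (finite_coordWords n s).toFinset,
          (l.map fun i => |ξ i|).prod := by
  intro ξ
  have hn0 : (0 : ℝ) < n := by exact_mod_cast hn
  set S : ℝ := ∑ l ∈ (finite_coordWords n s).toFinset, (l.map fun i => |ξ i|).prod with hS
  have hword : ∀ l : List (Option (Fin n)), coordOrd l ≤ s → (l.map fun i => |ξ i|).prod ≤ S := by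
    intro l hl
    exact Finset.single_le_sum (f := fun l : List (Option (Fin n)) => (l.map fun i => |ξ i|).prod)
      (fun l _ => List.prod_nonneg (by simp)) (by simpa using hl)
  have hne : (Finset.univ : Finset (Fin n)).Nonempty := ⟨⟨0, hn⟩, Finset.mem_univ _⟩
  obtain ⟨j, -, hj⟩ := Finset.exists_max_image Finset.univ (fun j : Fin n => |ξ (some j)|) hne
  have hp : max 1 |ξ (some j)| ^ s ≤ S := by
    rcases le_total |ξ (some j)| 1 with h | h
    · rw [max_eq_left h, one_pow]
      simpa using hword [] (by simp)
    · rw [max_eq_right h]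
      simpa using hword (List.replicate s (some j)) (by rw [coordOrd_replicate])
  rw [tensorWeight, Fintype.prod_option]
  simp only [Option.elim, Real.rpow_zero, one_mul]
  calc ∏ i : Fin n, (1 + |ξ (some i)|) ^ ((s : ℝ) / n)
      ≤ ∏ i : Fin n, ((n + 1) * max 1 |ξ (some j)|) ^ ((s : ℝ) / n) := by
        refine Finset.prod_le_prod (fun i _ => by positivity) fun i _ => ?_
        refine Real.rpow_le_rpow (by positivity) ?_ (by positivity)
        have h1 := hj i (Finset.mem_univ _)
        have h2 := le_max_left 1 |ξ (some j)|
        have h3 := le_max_right 1 |ξ (some j)|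
        have h4 : (1 : ℝ) ≤ n := by exact_mod_cast hn
        nlinarith
    _ = ((n + 1) * max 1 |ξ (some j)|) ^ s := by
        rw [Finset.prod_const, Finset.card_univ, Fintype.card_fin, ← Real.rpow_natCast,
          ← Real.rpow_mul (by positivity), div_mul_cancel₀ _ hn0.ne', Real.rpow_natCast]
    _ = (n + 1) ^ s * max 1 |ξ (some j)| ^ s := mul_pow _ _ _
    _ ≤ _ := by gcongr

/-- The product estimate on the model space `ℝ × ℝⁿ`: the time derivative counts twice, so the
effective dimension is `n + 2`, and `s₁ + s₂ > n / 2 + 1` derivatives suffice. -/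
theorem exists_eLpNorm_mul_le_coordDeriv {n : ℕ} (hn : 1 ≤ n) {s₁ s₂ : ℕ}
    (hs : n + 3 ≤ 2 * (s₁ + s₂)) (h2 : 2 ≤ s₁ ∨ 2 ≤ s₂) :
    ∃ K : ℝ≥0, ∀ F G : EuclideanSpace ℝ (Option (Fin n)) → ℂ,
      ContDiff ℝ ∞ F → HasCompactSupport F → ContDiff ℝ ∞ G → HasCompactSupport G →
      ∀ A B : ℝ≥0∞, (∀ l, coordOrd l ≤ s₁ → eLpNorm (coordDeriv l F) 2 ≤ A) →
        (∀ l, coordOrd l ≤ s₂ → eLpNorm (coordDeriv l G) 2 ≤ B) →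
        eLpNorm (fun x => F x * G x) 2 ≤ K * A * B := by
  wlog h1 : 2 ≤ s₁ generalizing s₁ s₂ with H
  · obtain ⟨K, hK⟩ := H (s₁ := s₂) (s₂ := s₁) (by omega) (by omega) (by omega)
    refine ⟨K, fun F G hF hF' hG hG' A B hA hB => ?_⟩
    have := hK G F hG hG' hF hF' B A hB hA
    simp only [mul_comm (G _)] at this
    exact this.trans_eq (by ring)
  -- The first factor carries the whole weight in the time frequency, for which it needs two
  -- derivatives.
  have hn0 : (0 : ℝ) < n := by exact_mod_cast hn
  have h1' : (2 : ℝ) ≤ s₁ := by exact_mod_cast h1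
  have hs' : (n : ℝ) + 3 ≤ 2 * (s₁ + s₂) := by exact_mod_cast hs
  obtain ⟨K, hK⟩ := SchwartzMap.eLpNorm_mul_le
    (fun i : Option (Fin n) => Option.elim i (5 / 8) fun _ => ((s₁ : ℝ) - 5 / 4) / n)
    (fun i => Option.elim i 0 fun _ => (s₂ : ℝ) / n)
    (fun i => by
      cases i
      · norm_num
      · exact div_nonneg (by linarith) hn0.le)
    (fun i => by
      cases i
      · simp
      · simp only [Option.elim]; positivity)
    (fun i => by
      cases i
      · norm_num
      · simp only [Option.elim]
        rw [← add_div, lt_div_iff₀ hn0]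
        linarith)
  refine ⟨K * (Real.toNNReal (3 * (n + 1) ^ s₁) * (finite_coordWords n s₁).toFinset.card) *
    (Real.toNNReal ((n + 1) ^ s₂) * (finite_coordWords n s₂).toFinset.card), ?_⟩
  intro F G hF hF' hG hG' A B hA hB
  have hT := eLpNorm_weight_le (fun ξ => (tensorWeight_pos _ ξ).le) _ (by positivity)
    (tensorWeight_le_time hn h1) (hF'.toSchwartzMap hF) (A := A)
    (fun l hl => hA l (by simpa using hl))
  have hX := eLpNorm_weight_le (fun ξ => (tensorWeight_pos _ ξ).le) _ (by positivity)
    (tensorWeight_le_space hn s₂) (hG'.toSchwartzMap hG) (A := B)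
    (fun l hl => hB l (by simpa using hl))
  refine (hK (hF'.toSchwartzMap hF) (hG'.toSchwartzMap hG)).trans ?_
  calc _ ≤ K * (ENNReal.ofReal (3 * (n + 1) ^ s₁) * (finite_coordWords n s₁).toFinset.card * A) *
        (ENNReal.ofReal ((n + 1) ^ s₂) * (finite_coordWords n s₂).toFinset.card * B) := by
        gcongr
    _ = _ := by
        simp only [ENNReal.ofReal]
        push_cast
        ring

end

/-! ### Generators acting on smooth functions -/

/-- The product of generators given by a word, acting on functions. -/
def wordAct {n : ℕ} (l : List (FlatGen n)) (f : Spacetime n → ℂ) : Spacetime n → ℂ :=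
  l.foldr FlatGen.act f

@[simp] theorem wordAct_nil {n : ℕ} (f : Spacetime n → ℂ) : wordAct [] f = f := rfl

@[simp] theorem wordAct_cons {n : ℕ} (g : FlatGen n) (l : List (FlatGen n))
    (f : Spacetime n → ℂ) : wordAct (g :: l) f = g.act (wordAct l f) := rfl

theorem ContDiff.wordAct {n : ℕ} {f : Spacetime n → ℂ} (hf : ContDiff ℝ ∞ f)
    (l : List (FlatGen n)) : ContDiff ℝ ∞ (wordAct l f) := by
  induction l with
  | nil => exact hf
  | cons g l ih => exact ih.genAct g

theorem FlatGen.weight_der {n : ℕ} (f : Spacetime n → ℂ) (Z : Spacetime n) :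
    (FlatGen.weight : FlatGen n).der f Z = 0 := by
  simp [FlatGen.der, FlatGen.vec]

theorem FlatGen.weight_act {n : ℕ} (f : Spacetime n → ℂ) (Z : Spacetime n) :
    (FlatGen.weight : FlatGen n).act f Z = ((bracketZ Z / bracketT Z : ℝ) : ℂ) * f Z := by
  rw [FlatGen.act, FlatGen.weight_der, zero_add]
  rfl

theorem FlatGen.act_eq_der {n : ℕ} {g : FlatGen n} (hg : g ≠ .weight) (f : Spacetime n → ℂ)
    (Z : Spacetime n) : g.act f Z = g.der f Z := by
  cases g <;> simp_all [FlatGen.act, FlatGen.pot]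

/-- Combinations of products of generators of order at most `m` with coefficients in `C^∞(X)`,
as maps on smooth functions. -/
inductive ActComb {n : ℕ} : ℕ → ((Spacetime n → ℂ) → Spacetime n → ℂ) → Prop
  | base {m : ℕ} {Q : (Spacetime n → ℂ) → Spacetime n → ℂ} (a : Spacetime n → ℂ)
      (l : List (FlatGen n)) (ha : a ∈ smoothX n) (hl : wordOrd l ≤ m)
      (hQ : ∀ f, ContDiff ℝ ∞ f → ∀ Z, Q f Z = a Z * wordAct l f Z) : ActComb m Q
  | add {m : ℕ} {Q Q₁ Q₂ : (Spacetime n → ℂ) → Spacetime n → ℂ} (h₁ : ActComb m Q₁)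
      (h₂ : ActComb m Q₂) (hQ : ∀ f, ContDiff ℝ ∞ f → ∀ Z, Q f Z = Q₁ f Z + Q₂ f Z) : ActComb m Q

namespace ActComb

variable {n : ℕ} {m : ℕ} {Q : (Spacetime n → ℂ) → Spacetime n → ℂ}

theorem mono (h : ActComb m Q) {m' : ℕ} (hm : m ≤ m') : ActComb m' Q := by
  induction h with
  | base a l ha hl hQ => exact base a l ha (hl.trans hm) hQ
  | add h₁ h₂ hQ ih₁ ih₂ => exact add ih₁ ih₂ hQ

theorem contDiff (h : ActComb m Q) {f : Spacetime n → ℂ} (hf : ContDiff ℝ ∞ f) :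
    ContDiff ℝ ∞ (Q f) := by
  induction h with
  | base a l ha hl hQ =>
    rw [funext (hQ f hf)]
    exact (contDiff_of_mem_smoothX ha).mul (hf.wordAct l)
  | add h₁ h₂ hQ ih₁ ih₂ =>
    rw [funext (hQ f hf)]
    exact ih₁.add ih₂

theorem smul (h : ActComb m Q) {b : Spacetime n → ℂ} (hb : b ∈ smoothX n) :
    ActComb m fun f Z => b Z * Q f Z := by
  induction h with
  | base a l ha hl hQ =>
    exact base _ l (smoothX_mul hb ha) hl fun f hf Z => by rw [hQ f hf]; ring
  | add h₁ h₂ hQ ih₁ ih₂ => exact add ih₁ ih₂ fun f hf Z => by rw [hQ f hf]; ring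

theorem weight (h : ActComb m Q) :
    ActComb (m + 1) fun f Z => ((bracketZ Z / bracketT Z : ℝ) : ℂ) * Q f Z := by
  induction h with
  | base a l ha hl hQ =>
    refine base a (.weight :: l) ha ?_ fun f hf Z => ?_
    · rw [wordOrd_cons]
      simp only [FlatGen.order]
      omega
    · rw [hQ f hf, wordAct_cons, FlatGen.weight_act]
      ring
  | add h₁ h₂ hQ ih₁ ih₂ => exact add ih₁ ih₂ fun f hf Z => by rw [hQ f hf]; ring

theorem exists_bound (h : ActComb m Q) : ∃ C : ℝ, 0 ≤ C ∧ ∀ f, ContDiff ℝ ∞ f → ∀ Z,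
    ‖Q f Z‖ ≤ C * ∑ l ∈ words n m, ‖wordAct l f Z‖ := by
  induction h with
  | base a l ha hl hQ =>
    obtain ⟨C, hC, haC⟩ := smoothX_bounded ha
    refine ⟨C, hC, fun f hf Z => ?_⟩
    rw [hQ f hf, norm_mul]
    gcongr
    · exact haC Z
    · exact Finset.single_le_sum (f := fun l => ‖wordAct l f Z‖) (fun _ _ => norm_nonneg _)
        (mem_words.2 hl)
  | add h₁ h₂ hQ ih₁ ih₂ =>
    obtain ⟨C₁, hC₁, h₁⟩ := ih₁
    obtain ⟨C₂, hC₂, h₂⟩ := ih₂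
    refine ⟨C₁ + C₂, by positivity, fun f hf Z => ?_⟩
    rw [hQ f hf, add_mul]
    exact (norm_add_le _ _).trans (add_le_add (h₁ f hf Z) (h₂ f hf Z))

end ActComb

/-- Differentiation along `V` maps `J` times a combination of order `m` to `J` times a combination
of order `m + d`. -/
def FieldOrdLE {n : ℕ} (J : Spacetime n → ℂ) (d : ℕ) (V : Spacetime n → Spacetime n) : Prop :=
  ∀ m Q, ActComb m Q → ∃ Q', ActComb (m + d) Q' ∧ ∀ f, ContDiff ℝ ∞ f → ∀ Z,
    fderiv ℝ (fun Z => J Z * Q f Z) Z (V Z) = J Z * Q' f Z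

namespace FieldOrdLE

variable {n d : ℕ} {J : Spacetime n → ℂ} {V W : Spacetime n → Spacetime n}

theorem add (hV : FieldOrdLE J d V) (hW : FieldOrdLE J d W) :
    FieldOrdLE J d fun Z => V Z + W Z := fun m Q hQ => by
  obtain ⟨Q₁, h₁, e₁⟩ := hV m Q hQ
  obtain ⟨Q₂, h₂, e₂⟩ := hW m Q hQ
  refine ⟨_, h₁.add (Q := fun f Z => Q₁ f Z + Q₂ f Z) h₂ fun _ _ _ => rfl, fun f hf Z => ?_⟩
  rw [map_add, e₁ f hf, e₂ f hf]
  ring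

theorem smul (hV : FieldOrdLE J d V) {a : Spacetime n → ℝ}
    (ha : (fun Z => (a Z : ℂ)) ∈ smoothX n) : FieldOrdLE J d fun Z => a Z • V Z := fun m Q hQ => by
  obtain ⟨Q₁, h₁, e₁⟩ := hV m Q hQ
  refine ⟨_, h₁.smul ha, fun f hf Z => ?_⟩
  rw [map_smul, e₁ f hf, Complex.real_smul]
  ring

theorem weight (hV : FieldOrdLE J d V) :
    FieldOrdLE J (d + 1) fun Z => (bracketZ Z / bracketT Z) • V Z := fun m Q hQ => by
  obtain ⟨Q₁, h₁, e₁⟩ := hV m Q hQ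
  refine ⟨_, h₁.weight, fun f hf Z => ?_⟩
  rw [map_smul, e₁ f hf, Complex.real_smul]
  ring

theorem sum {ι : Type*} (s : Finset ι) {V : ι → Spacetime n → Spacetime n}
    (h : ∀ i ∈ s, FieldOrdLE J d (V i)) : FieldOrdLE J d fun Z => ∑ i ∈ s, V i Z := by
  classical
  induction s using Finset.induction_on with
  | empty =>
    intro m Q hQ
    refine ⟨fun f Z => 0 * Q f Z, (hQ.smul (smoothX_const 0)).mono (by omega), fun f hf Z => ?_⟩
    simp
  | insert i s his ih =>
    simp only [Finset.sum_insert his]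
    exact (h i (by simp)).add (ih fun j hj => h j (by simp [hj]))

/-- The generators, if the logarithmic derivatives of `J` along them lie in `C^∞(X)`. -/
theorem of_gen (hJ : ContDiff ℝ ∞ J) (g : FlatGen n) {c : Spacetime n → ℂ} (hc : c ∈ smoothX n)
    (hJc : ∀ Z, g.der J Z = c Z * J Z) : FieldOrdLE J g.order g.vec := by
  intro m Q hQ
  induction hQ with
  | @base Q a l ha hl hQ =>
    have ha' := contDiff_of_mem_smoothX ha
    refine ⟨_, ActComb.add (Q := fun f Z => Complex.I * (c Z * a Z + g.der a Z) * wordAct l f Z +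
        Complex.I * a Z * g.der (wordAct l f) Z) (m := m + g.order)
      (.base (Q := fun f Z => Complex.I * (c Z * a Z + g.der a Z) * wordAct l f Z) _ l
        (smoothX_mul (smoothX_const _) (smoothX_add (smoothX_mul hc ha) (smoothX_der g ha)))
        (hl.trans (Nat.le_add_right _ _)) fun _ _ _ => rfl)
      (?_ : ActComb _ fun f Z => Complex.I * a Z * g.der (wordAct l f) Z)
      (fun _ _ _ => rfl), fun f hf Z => ?_⟩
    · by_cases hg : g = .weight
      · refine .base (fun _ => 0) l (smoothX_const 0) (hl.trans (Nat.le_add_right _ _))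
          fun f hf Z => ?_
        rw [hg, FlatGen.weight_der]
        ring
      · refine .base _ (g :: l) (smoothX_mul (smoothX_const Complex.I) ha) ?_ fun f hf Z => ?_
        · rw [wordOrd_cons]
          omega
        · rw [wordAct_cons, FlatGen.act_eq_der hg]
    · have hd := (hf.wordAct l).differentiable (by simp) Z
      have e : ∀ h : Spacetime n → ℂ, fderiv ℝ h Z (g.vec Z) = Complex.I * g.der h Z := by
        intro h
        rw [FlatGen.der, ← mul_assoc, mul_neg, Complex.I_mul_I, neg_neg, one_mul]
      have e1 : (fun Z => J Z * Q f Z) = fun Z => J Z * (a Z * wordAct l f Z) :=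
        funext fun Z => by rw [hQ f hf]
      have hJd := hJ.differentiable (by simp) Z
      have had := ha'.differentiable (by simp) Z
      rw [e1, fderiv_fun_mul hJd (had.fun_mul hd), fderiv_fun_mul had hd]
      simp only [add_apply, _root_.smul_apply, smul_eq_mul, e, hJc]
      ring
  | @add Q Q₁ Q₂ h₁ h₂ hQ ih₁ ih₂ =>
    obtain ⟨Q₁', h₁', e₁⟩ := ih₁
    obtain ⟨Q₂', h₂', e₂⟩ := ih₂
    refine ⟨_, h₁'.add (Q := fun f Z => Q₁' f Z + Q₂' f Z) h₂' fun _ _ _ => rfl, fun f hf Z => ?_⟩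
    have e : (fun Z => J Z * Q f Z) = fun Z => J Z * Q₁ f Z + J Z * Q₂ f Z :=
      funext fun Z => by rw [hQ f hf]; ring
    have d₁ := (hJ.mul (h₁.contDiff hf)).differentiable (by simp) Z
    have d₂ := (hJ.mul (h₂.contDiff hf)).differentiable (by simp) Z
    rw [e, fderiv_fun_add d₁ d₂, add_apply, e₁ f hf, e₂ f hf]
    ring

end FieldOrdLE

/-- The density `⟨Z⟩^a ⟨t⟩`. -/
def densityJ {n : ℕ} (a : ℝ) (Z : Spacetime n) : ℝ := bracketZ Z ^ a * bracketT Z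

theorem densityJ_pos {n : ℕ} (a : ℝ) (Z : Spacetime n) : 0 < densityJ a Z :=
  mul_pos (Real.rpow_pos_of_pos (bracketZ_pos Z) _) (bracketT_pos Z)

theorem contDiff_bracketZ_rpow (n : ℕ) (a : ℝ) :
    ContDiff ℝ ∞ fun Z : Spacetime n => bracketZ Z ^ a :=
  (contDiff_bracketZ n).rpow_const_of_ne fun Z => (bracketZ_pos Z).ne'

theorem contDiff_densityJ {n : ℕ} (a : ℝ) : ContDiff ℝ ∞ (densityJ a : Spacetime n → ℝ) :=
  (contDiff_bracketZ_rpow n a).mul (contDiff_bracketT n)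

theorem smoothX_logZ {n : ℕ} (g : FlatGen n) :
    (fun Z => (g.logZ (toAmbient Z) : ℂ)) ∈ smoothX n :=
  smoothX_of_real g.contDiff_logZ fun _ => rfl

theorem smoothX_logT {n : ℕ} (g : FlatGen n) :
    (fun Z => (g.logT (toAmbient Z) : ℂ)) ∈ smoothX n :=
  smoothX_of_real g.contDiff_logT fun _ => rfl

theorem FlatGen.der_densityJ {n : ℕ} (g : FlatGen n) (a : ℝ) (Z : Spacetime n) :
    g.der (fun Z => (densityJ a Z : ℂ)) Z =
      -Complex.I * (a * g.logZ (toAmbient Z) + g.logT (toAmbient Z)) * densityJ a Z := by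
  have h1 := (hasDerivAt_bracketZ_gen g Z).rpow_const (p := a) (Or.inl (by
    simpa using (bracketZ_pos Z).ne'))
  have h2 := (h1.mul (hasDerivAt_bracketT_gen g Z)).ofReal_comp
  have h3 := fderiv_eq_of_hasDerivAt_line (f := fun Z => (densityJ a Z : ℂ))
    ((contDiff_densityJ a).ofReal_comp.differentiable (by simp) Z) h2
  rw [FlatGen.der, h3, densityJ]
  have hR := bracketZ_pos Z
  simp only [zero_smul, add_zero, Real.rpow_sub_one hR.ne']
  push_cast
  have : (bracketZ Z : ℂ) ≠ 0 := by exact_mod_cast hR.ne'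
  field_simp

theorem fieldOrdLE_vec {n : ℕ} (a : ℝ) (g : FlatGen n) :
    FieldOrdLE (fun Z => (densityJ a Z : ℂ)) g.order g.vec :=
  FieldOrdLE.of_gen (contDiff_densityJ a).ofReal_comp g
    (smoothX_mul (smoothX_const _) (smoothX_add (smoothX_mul (smoothX_const _) (smoothX_logZ g))
      (smoothX_logT g))) fun Z => g.der_densityJ a Z

/-! ### Conical coordinates -/

section Chart

variable {n : ℕ} (p : Fin n) (ε : ℝ)

/-- The direction `(v, ε)`, before normalization: `ε` in slot `p`, and the coordinates `some j` in
the other slots. -/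
def coneNum (m : EuclideanSpace ℝ (Option (Fin n))) : EuclideanSpace ℝ (Fin n) :=
  WithLp.toLp 2 fun j => if j = p then ε else m (some j)

/-- The unit vector in the direction `coneNum`. -/
def coneDir (m : EuclideanSpace ℝ (Option (Fin n))) : EuclideanSpace ℝ (Fin n) :=
  ‖coneNum p ε m‖⁻¹ • coneNum p ε m

/-- The conical coordinates: the coordinate `none` is `arsinh t`, the coordinate `some p` is the
distance of `z / ⟨t⟩` from the tip `-ε e_p` of the cone, and the others are the slopes of the ray
from the tip. With the tip away from the origin the coordinates are regular where `z = 0`. The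
rotations about the tip differ from those about the origin by multiples of the fields `⟨t⟩ ∂_z`. -/
def coneChart (m : EuclideanSpace ℝ (Option (Fin n))) : Spacetime n :=
  (Real.cosh (m none) • (m (some p) • coneDir p ε m - ε • EuclideanSpace.single p 1),
    Real.sinh (m none))

/-- The vector `(z + ε ⟨t⟩ e_p) / ⟨Z⟩`, as a function on `X`. -/
def coneShift (x : BlowupAmbient n) : EuclideanSpace ℝ (Fin n) :=
  x.1 + (ε * x.2.2.2.1) • EuclideanSpace.single p 1

/-- The component of `coneShift` along the axis of the cone. -/
def coneHeight (x : BlowupAmbient n) : ℝ := ε * coneShift p ε x p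

/-- Half the lower bound for `coneHeight` on the region where the cone is used; that bound is
`1 / √n`, a value which some cone attains at every point. -/
def coneGap (n : ℕ) : ℝ := (2 * √n)⁻¹

/-- A smooth function on `X` equal to the direction from the tip where `coneHeight` is at
least `coneGap`. -/
def coneUnit (x : BlowupAmbient n) : EuclideanSpace ℝ (Fin n) :=
  (√(‖coneShift p ε x‖ ^ 2 +
    (1 - Real.smoothTransition (‖coneShift p ε x‖ ^ 2 / coneGap n ^ 2))))⁻¹ • coneShift p ε x

/-- A smooth function on `X` which localizes to the cone: it is `1` where `coneHeight` is at least
`2 * coneGap` and `0` where it is at most `coneGap`. -/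
def coneCutoff (x : BlowupAmbient n) : ℝ :=
  Real.smoothTransition (coneHeight p ε x / coneGap n - 1)

variable {p ε}

theorem abs_eq_one_of_sq {x : ℝ} (hx : x ^ 2 = 1) : |x| = 1 :=
  (sq_eq_sq₀ (abs_nonneg x) zero_le_one).1 (by rw [sq_abs, hx, one_pow])

theorem coneGap_pos (p : Fin n) : 0 < coneGap n := by
  have : 0 < n := p.pos
  unfold coneGap
  positivity

theorem contDiff_coneShift : ContDiff ℝ ∞ (coneShift p ε) := by
  unfold coneShift
  fun_prop

theorem contDiff_coneHeight : ContDiff ℝ ∞ (coneHeight p ε) :=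
  contDiff_const.mul ((EuclideanSpace.proj (𝕜 := ℝ) p).contDiff.comp contDiff_coneShift)

theorem contDiff_coneCutoff : ContDiff ℝ ∞ (coneCutoff p ε) :=
  Real.smoothTransition.contDiff.comp ((contDiff_coneHeight.div_const _).sub contDiff_const)

theorem contDiff_coneUnit : ContDiff ℝ ∞ (coneUnit p ε) := by
  have h1 : ContDiff ℝ ∞ fun x => ‖coneShift p ε x‖ ^ 2 := contDiff_coneShift.norm_sq ℝ
  have h2 : ∀ x, ‖coneShift p ε x‖ ^ 2 +
      (1 - Real.smoothTransition (‖coneShift p ε x‖ ^ 2 / coneGap n ^ 2)) ≠ 0 := by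
    intro x
    have h3 := Real.smoothTransition.le_one (‖coneShift p ε x‖ ^ 2 / coneGap n ^ 2)
    rcases (norm_nonneg (coneShift p ε x)).eq_or_lt with h | h
    · rw [← h]
      simp
    · have : 0 < ‖coneShift p ε x‖ ^ 2 := by positivity
      linarith
  refine ContDiff.smul (ContDiff.inv (ContDiff.sqrt ?_ h2) fun x => ?_) contDiff_coneShift
  · exact h1.add (contDiff_const.sub (Real.smoothTransition.contDiff.comp (h1.div_const _)))
  · rw [Real.sqrt_ne_zero']
    refine lt_of_le_of_ne ?_ (h2 x).symm
    have h3 := Real.smoothTransition.le_one (‖coneShift p ε x‖ ^ 2 / coneGap n ^ 2)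
    have : 0 ≤ ‖coneShift p ε x‖ ^ 2 := by positivity
    linarith

theorem coneNum_apply_self (m : EuclideanSpace ℝ (Option (Fin n))) : coneNum p ε m p = ε := by
  simp [coneNum]

theorem coneNum_apply_ne (m : EuclideanSpace ℝ (Option (Fin n))) {j : Fin n} (h : j ≠ p) :
    coneNum p ε m j = m (some j) := by
  simp [coneNum, h]

theorem one_le_norm_coneNum (hε : ε ^ 2 = 1) (m : EuclideanSpace ℝ (Option (Fin n))) :
    1 ≤ ‖coneNum p ε m‖ := by
  have h := PiLp.norm_apply_le (coneNum p ε m) p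
  rw [coneNum_apply_self, Real.norm_eq_abs, abs_eq_one_of_sq hε] at h
  exact h

theorem norm_coneDir (hε : ε ^ 2 = 1) (m : EuclideanSpace ℝ (Option (Fin n))) :
    ‖coneDir p ε m‖ = 1 := by
  have := one_le_norm_coneNum (p := p) hε m
  rw [coneDir, norm_smul, norm_inv, norm_norm, inv_mul_cancel₀ (by positivity)]

theorem contDiff_coneNum : ContDiff ℝ ∞ (coneNum p ε) := by
  unfold coneNum
  refine (PiLp.contDiff_toLp (𝕜 := ℝ) (p := 2)).comp (contDiff_pi.2 fun j => ?_)
  by_cases h : j = p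
  · simp only [h, if_true]
    exact contDiff_const
  · simp only [h, if_false]
    exact (EuclideanSpace.proj (𝕜 := ℝ) (some j)).contDiff

theorem contDiff_coneDir (hε : ε ^ 2 = 1) : ContDiff ℝ ∞ (coneDir p ε) := by
  have h : ∀ m, coneNum p ε m ≠ 0 := fun m h => by
    have := one_le_norm_coneNum (p := p) hε m
    rw [h, norm_zero] at this
    linarith
  exact ((contDiff_coneNum.norm ℝ h).inv fun m => norm_ne_zero_iff.2 (h m)).smul contDiff_coneNum

theorem contDiff_coneChart (hε : ε ^ 2 = 1) : ContDiff ℝ ∞ (coneChart p ε) := by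
  have h : ∀ i, ContDiff ℝ ∞ fun m : EuclideanSpace ℝ (Option (Fin n)) => m i := fun i =>
    (EuclideanSpace.proj (𝕜 := ℝ) i).contDiff
  exact ((Real.contDiff_cosh.comp (h none)).smul
    (((h (some p)).smul (contDiff_coneDir hε)).sub contDiff_const)).prodMk
    (Real.contDiff_sinh.comp (h none))

theorem bracketT_coneChart (m : EuclideanSpace ℝ (Option (Fin n))) :
    bracketT (coneChart p ε m) = Real.cosh (m none) := by
  rw [bracketT, coneChart]
  dsimp only
  rw [add_comm, ← Real.cosh_sq, Real.sqrt_sq (Real.cosh_pos _).le]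

theorem coneShift_coneChart (m : EuclideanSpace ℝ (Option (Fin n))) :
    coneShift p ε (toAmbient (coneChart p ε m)) =
      (Real.cosh (m none) / bracketZ (coneChart p ε m) * m (some p)) • coneDir p ε m := by
  have hR := bracketZ_pos (coneChart p ε m)
  ext j
  simp only [coneShift, toAmbient, bracketT_coneChart]
  simp only [coneChart, PiLp.add_apply, PiLp.smul_apply, PiLp.sub_apply, smul_eq_mul]
  field_simp
  ring

theorem coneHeight_coneChart (hε : ε ^ 2 = 1) (m : EuclideanSpace ℝ (Option (Fin n))) :
    coneHeight p ε (toAmbient (coneChart p ε m)) =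
      Real.cosh (m none) / bracketZ (coneChart p ε m) * m (some p) * ‖coneNum p ε m‖⁻¹ := by
  rw [coneHeight, coneShift_coneChart, coneDir]
  simp only [PiLp.smul_apply, coneNum_apply_self, smul_eq_mul]
  linear_combination (Real.cosh (m none) / bracketZ (coneChart p ε m) * m (some p) *
    ‖coneNum p ε m‖⁻¹) * hε

theorem radius_pos_of_coneHeight_pos (hε : ε ^ 2 = 1) {m : EuclideanSpace ℝ (Option (Fin n))}
    (h : 0 < coneHeight p ε (toAmbient (coneChart p ε m))) : 0 < m (some p) := by
  rw [coneHeight_coneChart hε] at h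
  have h1 := one_le_norm_coneNum (p := p) hε m
  have h2 := Real.cosh_pos (m none)
  have h3 := bracketZ_pos (coneChart p ε m)
  have h4 : 0 < Real.cosh (m none) / bracketZ (coneChart p ε m) * ‖coneNum p ε m‖⁻¹ := by positivity
  by_contra! h5
  nlinarith

theorem coneHeight_le_norm (hε : ε ^ 2 = 1) (x : BlowupAmbient n) :
    coneHeight p ε x ≤ ‖coneShift p ε x‖ := by
  have h := PiLp.norm_apply_le (coneShift p ε x) p
  refine le_trans (le_abs_self _) ?_
  rwa [coneHeight, abs_mul, abs_eq_one_of_sq hε, one_mul]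

theorem coneUnit_coneChart (hε : ε ^ 2 = 1) {m : EuclideanSpace ℝ (Option (Fin n))}
    (h : coneGap n ≤ coneHeight p ε (toAmbient (coneChart p ε m))) :
    coneUnit p ε (toAmbient (coneChart p ε m)) = coneDir p ε m := by
  have hg := coneGap_pos p
  have hρ := radius_pos_of_coneHeight_pos hε (hg.trans_le h)
  have h1 := h.trans (coneHeight_le_norm hε _)
  have h2 : 1 ≤ ‖coneShift p ε (toAmbient (coneChart p ε m))‖ ^ 2 / coneGap n ^ 2 := by
    rw [le_div_iff₀ (by positivity), one_mul]
    gcongr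
  rw [coneUnit, Real.smoothTransition.one_of_one_le h2, sub_self, add_zero,
    Real.sqrt_sq (norm_nonneg _), coneShift_coneChart, norm_smul, norm_coneDir hε, mul_one,
    smul_smul, Real.norm_of_nonneg, inv_mul_cancel₀, one_smul]
  all_goals
    have h2 := Real.cosh_pos (m none)
    have h3 := bracketZ_pos (coneChart p ε m)
    positivity

variable (p ε) in
/-- The coordinate vector fields of the conical coordinates, expressed through the generators
where `coneHeight` is at least `coneGap`. -/
def coneField (i : Option (Fin n)) (Z : Spacetime n) : Spacetime n :=
  match i with
  | none => FlatGen.dt.vec Z + (bracketZ Z / bracketT Z) •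
      ∑ j, ((toAmbient Z).2.2.2.2.1 * (toAmbient Z).1 j) • (FlatGen.dz j).vec Z
  | some j =>
    if j = p then ∑ l, coneUnit p ε (toAmbient Z) l • (FlatGen.dz l).vec Z
    else (ε * coneUnit p ε (toAmbient Z) p) •
        (∑ l, coneUnit p ε (toAmbient Z) l • (FlatGen.rot l j).vec Z) +
      (coneUnit p ε (toAmbient Z) p) ^ 2 • (FlatGen.dz j).vec Z

theorem sum_smul_single {ι : Type*} [Fintype ι] [DecidableEq ι] (c : ι → ℝ) :
    ∑ j, c j • (EuclideanSpace.single j 1 : EuclideanSpace ℝ ι) = WithLp.toLp 2 c := by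
  ext i
  simp [Finset.sum_apply, EuclideanSpace.single, Pi.single_apply]

theorem sum_smul_dz_vec (c : Fin n → ℝ) (Z : Spacetime n) :
    ∑ j, c j • (FlatGen.dz j).vec Z = (bracketT Z • WithLp.toLp 2 c, 0) := by
  simp only [FlatGen.vec, Prod.smul_mk, smul_zero, smul_comm _ (bracketT Z)]
  rw [← sum_smul_single, Finset.smul_sum]
  refine Prod.ext ?_ ?_ <;> simp [Prod.fst_sum, Prod.snd_sum]

theorem sum_smul_rot_vec (c : Fin n → ℝ) (j : Fin n) (Z : Spacetime n) :
    ∑ l, c l • (FlatGen.rot l j).vec Z =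
      ((∑ l, c l * Z.1 l) • EuclideanSpace.single j 1 - Z.1 j • WithLp.toLp 2 c, 0) := by
  rw [← sum_smul_single, Finset.smul_sum, Finset.sum_smul, ← Finset.sum_sub_distrib]
  refine Prod.ext ?_ ?_
  · rw [Prod.fst_sum]
    refine Finset.sum_congr rfl fun l _ => ?_
    simp only [FlatGen.vec, Prod.smul_mk, smul_sub, smul_smul, mul_comm (c l)]
  · simp [FlatGen.vec, Prod.snd_sum]

theorem coneNum_add_none (m : EuclideanSpace ℝ (Option (Fin n))) (s : ℝ) :
    coneNum p ε (m + s • EuclideanSpace.single none 1) = coneNum p ε m := by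
  ext j
  simp [coneNum]

theorem coneNum_add_self (m : EuclideanSpace ℝ (Option (Fin n))) (s : ℝ) :
    coneNum p ε (m + s • EuclideanSpace.single (some p) 1) = coneNum p ε m := by
  ext j
  by_cases h : j = p <;> simp [coneNum, h]

theorem coneNum_add_ne (m : EuclideanSpace ℝ (Option (Fin n))) (s : ℝ) {j : Fin n} (h : j ≠ p) :
    coneNum p ε (m + s • EuclideanSpace.single (some j) 1) =
      coneNum p ε m + s • EuclideanSpace.single j 1 := by
  ext l
  by_cases h' : l = p
  · subst h'
    simp [coneNum, h]
  · simp [coneNum, h', EuclideanSpace.single]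

theorem hasDerivAt_coneDir (hε : ε ^ 2 = 1) (m : EuclideanSpace ℝ (Option (Fin n))) {j : Fin n}
    (h : j ≠ p) : HasDerivAt (fun s : ℝ => coneDir p ε (m + s • EuclideanSpace.single (some j) 1))
      (‖coneNum p ε m‖⁻¹ • (EuclideanSpace.single j 1 - coneDir p ε m j • coneDir p ε m)) 0 := by
  have h1 : HasDerivAt (fun s : ℝ => coneNum p ε m + s • EuclideanSpace.single j (1 : ℝ))
      (EuclideanSpace.single j 1) 0 := by
    simpa using ((hasDerivAt_id (0 : ℝ)).smul_const (EuclideanSpace.single j (1 : ℝ))).const_add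
      (coneNum p ε m)
  have hN := one_le_norm_coneNum (p := p) hε m
  have hN0 : coneNum p ε m ≠ 0 := fun h0 => by
    rw [h0, norm_zero] at hN
    linarith
  have h2 := (h1.norm_sq).sqrt (by simp [hN0])
  have h3 := (h2.inv (by simp [hN0])).smul h1
  have e : (fun s : ℝ => coneDir p ε (m + s • EuclideanSpace.single (some j) 1)) =
      fun s : ℝ => (√(‖coneNum p ε m + s • EuclideanSpace.single j (1 : ℝ)‖ ^ 2))⁻¹ •
        (coneNum p ε m + s • EuclideanSpace.single j (1 : ℝ)) := by
    funext s
    rw [coneDir, coneNum_add_ne m s h, Real.sqrt_sq (norm_nonneg _)]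
  rw [e]
  refine h3.congr_deriv ?_
  simp only [zero_smul, add_zero, Real.sqrt_sq (norm_nonneg _), EuclideanSpace.inner_single_right,
    coneDir, PiLp.smul_apply, smul_eq_mul, smul_sub, smul_smul, Pi.inv_apply]
  rw [sub_eq_add_neg, ← neg_smul, one_mul]
  congr 2
  simp only [conj_trivial]
  field_simp

end Chart

section Chart

variable {n : ℕ} {p : Fin n} {ε : ℝ}

theorem coneChart_snd (m : EuclideanSpace ℝ (Option (Fin n))) :
    (coneChart p ε m).2 = Real.sinh (m none) := rfl

theorem coneChart_fst (m : EuclideanSpace ℝ (Option (Fin n))) :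
    (coneChart p ε m).1 =
      Real.cosh (m none) • (m (some p) • coneDir p ε m - ε • EuclideanSpace.single p 1) := rfl

theorem coneDir_apply_self (m : EuclideanSpace ℝ (Option (Fin n))) :
    coneDir p ε m p = ε * ‖coneNum p ε m‖⁻¹ := by
  rw [coneDir, PiLp.smul_apply, coneNum_apply_self, smul_eq_mul, mul_comm]

theorem sum_coneDir_mul_fst (hε : ε ^ 2 = 1) (m : EuclideanSpace ℝ (Option (Fin n))) :
    ∑ l, coneDir p ε m l * (coneChart p ε m).1 l =
      Real.cosh (m none) * (m (some p) - ε * coneDir p ε m p) := by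
  have h1 : ∑ l, coneDir p ε m l * (coneChart p ε m).1 l =
      inner ℝ (coneDir p ε m) (coneChart p ε m).1 := by
    simp [PiLp.inner_apply, mul_comm]
  rw [h1, coneChart_fst, inner_smul_right, inner_sub_right, inner_smul_right, inner_smul_right,
    real_inner_self_eq_norm_sq, norm_coneDir hε, EuclideanSpace.inner_single_right]
  simp

/-- The coordinate fields of the conical coordinates are the fields `coneField`. -/
theorem hasDerivAt_coneChart (hε : ε ^ 2 = 1) {m : EuclideanSpace ℝ (Option (Fin n))}
    (h : coneGap n ≤ coneHeight p ε (toAmbient (coneChart p ε m))) (i : Option (Fin n)) :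
    HasDerivAt (fun s : ℝ => coneChart p ε (m + s • EuclideanSpace.single i 1))
      (coneField p ε i (coneChart p ε m)) 0 := by
  have hT := Real.cosh_pos (m none)
  have hR := bracketZ_pos (coneChart p ε m)
  match i with
  | none =>
    have h0 : HasDerivAt (fun s : ℝ => m none + s) 1 0 := (hasDerivAt_id (0 : ℝ)).const_add _
    have h1 := (h0.cosh.smul_const
      (m (some p) • coneDir p ε m - ε • EuclideanSpace.single p (1 : ℝ))).prodMk h0.sinh
    have e : (fun s : ℝ => coneChart p ε (m + s • EuclideanSpace.single none 1)) = fun s : ℝ =>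
        (Real.cosh (m none + s) •
          (m (some p) • coneDir p ε m - ε • EuclideanSpace.single p (1 : ℝ)),
          Real.sinh (m none + s)) := by
      funext s
      simp [coneChart, coneDir, coneNum_add_none]
    rw [e]
    refine h1.congr_deriv ?_
    rw [coneField, sum_smul_dz_vec]
    refine Prod.ext ?_ ?_
    · ext j
      simp only [FlatGen.vec, toAmbient, bracketT_coneChart, coneChart_snd]
      simp only [coneChart_fst, Prod.fst_add, Prod.smul_mk, PiLp.smul_apply,
        smul_eq_mul, zero_add, PiLp.sub_apply, add_zero]
      field_simp
    · simp [FlatGen.vec, bracketT_coneChart]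
  | some j =>
    by_cases hj : j = p
    · subst hj
      have h0 : HasDerivAt (fun s : ℝ => m (some j) + s) 1 0 :=
        (hasDerivAt_id (0 : ℝ)).const_add _
      have h1 := (((h0.smul_const (coneDir j ε m)).sub_const
        (ε • EuclideanSpace.single j (1 : ℝ))).const_smul (Real.cosh (m none))).prodMk
        (hasDerivAt_const (0 : ℝ) (Real.sinh (m none)))
      have e : (fun s : ℝ => coneChart j ε (m + s • EuclideanSpace.single (some j) 1)) =
          fun s : ℝ => (Real.cosh (m none) •
            ((m (some j) + s) • coneDir j ε m - ε • EuclideanSpace.single j (1 : ℝ)),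
            Real.sinh (m none)) := by
        funext s
        simp [coneChart, coneDir, coneNum_add_self]
      rw [e]
      refine h1.congr_deriv ?_
      simp only [coneField, if_true]
      rw [sum_smul_dz_vec, coneUnit_coneChart hε h, bracketT_coneChart, one_smul]
    · have h1 := ((((hasDerivAt_coneDir hε m hj).const_smul (m (some p))).sub_const
        (ε • EuclideanSpace.single p (1 : ℝ))).const_smul (Real.cosh (m none))).prodMk
        (hasDerivAt_const (0 : ℝ) (Real.sinh (m none)))
      have e : (fun s : ℝ => coneChart p ε (m + s • EuclideanSpace.single (some j) 1)) =
          fun s : ℝ => (Real.cosh (m none) • (m (some p) •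
            coneDir p ε (m + s • EuclideanSpace.single (some j) 1) -
              ε • EuclideanSpace.single p (1 : ℝ)), Real.sinh (m none)) := by
        funext s
        have : ¬p = j := fun h => hj h.symm
        simp [coneChart, this]
      rw [e]
      refine h1.congr_deriv ?_
      simp only [coneField, if_neg hj]
      rw [sum_smul_rot_vec, coneUnit_coneChart hε h, sum_coneDir_mul_fst hε]
      have hz : (coneChart p ε m).1 j = Real.cosh (m none) * (m (some p) * coneDir p ε m j) := by
        simp [coneChart_fst, hj]
      rw [hz]
      refine Prod.ext ?_ ?_
      · ext l
        simp only [FlatGen.vec, bracketT_coneChart, Prod.smul_mk, Prod.fst_add, PiLp.smul_apply,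
          PiLp.add_apply, PiLp.sub_apply, smul_eq_mul, coneDir_apply_self]
        linear_combination (-(Real.cosh (m none) * m (some p) * ‖coneNum p ε m‖⁻¹ *
          ((EuclideanSpace.single j (1 : ℝ) : EuclideanSpace ℝ (Fin n)) l -
            coneDir p ε m j * coneDir p ε m l)) +
          Real.cosh (m none) * ε ^ 2 * ‖coneNum p ε m‖⁻¹ ^ 2 *
            (EuclideanSpace.single j (1 : ℝ) : EuclideanSpace ℝ (Fin n)) l) * hε
      · simp [FlatGen.vec]

theorem smoothX_coneUnit (l : Fin n) :
    (fun Z => ((coneUnit p ε (toAmbient Z) l : ℝ) : ℂ)) ∈ smoothX n :=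
  smoothX_of_real (F := fun x => coneUnit p ε x l)
    ((EuclideanSpace.proj (𝕜 := ℝ) l).contDiff.comp contDiff_coneUnit) fun _ => rfl

/-- The time coordinate field has order `2` and the others have order `1`. -/
theorem fieldOrdLE_coneField (a : ℝ) (i : Option (Fin n)) :
    FieldOrdLE (fun Z => (densityJ a Z : ℂ)) (if i = none then 2 else 1) (coneField p ε i) := by
  match i with
  | none =>
    refine FieldOrdLE.add (fieldOrdLE_vec a .dt) (FieldOrdLE.weight (d := 1)
      (FieldOrdLE.sum _ fun j _ => FieldOrdLE.smul (fieldOrdLE_vec a (.dz j)) ?_))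
    refine smoothX_of_real (F := fun x => x.2.2.2.2.1 * x.1 j) ?_ fun _ => rfl
    exact ContDiff.mul (by fun_prop) (contDiff_ambient_coord j)
  | some j =>
    by_cases hj : j = p
    · have e : coneField p ε (some j) = fun Z =>
          ∑ l, coneUnit p ε (toAmbient Z) l • (FlatGen.dz l).vec Z := by
        funext Z
        simp [coneField, hj]
      simp only [e, reduceCtorEq, if_false]
      exact FieldOrdLE.sum _ fun l _ => FieldOrdLE.smul (fieldOrdLE_vec a (.dz l))
        (smoothX_coneUnit l)
    · have e : coneField p ε (some j) = fun Z => (ε * coneUnit p ε (toAmbient Z) p) •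
          (∑ l, coneUnit p ε (toAmbient Z) l • (FlatGen.rot l j).vec Z) +
          (coneUnit p ε (toAmbient Z) p) ^ 2 • (FlatGen.dz j).vec Z := by
        funext Z
        simp [coneField, hj]
      simp only [e, reduceCtorEq, if_false]
      refine FieldOrdLE.add (FieldOrdLE.smul (FieldOrdLE.sum _ fun l _ => FieldOrdLE.smul
        (fieldOrdLE_vec a (.rot l j)) (smoothX_coneUnit l)) ?_)
        (FieldOrdLE.smul (fieldOrdLE_vec a (.dz j)) ?_)
      · push_cast
        exact smoothX_mul (smoothX_const _) (smoothX_coneUnit p)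
      · push_cast
        simp only [sq]
        exact smoothX_mul (smoothX_coneUnit p) (smoothX_coneUnit p)

theorem continuous_coneHeight_toAmbient :
    Continuous fun Z : Spacetime n => coneHeight p ε (toAmbient Z) :=
  contDiff_coneHeight.continuous.comp (contDiff_toAmbient n).continuous

/-- In conical coordinates, coordinate derivatives of `J` times a combination of generators are
again of this form, with the orders adding up. -/
theorem exists_coordDeriv_coneChart (hε : ε ^ 2 = 1) (a : ℝ) {m₀ : ℕ}
    {Q : (Spacetime n → ℂ) → Spacetime n → ℂ} (hQ : ActComb m₀ Q)
    (hQ0 : ∀ f, ContDiff ℝ ∞ f → ∀ Z, coneHeight p ε (toAmbient Z) < coneGap n → Q f Z = 0)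
    (l : List (Option (Fin n))) :
    ∃ Q', ActComb (m₀ + coordOrd l) Q' ∧
      (∀ f, ContDiff ℝ ∞ f → ∀ Z, coneHeight p ε (toAmbient Z) < coneGap n → Q' f Z = 0) ∧
      ∀ f, ContDiff ℝ ∞ f → ∀ m,
        coordDeriv l (fun m => (densityJ a (coneChart p ε m) : ℂ) * Q f (coneChart p ε m)) m =
          densityJ a (coneChart p ε m) * Q' f (coneChart p ε m) := by
  induction l with
  | nil => exact ⟨Q, hQ, hQ0, fun f hf m => rfl⟩
  | cons i l ih =>
    obtain ⟨Q₁, h₁, h₁0, e₁⟩ := ih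
    obtain ⟨Q₂, h₂, e₂⟩ := fieldOrdLE_coneField (p := p) (ε := ε) a i _ _ h₁
    have key : ∀ f, ContDiff ℝ ∞ f → ∀ Z, coneHeight p ε (toAmbient Z) < coneGap n →
        fderiv ℝ (fun Z => (densityJ a Z : ℂ) * Q₁ f Z) Z = 0 := by
      intro f hf Z hZ
      have : (fun Z => (densityJ a Z : ℂ) * Q₁ f Z) =ᶠ[nhds Z] fun _ => 0 := by
        filter_upwards [(isOpen_lt continuous_coneHeight_toAmbient
          (continuous_const (y := coneGap n))).mem_nhds hZ] with W hW
        rw [h₁0 f hf W hW, mul_zero]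
      rw [this.fderiv_eq]
      simp
    refine ⟨Q₂, ?_, fun f hf Z hZ => ?_, fun f hf m => ?_⟩
    · convert h₂ using 1
      cases i <;> simp <;> ring
    · have h := e₂ f hf Z
      rw [key f hf Z hZ, zero_apply, zero_eq_mul] at h
      exact h.resolve_left (Complex.ofReal_ne_zero.2 (densityJ_pos a Z).ne')
    · have hd : DifferentiableAt ℝ (fun Z => (densityJ a Z : ℂ) * Q₁ f Z) (coneChart p ε m) :=
        ((contDiff_densityJ a).ofReal_comp.mul (h₁.contDiff hf)).differentiable (by simp) _
      have hc := (contDiff_coneChart (p := p) hε).differentiable (by simp) m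
      have e : coordDeriv (i :: l) (fun m => (densityJ a (coneChart p ε m) : ℂ) *
          Q f (coneChart p ε m)) m = fderiv ℝ ((fun Z => (densityJ a Z : ℂ) * Q₁ f Z) ∘
            coneChart p ε) m (EuclideanSpace.single i 1) := by
        change fderiv ℝ (coordDeriv l _) m _ = _
        rw [funext (e₁ f hf)]
        rfl
      rw [e, fderiv_comp m hd hc, ContinuousLinearMap.comp_apply, ← e₂ f hf]
      by_cases hm : coneHeight p ε (toAmbient (coneChart p ε m)) < coneGap n
      · rw [key f hf _ hm, zero_apply, zero_apply]
      · rw [← (hasDerivAt_coneChart hε (not_lt.1 hm) i).deriv]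
        rw [← hc.lineDeriv_eq_fderiv]
        rfl

theorem coneCutoff_eq_zero (x : BlowupAmbient n) (h : coneHeight p ε x < coneGap n) :
    coneCutoff p ε x = 0 := by
  refine Real.smoothTransition.zero_of_nonpos ?_
  have := (div_lt_one (coneGap_pos p)).2 h
  linarith

theorem coneCutoff_eq_one {x : BlowupAmbient n} (h : 2 * coneGap n ≤ coneHeight p ε x) :
    coneCutoff p ε x = 1 := by
  refine Real.smoothTransition.one_of_one_le ?_
  have := (le_div_iff₀ (coneGap_pos p)).2 h
  linarith

theorem smoothX_coneCutoff : (fun Z => (coneCutoff p ε (toAmbient Z) : ℂ)) ∈ smoothX n :=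
  smoothX_of_real contDiff_coneCutoff fun _ => rfl

/-- The cones cover spacetime. -/
theorem exists_coneHeight_ge (hn : 1 ≤ n) (Z : Spacetime n) :
    ∃ p : Fin n, ∃ ε : ℝ, (ε = 1 ∨ ε = -1) ∧ 2 * coneGap n ≤ coneHeight p ε (toAmbient Z) := by
  by_contra! H
  set r := bracketT Z / bracketZ Z with hr
  have hr0 : 0 < r := div_pos (bracketT_pos Z) (bracketZ_pos Z)
  have h1 : ∀ p : Fin n, |(toAmbient Z).1 p| + r < 2 * coneGap n := by
    intro p
    rcases le_total 0 ((toAmbient Z).1 p) with h | h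
    · have := H p 1 (Or.inl rfl)
      rw [abs_of_nonneg h]
      simpa [coneHeight, coneShift, toAmbient, hr, add_comm, add_left_comm] using this
    · have := H p (-1) (Or.inr rfl)
      rw [abs_of_nonpos h]
      simp [coneHeight, coneShift, toAmbient, hr] at this ⊢
      linarith
  have hn0 : (0 : ℝ) < n := by exact_mod_cast hn
  have h2 : (2 * coneGap n) ^ 2 = 1 / n := by
    rw [coneGap, mul_inv, ← mul_assoc, mul_inv_cancel₀ two_ne_zero, one_mul, inv_pow,
      Real.sq_sqrt hn0.le, one_div]
  obtain ⟨h3, -, -, h4, -, h5, h6⟩ := toAmbient_mem_blowup Z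
  have h7 : ‖(toAmbient Z).1‖ ^ 2 + r ^ 2 = 1 := by
    have e : (toAmbient Z).2.2.2.1 = r := rfl
    change ‖(toAmbient Z).1‖ ^ 2 + (toAmbient Z).2.1 ^ 2 + (toAmbient Z).2.2.1 ^ 2 = 1 at h3
    change (toAmbient Z).2.1 = r * _ at h5
    change (toAmbient Z).2.2.1 = r * _ at h6
    rw [h5, h6] at h3
    linear_combination h3 - r ^ 2 * h4
  rw [EuclideanSpace.norm_sq_eq] at h7
  simp only [Real.norm_eq_abs, sq_abs] at h7
  have h8 : ∀ p : Fin n, (toAmbient Z).1 p ^ 2 < 1 / n - r ^ 2 := by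
    intro p
    have := abs_nonneg ((toAmbient Z).1 p)
    rw [← h2, ← sq_abs]
    nlinarith [h1 p]
  have h9 := Finset.sum_lt_sum_of_nonempty (s := Finset.univ) ⟨⟨0, hn⟩, Finset.mem_univ _⟩
    fun p _ => h8 p
  rw [Finset.sum_const, Finset.card_univ, Fintype.card_fin,
    nsmul_eq_mul, mul_sub, mul_one_div_cancel hn0.ne'] at h9
  have : (1 : ℝ) ≤ n := by exact_mod_cast hn
  nlinarith [sq_nonneg r]

end Chart

/-! ### Integration in conical coordinates -/

theorem lintegral_eq_mul_lintegral_comp_smul {E : Type*} [NormedAddCommGroup E] [NormedSpace ℝ E]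
    [FiniteDimensional ℝ E] [MeasurableSpace E] [BorelSpace E] (μ : Measure E)
    [μ.IsAddHaarMeasure] (f : E → ℝ≥0∞) {c : ℝ} (hc : c ≠ 0) :
    ∫⁻ x, f x ∂μ = ENNReal.ofReal (|c| ^ Module.finrank ℝ E) * ∫⁻ x, f (c • x) ∂μ := by
  have h1 : ∫⁻ x, f (c • x) ∂μ = ∫⁻ x, f x ∂(μ.map (c • ·)) :=
    (lintegral_map_equiv f (Homeomorph.smulOfNeZero c hc).toMeasurableEquiv).symm
  rw [h1, Measure.map_addHaar_smul μ hc, lintegral_smul_measure, smul_eq_mul, ← mul_assoc,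
    ← ENNReal.ofReal_mul (by positivity), abs_inv, abs_pow, mul_inv_cancel₀ (by positivity),
    ENNReal.ofReal_one, one_mul]

/-- The point of `ℝ × ℝⁿ` with time coordinate `s` and space coordinates `w`. -/
def timeJoin {n : ℕ} (s : ℝ) (w : EuclideanSpace ℝ (Fin n)) : EuclideanSpace ℝ (Option (Fin n)) :=
  WithLp.toLp 2 fun i => Option.elim i s fun j => w j

theorem lintegral_option {n : ℕ} {F : EuclideanSpace ℝ (Option (Fin n)) → ℝ≥0∞}
    (hF : Measurable F) : ∫⁻ x, F x = ∫⁻ s : ℝ, ∫⁻ w, F (timeJoin s w) := by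
  have h1 : ∫⁻ x, F x = ∫⁻ x : Option (Fin n) → ℝ, F (WithLp.toLp 2 x) :=
    ((PiLp.volume_preserving_toLp _).lintegral_comp hF).symm
  have h2 := Measure.pi_map_piOptionEquivProd (ι := Fin n) (β := fun _ => ℝ) fun _ => volume
  have h3 : Measurable fun x : Option (Fin n) → ℝ => F (WithLp.toLp 2 x) :=
    hF.comp (WithLp.measurable_toLp 2 _)
  rw [h1, volume_pi, ← h2, lintegral_map_equiv, lintegral_prod_symm' _ (by
    exact h3.comp (MeasurableEquiv.measurable _))]
  refine lintegral_congr fun s => ?_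
  have h4 : Measurable fun w : EuclideanSpace ℝ (Fin n) => F (timeJoin s w) := by
    refine hF.comp ((WithLp.measurable_toLp 2 _).comp (measurable_pi_lambda _ fun i => ?_))
    cases i
    · exact measurable_const
    · exact (EuclideanSpace.proj (𝕜 := ℝ) _).continuous.measurable
  rw [← (PiLp.volume_preserving_toLp _).lintegral_comp h4]
  refine lintegral_congr fun w => ?_
  congr 2
  funext i
  cases i <;> rfl

/-- The point with coordinate `q` in slot `p` and the other coordinates given by `v`. -/
def slotJoin {m : ℕ} (p : Fin (m + 1)) (q : ℝ) (v : Fin m → ℝ) : EuclideanSpace ℝ (Fin (m + 1)) :=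
  WithLp.toLp 2 (p.insertNth q v : Fin (m + 1) → ℝ)

theorem continuous_slotJoin {m : ℕ} (p : Fin (m + 1)) :
    Continuous fun x : ℝ × (Fin m → ℝ) => slotJoin p x.1 x.2 :=
  (PiLp.continuous_toLp 2 _).comp (Continuous.finInsertNth p continuous_fst continuous_snd)

theorem smul_slotJoin {m : ℕ} (p : Fin (m + 1)) (s q : ℝ) (v : Fin m → ℝ) :
    s • slotJoin p q v = slotJoin p (s * q) (s • v) := by
  ext j
  rcases Fin.eq_self_or_eq_succAbove p j with h | ⟨i, h⟩ <;> simp [slotJoin, h]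

theorem lintegral_slotJoin {m : ℕ} (p : Fin (m + 1)) {F : EuclideanSpace ℝ (Fin (m + 1)) → ℝ≥0∞}
    (hF : Measurable F) : ∫⁻ x, F x = ∫⁻ q : ℝ, ∫⁻ v, F (slotJoin p q v) := by
  have h1 : ∫⁻ x, F x = ∫⁻ x : Fin (m + 1) → ℝ, F (WithLp.toLp 2 x) :=
    ((PiLp.volume_preserving_toLp _).lintegral_comp hF).symm
  have h3 : Measurable fun x : Fin (m + 1) → ℝ => F (WithLp.toLp 2 x) :=
    hF.comp (WithLp.measurable_toLp 2 _)
  rw [h1, ← ((volume_preserving_piFinSuccAbove (fun _ : Fin (m + 1) => ℝ) p).symm _).lintegral_comp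
    h3, Measure.volume_eq_prod]
  exact lintegral_prod _ (hF.comp (continuous_slotJoin p).measurable).aemeasurable

/-- Integration over a cone with its tip at the origin, in polar-type coordinates. -/
theorem lintegral_cone {m : ℕ} (p : Fin (m + 1)) {ε : ℝ} (hε : ε ^ 2 = 1)
    {f : EuclideanSpace ℝ (Fin (m + 1)) → ℝ≥0∞} (hf : Measurable f)
    (hf0 : ∀ x, ε * x p ≤ 0 → f x = 0) :
    ∫⁻ x, f x = ∫⁻ w : EuclideanSpace ℝ (Fin (m + 1)),
      ENNReal.ofReal (w p ^ m * ‖coneNum p ε (timeJoin 0 w)‖⁻¹ ^ (m + 1)) *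
        f (w p • coneDir p ε (timeJoin 0 w)) := by
  have hε' := abs_eq_one_of_sq hε
  have hε0 : ε ≠ 0 := fun h => by simp [h] at hε
  have hpos : ∀ v : Fin m → ℝ, 0 < ‖slotJoin p ε v‖ := fun v => by
    have h := PiLp.norm_apply_le (slotJoin p ε v) p
    have e : (slotJoin p ε v) p = ε := by simp [slotJoin]
    rw [e, Real.norm_eq_abs, hε'] at h
    linarith
  have hnum : ∀ q v, coneNum p ε (timeJoin 0 (slotJoin p q v)) = slotJoin p ε v := by
    intro q v
    ext j
    rcases Fin.eq_self_or_eq_succAbove p j with h | ⟨i, h⟩ <;>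
      simp [slotJoin, coneNum, timeJoin, h]
  have hzero : ∀ (s : ℝ) v, s ≤ 0 → f (s • slotJoin p ε v) = 0 := by
    intro s v hs
    refine hf0 _ ?_
    have : ε * (s • slotJoin p ε v) p = s := by
      simp [slotJoin]
      linear_combination s * hε
    rwa [this]
  have hjoin := continuous_slotJoin (m := m) p
  have hm1 : Measurable fun x : ℝ × (Fin m → ℝ) => f (x.1 • slotJoin p ε x.2) :=
    hf.comp (continuous_fst.smul (hjoin.comp (continuous_const.prodMk continuous_snd))).measurable
  have htime : Continuous fun w : EuclideanSpace ℝ (Fin (m + 1)) => timeJoin 0 w := by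
    refine (PiLp.continuous_toLp 2 _).comp (continuous_pi fun i => ?_)
    cases i
    · exact continuous_const
    · exact (EuclideanSpace.proj (𝕜 := ℝ) _).continuous
  have hm2 : Measurable fun w : EuclideanSpace ℝ (Fin (m + 1)) =>
      ENNReal.ofReal (w p ^ m * ‖coneNum p ε (timeJoin 0 w)‖⁻¹ ^ (m + 1)) *
        f (w p • coneDir p ε (timeJoin 0 w)) := by
    have h1 : Measurable fun w : EuclideanSpace ℝ (Fin (m + 1)) => w p :=
      (EuclideanSpace.proj (𝕜 := ℝ) p).continuous.measurable
    have h2 : Measurable fun w : EuclideanSpace ℝ (Fin (m + 1)) => coneNum p ε (timeJoin 0 w) :=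
      (contDiff_coneNum.continuous.comp htime).measurable
    have h3 : Measurable fun w : EuclideanSpace ℝ (Fin (m + 1)) => coneDir p ε (timeJoin 0 w) :=
      ((contDiff_coneDir hε).continuous.comp htime).measurable
    exact (((h1.pow_const m).mul (h2.norm.inv.pow_const _)).ennreal_ofReal).mul
      (hf.comp (h1.smul h3))
  calc ∫⁻ x, f x = ∫⁻ q : ℝ, ∫⁻ v, f (slotJoin p q v) := lintegral_slotJoin p hf
    _ = ∫⁻ s : ℝ, ∫⁻ v, f (slotJoin p (ε * s) v) := by
        rw [lintegral_eq_mul_lintegral_comp_smul volume _ hε0, hε']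
        simp
    _ = ∫⁻ s : ℝ, ∫⁻ v, ENNReal.ofReal (|s| ^ m) * f (s • slotJoin p ε v) := by
        refine lintegral_congr fun s => ?_
        rcases le_or_gt s 0 with hs | hs
        · simp only [hzero _ _ hs, mul_zero]
          refine lintegral_congr fun v => hf0 _ ?_
          have : ε * (slotJoin p (ε * s) v) p = s := by
            simp [slotJoin]
            linear_combination s * hε
          rwa [this]
        · rw [lintegral_eq_mul_lintegral_comp_smul volume _ hs.ne', lintegral_const_mul'
            _ _ ENNReal.ofReal_ne_top]
          simp [smul_slotJoin, mul_comm]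
    _ = ∫⁻ v, ∫⁻ s : ℝ, ENNReal.ofReal (|s| ^ m) * f (s • slotJoin p ε v) := by
        refine lintegral_lintegral_swap (Measurable.aemeasurable ?_)
        exact Measurable.mul (by fun_prop) hm1
    _ = ∫⁻ v, ∫⁻ q : ℝ, ENNReal.ofReal (q ^ m * ‖slotJoin p ε v‖⁻¹ ^ (m + 1)) *
          f (q • ‖slotJoin p ε v‖⁻¹ • slotJoin p ε v) := by
        refine lintegral_congr fun v => ?_
        have hN := hpos v
        rw [lintegral_eq_mul_lintegral_comp_smul volume _ (inv_ne_zero hN.ne'),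
          ← lintegral_const_mul' _ _ ENNReal.ofReal_ne_top]
        refine lintegral_congr fun q => ?_
        rw [smul_smul, smul_eq_mul, mul_comm q]
        rcases le_or_gt q 0 with hq | hq
        · rw [hzero _ _ (mul_nonpos_of_nonneg_of_nonpos (by positivity) hq), mul_zero, mul_zero,
            mul_zero]
        · rw [← mul_assoc, ← ENNReal.ofReal_mul (by positivity)]
          congr 2
          rw [abs_of_pos (by positivity), abs_of_pos (by positivity)]
          simp
          ring
    _ = ∫⁻ q : ℝ, ∫⁻ v, ENNReal.ofReal (q ^ m * ‖slotJoin p ε v‖⁻¹ ^ (m + 1)) *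
          f (q • ‖slotJoin p ε v‖⁻¹ • slotJoin p ε v) := by
        refine lintegral_lintegral_swap (Measurable.aemeasurable ?_)
        have h1 : Measurable fun x : (Fin m → ℝ) × ℝ => slotJoin p ε x.1 :=
          (hjoin.comp (continuous_const.prodMk continuous_fst)).measurable
        exact Measurable.mul ((measurable_snd.pow_const m).mul
          (h1.norm.inv.pow_const _)).ennreal_ofReal
          (hf.comp (measurable_snd.smul (h1.norm.inv.smul h1)))
    _ = _ := by
        rw [lintegral_slotJoin p hm2]
        refine lintegral_congr fun q => lintegral_congr fun v => ?_
        have e : (slotJoin p q v) p = q := by simp [slotJoin]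
        rw [e, coneDir, hnum]

/-- Integration over spacetime in conical coordinates. -/
theorem lintegral_coneChart {n : ℕ} (p : Fin n) {ε : ℝ} (hε : ε ^ 2 = 1)
    {h : Spacetime n → ℝ≥0∞} (hh : Measurable h)
    (h0 : ∀ Z, coneHeight p ε (toAmbient Z) ≤ 0 → h Z = 0) :
    ∫⁻ Z, h Z = ∫⁻ m : EuclideanSpace ℝ (Option (Fin n)),
      ENNReal.ofReal (Real.cosh (m none) ^ (n + 1) *
        (m (some p) ^ (n - 1) * ‖coneNum p ε m‖⁻¹ ^ n)) * h (coneChart p ε m) := by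
  obtain ⟨k, rfl⟩ : ∃ k, n = k + 1 := ⟨n - 1, (Nat.sub_add_cancel p.pos).symm⟩
  rw [Nat.add_sub_cancel]
  have hmeas : Measurable fun m : EuclideanSpace ℝ (Option (Fin (k + 1))) =>
      ENNReal.ofReal (Real.cosh (m none) ^ (k + 1 + 1) *
        (m (some p) ^ k * ‖coneNum p ε m‖⁻¹ ^ (k + 1))) * h (coneChart p ε m) := by
    have h1 : ∀ i, Measurable fun m : EuclideanSpace ℝ (Option (Fin (k + 1))) => m i :=
      fun i => (EuclideanSpace.proj (𝕜 := ℝ) i).continuous.measurable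
    exact (((Real.measurable_cosh.comp (h1 none)).pow_const _).mul (((h1 _).pow_const _).mul
      (contDiff_coneNum.continuous.measurable.norm.inv.pow_const _))).ennreal_ofReal.mul
      (hh.comp (contDiff_coneChart hε).continuous.measurable)
  have hcone : ∀ s w, coneNum p ε (timeJoin s w) = coneNum p ε (timeJoin 0 w) := fun s w => by
    ext j
    simp [coneNum, timeJoin]
  rw [lintegral_option hmeas, Measure.volume_eq_prod, lintegral_prod_symm' _ hh]
  have h1 := lintegral_image_eq_lintegral_abs_deriv_mul (s := Set.univ) MeasurableSet.univ
    (fun x _ => (Real.hasDerivAt_sinh x).hasDerivWithinAt) Real.sinh_injective.injOn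
    (fun t => ∫⁻ z : EuclideanSpace ℝ (Fin (k + 1)), h (z, t))
  rw [Set.image_univ, Real.sinh_surjective.range_eq, setLIntegral_univ, setLIntegral_univ] at h1
  rw [h1]
  refine lintegral_congr fun s => ?_
  have hc := Real.cosh_pos s
  rw [lintegral_eq_mul_lintegral_comp_smul volume _ hc.ne',
    ← lintegral_sub_right_eq_self _ (ε • EuclideanSpace.single p (1 : ℝ)), ← mul_assoc,
    ← ENNReal.ofReal_mul (by positivity), lintegral_cone p hε]
  · rw [← lintegral_const_mul' _ _ ENNReal.ofReal_ne_top]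
    refine lintegral_congr fun w => ?_
    have e1 : (timeJoin s w) none = s := rfl
    have e2 : (timeJoin s w) (some p) = w p := rfl
    have e3 : coneChart p ε (timeJoin s w) = (Real.cosh s • (w p • coneDir p ε (timeJoin 0 w) -
        ε • EuclideanSpace.single p (1 : ℝ)), Real.sinh s) := by
      rw [coneChart, e1, e2, coneDir, coneDir, hcone]
    rw [e1, e2, e3, ← mul_assoc, ← ENNReal.ofReal_mul (by positivity), hcone s,
      finrank_euclideanSpace, Fintype.card_fin, abs_of_pos hc, pow_succ' (Real.cosh s) (k + 1)]
  · refine hh.comp (Continuous.measurable ?_)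
    fun_prop
  · intro x hx
    refine h0 _ ?_
    have hT : bracketT ((Real.cosh s • (x - ε • EuclideanSpace.single p (1 : ℝ)), Real.sinh s) :
        Spacetime (k + 1)) = Real.cosh s := by
      rw [bracketT]
      dsimp only
      rw [add_comm, ← Real.cosh_sq, Real.sqrt_sq hc.le]
    have hR := bracketZ_pos ((Real.cosh s • (x - ε • EuclideanSpace.single p (1 : ℝ)),
      Real.sinh s) : Spacetime (k + 1))
    simp only [coneHeight, coneShift, toAmbient, hT]
    simp only [PiLp.add_apply, PiLp.smul_apply, PiLp.sub_apply, smul_eq_mul,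
      PiLp.single_apply, if_true, mul_one]
    have : ∀ R : ℝ, ε * (R⁻¹ * (Real.cosh s * (x p - ε)) + ε * (Real.cosh s / R)) =
        (R⁻¹ * Real.cosh s) * (ε * x p) := fun R => by ring
    rw [this]
    exact mul_nonpos_of_nonneg_of_nonpos (by positivity) hx

/-! ### The product estimate for compactly supported functions -/

/-- The norm of `⟨Z⟩^{-r} L²`. -/
def weightedNorm {n : ℕ} (r : ℝ) (f : Spacetime n → ℂ) : ℝ≥0∞ :=
  eLpNorm (fun Z => ((bracketZ Z ^ r : ℝ) : ℂ) * f Z) 2 volume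

/-- The sum of the weighted norms of all products of generators of order at most `k` applied
to a smooth function. -/
def wordNorm {n : ℕ} (r : ℝ) (k : ℕ) (f : Spacetime n → ℂ) : ℝ≥0∞ :=
  ∑ l ∈ words n k, weightedNorm r (wordAct l f)

theorem words_mono {n m k : ℕ} (h : m ≤ k) : words n m ⊆ words n k := fun _ hl =>
  mem_words.2 ((mem_words.1 hl).trans h)

theorem wordNorm_mono {n : ℕ} (r : ℝ) {m k : ℕ} (h : m ≤ k) (f : Spacetime n → ℂ) :
    wordNorm r m f ≤ wordNorm r k f := Finset.sum_le_sum_of_subset (words_mono h)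

theorem HasCompactSupport.wordAct {n : ℕ} {f : Spacetime n → ℂ} (hf : HasCompactSupport f)
    (l : List (FlatGen n)) : HasCompactSupport (wordAct l f) := by
  induction l with
  | nil => exact hf
  | cons g l ih =>
    refine ih.mono' fun Z hZ => ?_
    by_contra h
    refine hZ ?_
    have h1 := image_eq_zero_of_notMem_tsupport h
    have h2 : fderiv ℝ (_root_.wordAct l f) Z = 0 := by
      have := notMem_tsupport_iff_eventuallyEq.1 h
      rw [this.fderiv_eq]
      simp
    simp [FlatGen.act, FlatGen.der, h1, h2]

theorem ActComb.exists_weightedNorm_le {n m : ℕ} {Q : (Spacetime n → ℂ) → Spacetime n → ℂ}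
    (h : ActComb m Q) (r : ℝ) : ∃ C : ℝ≥0, ∀ f, ContDiff ℝ ∞ f →
      weightedNorm r (Q f) ≤ C * wordNorm r m f := by
  obtain ⟨C, hC, hQ⟩ := h.exists_bound
  refine ⟨C.toNNReal, fun f hf => eLpNorm_le_sum_of_norm_le _ hC (fun l _ => ?_)
    (Filter.Eventually.of_forall fun Z => ?_)⟩
  · exact ((contDiff_bracketZ_rpow n r).ofReal_comp.continuous.mul
      (hf.wordAct l).continuous).aestronglyMeasurable
  · simp only [norm_mul, ← Finset.mul_sum]
    rw [mul_left_comm]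
    gcongr
    exact hQ f hf Z

section Chart

variable {n : ℕ} {p : Fin n} {ε : ℝ}

theorem norm_coneShift_le (hε : ε ^ 2 = 1) (Z : Spacetime n) :
    ‖coneShift p ε (toAmbient Z)‖ ≤ 2 := by
  have hR := bracketZ_pos Z
  have hT := bracketT_pos Z
  refine (norm_add_le _ _).trans ?_
  have h1 : ‖(toAmbient Z).1‖ ≤ 1 := by
    change ‖(bracketZ Z)⁻¹ • Z.1‖ ≤ 1
    rw [norm_smul, norm_inv, Real.norm_of_nonneg hR.le, inv_mul_le_iff₀ hR, mul_one]
    exact norm_fst_le_bracketZ Z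
  have h2 : bracketT Z / bracketZ Z ≤ 1 := (div_le_one hR).2 (bracketT_le_bracketZ Z)
  have h3 : ‖(ε * (toAmbient Z).2.2.2.1) • EuclideanSpace.single p (1 : ℝ)‖ ≤ 1 := by
    rw [norm_smul, norm_mul, Real.norm_eq_abs, abs_eq_one_of_sq hε, one_mul,
      PiLp.norm_single, norm_one, mul_one]
    change ‖bracketT Z / bracketZ Z‖ ≤ 1
    rwa [Real.norm_of_nonneg (by positivity)]
  linarith

/-- On the part of the cone that is used, the distance from the tip is comparable
to `⟨Z⟩ / ⟨t⟩`, and the slopes are bounded. -/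
theorem coneChart_bounds (hε : ε ^ 2 = 1) {m : EuclideanSpace ℝ (Option (Fin n))}
    (h : coneGap n ≤ coneHeight p ε (toAmbient (coneChart p ε m))) :
    0 < m (some p) ∧ coneGap n * bracketZ (coneChart p ε m) ≤ Real.cosh (m none) * m (some p) ∧
      Real.cosh (m none) * m (some p) ≤ 2 * bracketZ (coneChart p ε m) ∧
      coneGap n / 2 ≤ ‖coneNum p ε m‖⁻¹ := by
  have hg := coneGap_pos p
  have hρ := radius_pos_of_coneHeight_pos hε (hg.trans_le h)
  have hN := one_le_norm_coneNum (p := p) hε m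
  have hR := bracketZ_pos (coneChart p ε m)
  have hT := Real.cosh_pos (m none)
  have h2 := norm_coneShift_le (p := p) hε (coneChart p ε m)
  rw [coneShift_coneChart, norm_smul, norm_coneDir hε, mul_one, Real.norm_of_nonneg (by positivity),
    div_mul_eq_mul_div, div_le_iff₀ hR] at h2
  rw [coneHeight_coneChart hε, div_mul_eq_mul_div] at h
  have hNi : ‖coneNum p ε m‖⁻¹ ≤ 1 := inv_le_one_of_one_le₀ hN
  have hNi0 : 0 < ‖coneNum p ε m‖⁻¹ := by positivity
  have hx : Real.cosh (m none) * m (some p) / bracketZ (coneChart p ε m) ≤ 2 :=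
    (div_le_iff₀ hR).2 h2
  have hx0 : 0 < Real.cosh (m none) * m (some p) / bracketZ (coneChart p ε m) := by positivity
  refine ⟨hρ, ?_, h2, ?_⟩
  · rw [← le_div_iff₀ hR]
    nlinarith
  · nlinarith

theorem sq_densityJ (r : ℝ) (hn : 1 ≤ n) (Z : Spacetime n) :
    densityJ (r + ((n : ℝ) - 1) / 2) Z ^ 2 =
      (bracketZ Z ^ r) ^ 2 * bracketZ Z ^ (n - 1) * bracketT Z ^ 2 := by
  have hR := bracketZ_pos Z
  rw [densityJ, mul_pow, ← Real.rpow_mul_natCast hR.le, ← Real.rpow_mul_natCast hR.le,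
    ← Real.rpow_natCast _ (n - 1), ← Real.rpow_add hR]
  congr 2
  push_cast [hn]
  ring

theorem ofReal_norm_sq {x : ℂ} : ‖x‖ₑ ^ 2 = ENNReal.ofReal (‖x‖ ^ 2) := by
  rw [ENNReal.ofReal_pow (norm_nonneg _), ofReal_norm]

/-- The volume in conical coordinates is bounded below by a multiple of `⟨Z⟩^(n-1) ⟨t⟩²`. -/
theorem exists_eLpNorm_coneChart_le (hε : ε ^ 2 = 1) (r : ℝ) :
    ∃ C : ℝ≥0, ∀ h : Spacetime n → ℂ, Continuous h →
      (∀ Z, coneHeight p ε (toAmbient Z) < coneGap n → h Z = 0) →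
      eLpNorm (fun m => (densityJ (r + ((n : ℝ) - 1) / 2) (coneChart p ε m) : ℂ) *
        h (coneChart p ε m)) 2 ≤ C * weightedNorm r h := by
  have hg := coneGap_pos p
  set c : ℝ := (coneGap n ^ (n - 1) * (coneGap n / 2) ^ n)⁻¹ with hc
  have hc0 : 0 < c := by positivity
  refine ⟨(√c).toNNReal, fun h hh h0 => ?_⟩
  have hsq : eLpNorm (fun m => (densityJ (r + ((n : ℝ) - 1) / 2) (coneChart p ε m) : ℂ) *
        h (coneChart p ε m)) 2 ^ 2 ≤ (((√c).toNNReal : ℝ≥0∞) * weightedNorm r h) ^ 2 := by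
    rw [mul_pow, weightedNorm, eLpNorm_two_sq, eLpNorm_two_sq, lintegral_coneChart p hε]
    · rw [← lintegral_const_mul' _ _ (by simp)]
      refine lintegral_mono fun m => ?_
      by_cases hm : coneHeight p ε (toAmbient (coneChart p ε m)) < coneGap n
      · simp [h0 _ hm]
      · obtain ⟨h1, h2, -, h4⟩ := coneChart_bounds hε (not_lt.1 hm)
        have hR := bracketZ_pos (coneChart p ε m)
        have hT := Real.cosh_pos (m none)
        rw [ofReal_norm_sq, ofReal_norm_sq, ← ENNReal.ofReal_mul (by positivity)]
        have e : (((√c).toNNReal : ℝ≥0∞)) ^ 2 = ENNReal.ofReal c := by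
          change ENNReal.ofReal (√c) ^ 2 = _
          rw [← ENNReal.ofReal_pow (Real.sqrt_nonneg _), Real.sq_sqrt hc0.le]
        rw [e, ← ENNReal.ofReal_mul hc0.le]
        refine ENNReal.ofReal_le_ofReal ?_
        rw [norm_mul, norm_mul, Complex.norm_real, Complex.norm_real, mul_pow, mul_pow,
          Real.norm_eq_abs, sq_abs, Real.norm_eq_abs, sq_abs, sq_densityJ r p.pos,
          bracketT_coneChart]
        obtain ⟨k, hk⟩ : ∃ k, n = k + 1 := ⟨n - 1, (Nat.sub_add_cancel p.pos).symm⟩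
        have e2 : Real.cosh (m none) ^ (n + 1) = Real.cosh (m none) ^ 2 *
            Real.cosh (m none) ^ (n - 1) := by rw [← pow_add]; congr 1; omega
        have key : bracketZ (coneChart p ε m) ^ (n - 1) ≤
            c * ((Real.cosh (m none) * m (some p)) ^ (n - 1) * ‖coneNum p ε m‖⁻¹ ^ n) := by
          rw [hc, ← div_eq_inv_mul, le_div_iff₀ (by positivity)]
          calc _ = (coneGap n * bracketZ (coneChart p ε m)) ^ (n - 1) * (coneGap n / 2) ^ n := by
                rw [mul_pow]; ring
            _ ≤ _ := by gcongr
        calc _ = ((bracketZ (coneChart p ε m) ^ r) ^ 2 * Real.cosh (m none) ^ 2 *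
              ‖h (coneChart p ε m)‖ ^ 2) * bracketZ (coneChart p ε m) ^ (n - 1) := by ring
          _ ≤ ((bracketZ (coneChart p ε m) ^ r) ^ 2 * Real.cosh (m none) ^ 2 *
              ‖h (coneChart p ε m)‖ ^ 2) *
              (c * ((Real.cosh (m none) * m (some p)) ^ (n - 1) * ‖coneNum p ε m‖⁻¹ ^ n)) := by
            gcongr
          _ = _ := by rw [e2, mul_pow]; ring
    · exact ((contDiff_bracketZ_rpow n
        r).ofReal_comp.continuous.mul hh).measurable.enorm.pow_const 2
    · intro Z hZ
      simp [h0 Z (hZ.trans_lt hg)]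
  exact (ENNReal.pow_le_pow_left_iff two_ne_zero).1 hsq

/-- The volume in conical coordinates is bounded above by a multiple of `⟨Z⟩^(n-1) ⟨t⟩²`. The
densities of the two factors multiply to `⟨t⟩ / ⟨Z⟩` times that of the product. -/
theorem eLpNorm_indicator_le_coneChart (hε : ε ^ 2 = 1) (r₁ r₂ : ℝ) {f g : Spacetime n → ℂ}
    (hf : Continuous f) (hg : Continuous g) :
    eLpNorm ({Z : Spacetime n | 2 * coneGap n ≤ coneHeight p ε (toAmbient Z)}.indicator fun Z =>
        ((bracketZ Z ^ (r₁ + r₂ + ((n : ℝ) + 1) / 2) : ℝ) : ℂ) * (f Z * g Z)) 2 ≤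
      ENNReal.ofReal (√(2 ^ (n - 1))) * eLpNorm (fun m =>
        ((densityJ (r₁ + ((n : ℝ) - 1) / 2) (coneChart p ε m) : ℂ) *
          (coneCutoff p ε (toAmbient (coneChart p ε m)) *
          (((bracketZ (coneChart p ε m) / bracketT (coneChart p ε m) : ℝ) : ℂ) *
            f (coneChart p ε m)))) *
        ((densityJ (r₂ + ((n : ℝ) - 1) / 2) (coneChart p ε m) : ℂ) *
          (coneCutoff p ε (toAmbient (coneChart p ε m)) * g (coneChart p ε m)))) 2 := by
  have hgap := coneGap_pos p
  set A : Set (Spacetime n) := {Z | 2 * coneGap n ≤ coneHeight p ε (toAmbient Z)} with hA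
  have hAm : MeasurableSet A :=
    (isClosed_le continuous_const continuous_coneHeight_toAmbient).measurableSet
  refine (ENNReal.pow_le_pow_left_iff two_ne_zero).1 ?_
  rw [mul_pow, eLpNorm_two_sq, eLpNorm_two_sq, lintegral_coneChart p hε]
  · rw [← lintegral_const_mul' _ _ (by finiteness)]
    refine lintegral_mono fun m => ?_
    by_cases hm : coneChart p ε m ∈ A
    · have hm' : coneGap n ≤ coneHeight p ε (toAmbient (coneChart p ε m)) := by
        have : 2 * coneGap n ≤ coneHeight p ε (toAmbient (coneChart p ε m)) := hm
        linarith
      obtain ⟨h1, -, h3, -⟩ := coneChart_bounds hε hm'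
      have hN := one_le_norm_coneNum (p := p) hε m
      have hR := bracketZ_pos (coneChart p ε m)
      have hT := Real.cosh_pos (m none)
      rw [Set.indicator_of_mem hm, coneCutoff_eq_one hm, ofReal_norm_sq, ofReal_norm_sq,
        ← ENNReal.ofReal_mul (by positivity), ← ENNReal.ofReal_pow (Real.sqrt_nonneg _),
        Real.sq_sqrt (by positivity), ← ENNReal.ofReal_mul (by positivity)]
      refine ENNReal.ofReal_le_ofReal ?_
      simp only [norm_mul, Complex.norm_real, mul_pow, Real.norm_eq_abs, sq_abs,
        sq_densityJ _ p.pos, bracketT_coneChart, Complex.ofReal_one, one_mul]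
      have e2 : Real.cosh (m none) ^ (n + 1) = Real.cosh (m none) ^ 2 *
          Real.cosh (m none) ^ (n - 1) := by
        rw [← pow_add]; congr 1; have := p.pos; omega
      have key : (Real.cosh (m none) * m (some p)) ^ (n - 1) * ‖coneNum p ε m‖⁻¹ ^ n ≤
          2 ^ (n - 1) * bracketZ (coneChart p ε m) ^ (n - 1) := by
        rw [← mul_pow]
        refine (mul_le_of_le_one_right (by positivity)
          (pow_le_one₀ (by positivity) (inv_le_one_of_one_le₀ hN))).trans ?_
        gcongr
      have e3 : (bracketZ (coneChart p ε m) ^ (r₁ + r₂ + ((n : ℝ) + 1) / 2)) ^ 2 =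
          (bracketZ (coneChart p ε m) ^ r₁) ^ 2 * (bracketZ (coneChart p ε m) ^ r₂) ^ 2 *
            bracketZ (coneChart p ε m) ^ (n + 1) := by
        rw [← Real.rpow_mul_natCast hR.le, ← Real.rpow_mul_natCast hR.le,
          ← Real.rpow_mul_natCast hR.le, ← Real.rpow_natCast _ (n + 1), ← Real.rpow_add hR,
          ← Real.rpow_add hR]
        congr 1
        push_cast
        ring
      have e4 : bracketZ (coneChart p ε m) ^ (n + 1) = bracketZ (coneChart p ε m) ^ (n - 1) *
          bracketZ (coneChart p ε m) ^ 2 := by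
        rw [← pow_add]; congr 1; have := p.pos; omega
      rw [e3, e2, div_pow]
      calc _ = ((bracketZ (coneChart p ε m) ^ r₁) ^ 2 * (bracketZ (coneChart p ε m) ^ r₂) ^ 2 *
            bracketZ (coneChart p ε m) ^ (n + 1) * Real.cosh (m none) ^ 2 *
            (‖f (coneChart p ε m)‖ ^ 2 * ‖g (coneChart p ε m)‖ ^ 2)) *
            ((Real.cosh (m none) * m (some p)) ^ (n - 1) * ‖coneNum p ε m‖⁻¹ ^ n) := by
            rw [mul_pow (Real.cosh (m none))]; ring
        _ ≤ ((bracketZ (coneChart p ε m) ^ r₁) ^ 2 * (bracketZ (coneChart p ε m) ^ r₂) ^ 2 *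
            bracketZ (coneChart p ε m) ^ (n + 1) * Real.cosh (m none) ^ 2 *
            (‖f (coneChart p ε m)‖ ^ 2 * ‖g (coneChart p ε m)‖ ^ 2)) *
            (2 ^ (n - 1) * bracketZ (coneChart p ε m) ^ (n - 1)) := by gcongr
        _ = _ := by rw [e4]; field_simp
    · simp [Set.indicator_of_notMem hm]
  · refine Measurable.pow_const (Measurable.enorm (Measurable.indicator ?_ hAm)) 2
    exact ((contDiff_bracketZ_rpow n _).ofReal_comp.continuous.mul (hf.mul hg)).measurable
  · intro Z hZ
    have : Z ∉ A := fun h => by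
      have : 2 * coneGap n ≤ coneHeight p ε (toAmbient Z) := h
      linarith
    simp [Set.indicator_of_notMem this]

theorem hasCompactSupport_coneChart (hε : ε ^ 2 = 1) {h : Spacetime n → ℂ}
    (hh : HasCompactSupport h) (h0 : ∀ Z, coneHeight p ε (toAmbient Z) < coneGap n → h Z = 0)
    (a : ℝ) : HasCompactSupport fun m => (densityJ a (coneChart p ε m) : ℂ) *
      h (coneChart p ε m) := by
  have hg := coneGap_pos p
  obtain ⟨B, hB⟩ := hh.isCompact.exists_bound_of_continuousOn
    (f := fun Z : Spacetime n => bracketZ Z) (contDiff_bracketZ n).continuous.continuousOn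
  set D : ℝ := 2 * B + 2 / coneGap n with hD
  refine HasCompactSupport.of_support_subset_isCompact
    (isCompact_closedBall 0 (√(∑ _i : Option (Fin n), D ^ 2))) fun m hm => ?_
  have hm0 : h (coneChart p ε m) ≠ 0 := right_ne_zero_of_mul hm
  have hm1 : coneGap n ≤ coneHeight p ε (toAmbient (coneChart p ε m)) := by
    by_contra! H
    exact hm0 (h0 _ H)
  obtain ⟨h1, h2, h3, h4⟩ := coneChart_bounds hε hm1
  have hR := bracketZ_pos (coneChart p ε m)
  have hRB : bracketZ (coneChart p ε m) ≤ B := by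
    have := hB _ (subset_tsupport _ hm0)
    rwa [Real.norm_of_nonneg hR.le] at this
  have hN := one_le_norm_coneNum (p := p) hε m
  have hNB : ‖coneNum p ε m‖ ≤ 2 / coneGap n := by
    rw [← inv_div]
    exact (le_inv_comm₀ (by positivity) (by positivity)).1 h4
  have hg2 : 0 < 2 / coneGap n := by positivity
  have hT := Real.one_le_cosh (m none)
  rw [mem_closedBall_zero_iff, EuclideanSpace.norm_eq]
  refine Real.sqrt_le_sqrt (Finset.sum_le_sum fun i _ => ?_)
  refine pow_le_pow_left₀ (norm_nonneg _) ?_ 2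
  rw [Real.norm_eq_abs]
  match i with
  | none =>
    have e1 : |m none| ≤ |Real.sinh (m none)| := by
      rw [Real.abs_sinh]
      exact Real.self_le_sinh_iff.2 (abs_nonneg _)
    have e2 := abs_snd_le_bracketT (coneChart p ε m)
    rw [coneChart_snd] at e2
    have e3 := bracketT_le_bracketZ (coneChart p ε m)
    linarith
  | some j =>
    by_cases hj : j = p
    · subst hj
      rw [abs_of_pos h1]
      nlinarith
    · have e1 := PiLp.norm_apply_le (coneNum p ε m) j
      rw [coneNum_apply_ne m hj, Real.norm_eq_abs] at e1
      linarith

end Chart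

/-- In conical coordinates, the derivatives of order at most `s` of a localized combination of
generators are bounded. -/
theorem exists_eLpNorm_coordDeriv_coneChart_le {n : ℕ} {p : Fin n} {ε : ℝ} (hε : ε ^ 2 = 1) (r : ℝ)
    {m₀ s k : ℕ} (hs : m₀ + s ≤ k) {Q : (Spacetime n → ℂ) → Spacetime n → ℂ} (hQ : ActComb m₀ Q)
    (hQ0 : ∀ f, ContDiff ℝ ∞ f → ∀ Z, coneHeight p ε (toAmbient Z) < coneGap n → Q f Z = 0) :
    ∃ C : ℝ≥0, ∀ f, ContDiff ℝ ∞ f → ∀ l : List (Option (Fin n)), coordOrd l ≤ s →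
      eLpNorm (coordDeriv l fun m => (densityJ (r + ((n : ℝ) - 1) / 2) (coneChart p ε m) : ℂ) *
        Q f (coneChart p ε m)) 2 ≤ C * wordNorm r k f := by
  choose Q' h₁ h₂ h₃ using exists_coordDeriv_coneChart hε (r + ((n : ℝ) - 1) / 2) hQ hQ0
  choose C₁ hC₁ using fun l => (h₁ l).exists_weightedNorm_le r
  obtain ⟨C₂, hC₂⟩ := exists_eLpNorm_coneChart_le (p := p) hε r
  refine ⟨C₂ * ∑ l ∈ (finite_coordWords n s).toFinset, C₁ l, fun f hf l hl => ?_⟩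
  rw [funext (h₃ l f hf)]
  refine (hC₂ _ ((h₁ l).contDiff hf).continuous (h₂ l f hf)).trans ?_
  push_cast
  rw [mul_assoc]
  gcongr
  refine (hC₁ l f hf).trans ?_
  gcongr
  · exact_mod_cast Finset.single_le_sum (f := C₁) (fun _ _ => zero_le)
      (by simpa using hl : l ∈ (finite_coordWords n s).toFinset)
  · exact wordNorm_mono r (by omega) f

/-- The product estimate on one cone. The factor `⟨Z⟩ / ⟨t⟩` which the change of variables
produces is absorbed into the first factor, at the cost of one order. -/
theorem exists_eLpNorm_indicator_cone_le {n : ℕ} (hn : 1 ≤ n) {k : ℕ} (hk : 4 ≤ k)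
    (hkn : n + 5 ≤ 2 * k) {p : Fin n} {ε : ℝ} (hε : ε ^ 2 = 1) (r₁ r₂ : ℝ)
    {l₁ l₂ : List (FlatGen n)} (h₁ : wordOrd l₁ + 1 ≤ k) (h₁₂ : wordOrd l₁ + wordOrd l₂ ≤ k) :
    ∃ C : ℝ≥0, ∀ f g : Spacetime n → ℂ, ContDiff ℝ ∞ f → HasCompactSupport f → ContDiff ℝ ∞ g →
      HasCompactSupport g →
      eLpNorm ({Z : Spacetime n | 2 * coneGap n ≤ coneHeight p ε (toAmbient Z)}.indicator fun Z =>
        ((bracketZ Z ^ (r₁ + r₂ + ((n : ℝ) + 1) / 2) : ℝ) : ℂ) *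
          (wordAct l₁ f Z * wordAct l₂ g Z)) 2 ≤ C * wordNorm r₁ k f * wordNorm r₂ k g := by
  let Q : List (FlatGen n) → (Spacetime n → ℂ) → Spacetime n → ℂ := fun l f Z =>
    (coneCutoff p ε (toAmbient Z) : ℂ) * wordAct l f Z
  have hQ : ∀ l, ActComb (wordOrd l) (Q l) := fun l =>
    .base _ l smoothX_coneCutoff le_rfl fun _ _ _ => rfl
  have hQ0 : ∀ l f, ContDiff ℝ ∞ f → ∀ Z, coneHeight p ε (toAmbient Z) < coneGap n →
      Q l f Z = 0 := fun l f _ Z hZ => by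
    simp [Q, coneCutoff_eq_zero _ hZ]
  have hw : wordOrd (.weight :: l₁) = wordOrd l₁ + 1 := by
    rw [wordOrd_cons, add_comm]
    rfl
  obtain ⟨C₁, hC₁⟩ := exists_eLpNorm_coordDeriv_coneChart_le hε r₁
    (s := k - (wordOrd l₁ + 1)) (k := k) (by omega) (hQ (.weight :: l₁)) (hQ0 _)
  obtain ⟨C₂, hC₂⟩ := exists_eLpNorm_coordDeriv_coneChart_le hε r₂
    (s := k - wordOrd l₂) (k := k) (by omega) (hQ l₂) (hQ0 _)
  -- In total at least `k - 1 > (n + 2) / 2` derivatives are left for the two factors.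
  obtain ⟨K, hK⟩ := exists_eLpNorm_mul_le_coordDeriv hn (s₁ := k - (wordOrd l₁ + 1))
    (s₂ := k - wordOrd l₂) (by omega) (by omega)
  refine ⟨Real.toNNReal (√(2 ^ (n - 1))) * (K * C₁ * C₂), fun f g hf hf' hg hg' => ?_⟩
  refine (eLpNorm_indicator_le_coneChart hε r₁ r₂ (hf.wordAct l₁).continuous
    (hg.wordAct l₂).continuous).trans ?_
  have hsm : ∀ l f r, ContDiff ℝ ∞ f → ContDiff ℝ ∞ fun m =>
      (densityJ (r + ((n : ℝ) - 1) / 2) (coneChart p ε m) : ℂ) * Q l f (coneChart p ε m) :=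
    fun l f r hf => ((contDiff_densityJ _).ofReal_comp.mul ((hQ l).contDiff hf)).comp
      (contDiff_coneChart hε)
  have hcs : ∀ l f r, ContDiff ℝ ∞ f → HasCompactSupport f → HasCompactSupport fun m =>
      (densityJ (r + ((n : ℝ) - 1) / 2) (coneChart p ε m) : ℂ) * Q l f (coneChart p ε m) :=
    fun l f r hf hf' => hasCompactSupport_coneChart hε ((hf'.wordAct l).mul_left) (hQ0 l f hf) _
  have := hK _ _ (hsm (.weight :: l₁) f r₁ hf) (hcs (.weight :: l₁) f r₁ hf hf')
    (hsm l₂ g r₂ hg) (hcs l₂ g r₂ hg hg') _ _ (hC₁ f hf) (hC₂ g hg)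
  simp only [Q, wordAct_cons, FlatGen.weight_act] at this
  calc _ ≤ ENNReal.ofReal (√(2 ^ (n - 1))) *
        (K * (C₁ * wordNorm r₁ k f) * (C₂ * wordNorm r₂ k g)) := by
        gcongr
    _ = _ := by
        rw [ENNReal.ofReal]
        push_cast
        ring

/-- The signs of the two cones around an axis. -/
def axisSign (b : Bool) : ℝ := if b then 1 else -1

theorem axisSign_sq (b : Bool) : axisSign b ^ 2 = 1 := by
  cases b <;> norm_num [axisSign]

/-- The part of spacetime where a cone is used. -/
def coneRegion {n : ℕ} (q : Fin n × Bool) : Set (Spacetime n) :=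
  {Z | 2 * coneGap n ≤ coneHeight q.1 (axisSign q.2) (toAmbient Z)}

theorem measurableSet_coneRegion {n : ℕ} (q : Fin n × Bool) : MeasurableSet (coneRegion q) :=
  (isClosed_le continuous_const continuous_coneHeight_toAmbient).measurableSet

theorem exists_mem_coneRegion {n : ℕ} (hn : 1 ≤ n) (Z : Spacetime n) : ∃ q, Z ∈ coneRegion q := by
  obtain ⟨p, ε, rfl | rfl, hZ⟩ := exists_coneHeight_ge hn Z
  · exact ⟨(p, true), by simpa [coneRegion, axisSign] using hZ⟩
  · exact ⟨(p, false), by simpa [coneRegion, axisSign] using hZ⟩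

theorem eLpNorm_le_sum_indicator_coneRegion {n : ℕ} (hn : 1 ≤ n) {H : Spacetime n → ℂ}
    (hH : Continuous H) : eLpNorm H 2 ≤ ∑ q, eLpNorm ((coneRegion q).indicator H) 2 := by
  have h1 : eLpNorm H 2 ≤ ENNReal.ofReal 1 * ∑ q, eLpNorm ((coneRegion q).indicator H) 2 := by
    refine eLpNorm_le_sum_of_norm_le _ zero_le_one (fun q _ =>
      hH.aestronglyMeasurable.indicator (measurableSet_coneRegion q))
      (Filter.Eventually.of_forall fun Z => ?_)
    obtain ⟨q, hq⟩ := exists_mem_coneRegion hn Z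
    rw [one_mul]
    refine le_trans ?_ (Finset.single_le_sum (f := fun q => ‖(coneRegion q).indicator H Z‖)
      (fun _ _ => norm_nonneg _) (Finset.mem_univ q))
    rw [Set.indicator_of_mem hq]
  rwa [ENNReal.ofReal_one, one_mul] at h1

theorem exists_eLpNorm_indicator_coneRegion_le {n : ℕ} (hn : 1 ≤ n) {k : ℕ} (hk : 4 ≤ k)
    (hkn : n + 5 ≤ 2 * k) (r₁ r₂ : ℝ) {l₁ l₂ : List (FlatGen n)}
    (h₁₂ : wordOrd l₁ + wordOrd l₂ ≤ k) (q : Fin n × Bool) :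
    ∃ C : ℝ≥0, ∀ f g : Spacetime n → ℂ, ContDiff ℝ ∞ f → HasCompactSupport f → ContDiff ℝ ∞ g →
      HasCompactSupport g → eLpNorm ((coneRegion q).indicator fun Z =>
        ((bracketZ Z ^ (r₁ + r₂ + ((n : ℝ) + 1) / 2) : ℝ) : ℂ) *
          (wordAct l₁ f Z * wordAct l₂ g Z)) 2 ≤ C * wordNorm r₁ k f * wordNorm r₂ k g := by
  -- The weight `⟨Z⟩ / ⟨t⟩` is put on a factor with at least one derivative left.
  by_cases h₁ : wordOrd l₁ + 1 ≤ k
  · exact exists_eLpNorm_indicator_cone_le hn hk hkn (axisSign_sq q.2) r₁ r₂ h₁ h₁₂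
  · obtain ⟨C, hC⟩ := exists_eLpNorm_indicator_cone_le hn hk hkn (p := q.1) (axisSign_sq q.2) r₂ r₁
      (l₁ := l₂) (l₂ := l₁) (by omega) (by omega)
    refine ⟨C, fun f g hf hf' hg hg' => ?_⟩
    have := hC g f hg hg' hf hf'
    simp only [mul_comm (wordAct l₂ g _), add_comm r₂ r₁, mul_right_comm (C : ℝ≥0∞)] at this
    exact this

/-- The product estimate for compactly supported functions. -/
theorem exists_weightedNorm_mul_le {n : ℕ} (hn : 1 ≤ n) {k : ℕ} (hk : 4 ≤ k)
    (hkn : n + 5 ≤ 2 * k) (r₁ r₂ : ℝ) (l₁ l₂ : List (FlatGen n))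
    (h₁₂ : wordOrd l₁ + wordOrd l₂ ≤ k) :
    ∃ C : ℝ≥0, ∀ f g : Spacetime n → ℂ, ContDiff ℝ ∞ f → HasCompactSupport f → ContDiff ℝ ∞ g →
      HasCompactSupport g →
      weightedNorm (r₁ + r₂ + ((n : ℝ) + 1) / 2) (fun Z => wordAct l₁ f Z * wordAct l₂ g Z) ≤
        C * wordNorm r₁ k f * wordNorm r₂ k g := by
  choose C hC using exists_eLpNorm_indicator_coneRegion_le hn hk hkn r₁ r₂ h₁₂
  refine ⟨∑ q, C q, fun f g hf hf' hg hg' => ?_⟩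
  refine (eLpNorm_le_sum_indicator_coneRegion hn
    ((contDiff_bracketZ_rpow n _).ofReal_comp.continuous.mul
    ((hf.wordAct l₁).continuous.mul (hg.wordAct l₂).continuous))).trans ?_
  refine (Finset.sum_le_sum fun q _ => hC q f g hf hf' hg hg').trans_eq ?_
  rw [← Finset.sum_mul, ← Finset.sum_mul]
  push_cast
  rfl

/-! ### Mollification -/

section Mollify

variable {E : Type*} [NormedAddCommGroup E] [NormedSpace ℝ E] [FiniteDimensional ℝ E]
  [MeasurableSpace E]

/-- A sequence of bump functions concentrating at the origin. -/
def bumpSeq (E : Type*) [NormedAddCommGroup E] [NormedSpace ℝ E] (m : ℕ) :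
    ContDiffBump (0 : E) where
  rIn := 1 / (2 * ((m : ℝ) + 1))
  rOut := 1 / ((m : ℝ) + 1)
  rIn_pos := by positivity
  rIn_lt_rOut := by
    apply one_div_lt_one_div_of_lt <;> nlinarith [(Nat.cast_nonneg m : (0 : ℝ) ≤ m)]

/-- The convolution of `w` with the normalized bump function of index `m`. -/
def mollify (μ : Measure E) (m : ℕ) (w : E → ℂ) : E → ℂ := fun x => ∫ t, (bumpSeq E m).normed μ t • w (x - t) ∂μ

theorem mollify_eq_convolution (μ : Measure E) (m : ℕ) (w : E → ℂ) :
    mollify μ m w = convolution ((bumpSeq E m).normed μ) w (ContinuousLinearMap.lsmul ℝ ℝ) μ := rfl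

variable [BorelSpace E] (μ : Measure E) [μ.IsAddHaarMeasure]

theorem mollify_congr (m : ℕ) {w w' : E → ℂ} (h : w =ᵐ[μ] w') :
    mollify μ m w = mollify μ m w' := by
  rw [mollify_eq_convolution, mollify_eq_convolution]
  exact convolution_congr _ (ae_eq_refl _) h

theorem norm_lt_of_bumpSeq_ne_zero {m : ℕ} {t : E} (ht : (bumpSeq E m).normed μ t ≠ 0) :
    ‖t‖ < 1 / ((m : ℝ) + 1) := by
  have h : t ∈ Function.support ((bumpSeq E m).normed μ) := ht
  rw [ContDiffBump.support_normed_eq, mem_ball_zero_iff] at h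
  exact h

theorem lintegral_bumpSeq (m : ℕ) : ∫⁻ t, ENNReal.ofReal ((bumpSeq E m).normed μ t) ∂μ = 1 := by
  rw [← ofReal_integral_eq_lintegral_ofReal (bumpSeq E m).integrable_normed
    (Filter.Eventually.of_forall fun t => (bumpSeq E m).nonneg_normed t),
    (bumpSeq E m).integral_normed, ENNReal.ofReal_one]

/-- Averaging does not increase the `L²` norm. -/
theorem eLpNorm_mollify_le (m : ℕ) {w : E → ℂ} (hw : AEStronglyMeasurable w μ) :
    eLpNorm (mollify μ m w) 2 μ ≤ eLpNorm w 2 μ := by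
  rw [mollify_congr μ m hw.ae_eq_mk, eLpNorm_congr_ae hw.ae_eq_mk]
  set h := hw.mk w
  have hh : Measurable h := hw.stronglyMeasurable_mk.measurable
  set φ : E → ℝ≥0∞ := fun t => ENNReal.ofReal ((bumpSeq E m).normed μ t) with hφ
  have hφm : Measurable φ := (bumpSeq E m).continuous_normed.measurable.ennreal_ofReal
  have hφ1 : ∫⁻ t, φ t ∂μ = 1 := lintegral_bumpSeq μ m
  have hroot : ∀ t, φ t ^ (1 / 2 : ℝ) * φ t ^ (1 / 2 : ℝ) = φ t := fun t => by
    rw [← ENNReal.rpow_add_of_nonneg _ _ (by norm_num) (by norm_num)]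
    norm_num
  have hroot2 : ∀ t, (φ t ^ (1 / 2 : ℝ)) ^ 2 = φ t := fun t => by rw [sq, hroot]
  refine (ENNReal.pow_le_pow_left_iff two_ne_zero).1 ?_
  rw [eLpNorm_two_sq, eLpNorm_two_sq]
  have hpt : ∀ x, ‖mollify μ m h x‖ₑ ^ 2 ≤ ∫⁻ t, φ t * ‖h (x - t)‖ₑ ^ 2 ∂μ := by
    intro x
    have h1 : ‖mollify μ m h x‖ₑ ≤ ∫⁻ t, φ t * ‖h (x - t)‖ₑ ∂μ := by
      refine (enorm_integral_le_lintegral_enorm _).trans_eq (lintegral_congr fun t => ?_)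
      rw [enorm_smul, hφ, Real.enorm_eq_ofReal ((bumpSeq E m).nonneg_normed t)]
    have hx : Measurable fun t => ‖h (x - t)‖ₑ :=
      (hh.comp (measurable_const.sub measurable_id)).enorm
    calc ‖mollify μ m h x‖ₑ ^ 2 ≤ (∫⁻ t, φ t * ‖h (x - t)‖ₑ ∂μ) ^ 2 := by gcongr
      _ = (∫⁻ t, φ t ^ (1 / 2 : ℝ) * (φ t ^ (1 / 2 : ℝ) * ‖h (x - t)‖ₑ) ∂μ) ^ 2 := by
          simp only [← mul_assoc, hroot]
      _ ≤ (∫⁻ t, (φ t ^ (1 / 2 : ℝ)) ^ 2 ∂μ) *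
            ∫⁻ t, (φ t ^ (1 / 2 : ℝ) * ‖h (x - t)‖ₑ) ^ 2 ∂μ :=
          lintegral_mul_sq_le μ (hφm.pow_const _).aemeasurable
            ((hφm.pow_const _).mul hx).aemeasurable
      _ = ∫⁻ t, φ t * ‖h (x - t)‖ₑ ^ 2 ∂μ := by
          simp only [mul_pow, hroot2, hφ1, one_mul]
  calc ∫⁻ x, ‖mollify μ m h x‖ₑ ^ 2 ∂μ ≤ ∫⁻ x, ∫⁻ t, φ t * ‖h (x - t)‖ₑ ^ 2 ∂μ ∂μ :=
        lintegral_mono hpt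
    _ = ∫⁻ t, ∫⁻ x, φ t * ‖h (x - t)‖ₑ ^ 2 ∂μ ∂μ := by
        refine lintegral_lintegral_swap (Measurable.aemeasurable ?_)
        exact (hφm.comp measurable_snd).mul
          ((hh.comp (measurable_fst.sub measurable_snd)).enorm.pow_const 2)
    _ = ∫⁻ t, φ t * ∫⁻ x, ‖h x‖ₑ ^ 2 ∂μ ∂μ := by
        refine lintegral_congr fun t => ?_
        rw [lintegral_const_mul' _ _ ENNReal.ofReal_ne_top,
          lintegral_sub_right_eq_self (fun x => ‖h x‖ₑ ^ 2) t]
    _ = ∫⁻ x, ‖h x‖ₑ ^ 2 ∂μ := by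
        rw [lintegral_mul_const _ hφm, hφ1, one_mul]

theorem mollify_sub_apply (m : ℕ) {w w' : E → ℂ} (hw : LocallyIntegrable w μ)
    (hw' : LocallyIntegrable w' μ) (x : E) :
    mollify μ m (w - w') x = mollify μ m w x - mollify μ m w' x := by
  have key : ∀ v : E → ℂ, LocallyIntegrable v μ →
      Integrable (fun t => (bumpSeq E m).normed μ t • v (x - t)) μ := fun v hv =>
    (bumpSeq E m).hasCompactSupport_normed.convolutionExists_left
      (ContinuousLinearMap.lsmul ℝ ℝ) (bumpSeq E m).continuous_normed hv x
  unfold mollify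
  rw [← integral_sub (key w hw) (key w' hw')]
  refine integral_congr_ae (Filter.Eventually.of_forall fun t => ?_)
  simp only [Pi.sub_apply, smul_sub]

/-- Mollifications converge locally in `L²`. -/
theorem tendsto_eLpNorm_mollify_sub {w : E → ℂ}
    (hw : ∀ K : Set E, IsCompact K → MemLp w 2 (μ.restrict K)) {K : Set E} (hK : IsCompact K) :
    Filter.Tendsto (fun m => eLpNorm (mollify μ m w - w) 2 (μ.restrict K)) Filter.atTop
      (nhds 0) := by
  -- On `K` the mollifications only see the values in a compact neighbourhood `K'` of `K`.
  set K' := Metric.cthickening 1 K with hK'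
  have hK'c : IsCompact K' := hK.cthickening
  set h : E → ℂ := K'.indicator w with hh
  have hmem : MemLp h 2 μ := (memLp_indicator_iff_restrict hK'c.measurableSet).2 (hw K' hK'c)
  have hloc : ∀ m, ∀ x ∈ K, mollify μ m w x - w x = mollify μ m h x - h x := by
    intro m x hx
    have hxK : x ∈ K' := Metric.self_subset_cthickening K hx
    have e : mollify μ m w x = mollify μ m h x := by
      refine integral_congr_ae (Filter.Eventually.of_forall fun t => ?_)
      by_cases ht : (bumpSeq E m).normed μ t = 0
      · simp [ht]
      · have h1 : ‖t‖ < 1 := (norm_lt_of_bumpSeq_ne_zero μ ht).trans_le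
          ((div_le_one (by positivity)).2 (by linarith [(Nat.cast_nonneg m : (0 : ℝ) ≤ m)]))
        have h2 : x - t ∈ K' := Metric.mem_cthickening_of_dist_le (x - t) x 1 K hx (by
          rw [dist_eq_norm, sub_sub_cancel_left, norm_neg]
          exact h1.le)
        simp only [hh, Set.indicator_of_mem h2]
    rw [e, hh, Set.indicator_of_mem hxK]
  have hle : ∀ m, eLpNorm (mollify μ m w - w) 2 (μ.restrict K) =
      eLpNorm (mollify μ m h - h) 2 (μ.restrict K) := fun m =>
    eLpNorm_congr_ae ((ae_restrict_iff' hK.measurableSet).2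
      (Filter.Eventually.of_forall fun x hx => hloc m x hx))
  simp only [hle]
  rw [ENNReal.tendsto_nhds_zero]
  intro ε hε
  have hε3 : ε / 3 ≠ 0 := (ENNReal.div_pos hε.ne' (by simp)).ne'
  obtain ⟨g, hgc, hgε, hgcont, hgm⟩ := hmem.exists_hasCompactSupport_eLpNorm_sub_le
    (by simp) hε3
  have hunif := hgc.uniformContinuous_of_continuous hgcont
  -- The continuous approximation converges uniformly.
  obtain ⟨δ, hδ, hδε⟩ : ∃ δ : ℝ, 0 < δ ∧
      (μ.restrict K) Set.univ ^ (2 : ℝ≥0∞).toReal⁻¹ * ENNReal.ofReal δ ≤ ε / 3 := by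
    have hfin : (μ.restrict K) Set.univ ^ (2 : ℝ≥0∞).toReal⁻¹ ≠ ⊤ := by
      rw [Measure.restrict_apply_univ]
      exact ENNReal.rpow_ne_top_of_nonneg (by positivity) hK.measure_lt_top.ne
    have h1 : Filter.Tendsto (fun δ : ℝ => (μ.restrict K) Set.univ ^ (2 : ℝ≥0∞).toReal⁻¹ *
        ENNReal.ofReal δ) (nhdsWithin 0 (Set.Ioi 0)) (nhds 0) := by
      have h2 : Filter.Tendsto (fun δ : ℝ => ENNReal.ofReal δ) (nhdsWithin 0 (Set.Ioi 0))
          (nhds 0) := by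
        have := (ENNReal.continuous_ofReal.tendsto 0).mono_left
          (nhdsWithin_le_nhds (s := Set.Ioi (0 : ℝ)))
        rwa [ENNReal.ofReal_zero] at this
      simpa using ENNReal.Tendsto.const_mul h2 (Or.inr hfin)
    obtain ⟨δ, hδ, hδ'⟩ := ((ENNReal.tendsto_nhds_zero.1 h1 (ε / 3)
      (pos_iff_ne_zero.2 hε3)).and self_mem_nhdsWithin).exists
    exact ⟨δ, hδ', hδ⟩
  obtain ⟨η, hη, hηδ⟩ := Metric.uniformContinuous_iff.1 hunif δ hδ
  have hev : ∀ᶠ m : ℕ in Filter.atTop, 1 / ((m : ℝ) + 1) < η :=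
    tendsto_one_div_add_atTop_nhds_zero_nat.eventually_lt_const hη
  filter_upwards [hev] with m hm
  have hl := hmem.locallyIntegrable (by norm_num : (1 : ℝ≥0∞) ≤ 2)
  have hgl := hgcont.locallyIntegrable (μ := μ)
  have hdecomp : mollify μ m h - h = (mollify μ m (h - g) + (mollify μ m g - g)) + (g - h) := by
    funext x
    simp only [Pi.sub_apply, Pi.add_apply, mollify_sub_apply μ m hl hgl]
    ring
  have hmg : AEStronglyMeasurable (mollify μ m g) μ :=
    ((bumpSeq E m).hasCompactSupport_normed.continuous_convolution_left
      (ContinuousLinearMap.lsmul ℝ ℝ) (bumpSeq E m).continuous_normed hgl).aestronglyMeasurable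
  have hmhg : AEStronglyMeasurable (mollify μ m (h - g)) μ :=
    ((bumpSeq E m).hasCompactSupport_normed.continuous_convolution_left
      (ContinuousLinearMap.lsmul ℝ ℝ) (bumpSeq E m).continuous_normed
      (hl.sub hgl)).aestronglyMeasurable
  have b1 : eLpNorm (mollify μ m (h - g)) 2 (μ.restrict K) ≤ ε / 3 :=
    (eLpNorm_mono_measure _ Measure.restrict_le_self).trans
      ((eLpNorm_mollify_le μ m (hmem.1.sub hgm.1)).trans hgε)
  have b2 : eLpNorm (mollify μ m g - g) 2 (μ.restrict K) ≤ ε / 3 := by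
    refine (eLpNorm_le_of_ae_bound (Filter.Eventually.of_forall fun x => ?_)).trans hδε
    rw [Pi.sub_apply, ← dist_eq_norm]
    refine (bumpSeq E m).dist_normed_convolution_le hgcont.aestronglyMeasurable fun y hy => ?_
    exact (hηδ (lt_trans hy hm)).le
  have b3 : eLpNorm (g - h) 2 (μ.restrict K) ≤ ε / 3 := by
    rw [eLpNorm_sub_comm]
    exact (eLpNorm_mono_measure _ Measure.restrict_le_self).trans hgε
  rw [hdecomp]
  calc _ ≤ eLpNorm (mollify μ m (h - g)) 2 (μ.restrict K) +
        eLpNorm (mollify μ m g - g) 2 (μ.restrict K) + eLpNorm (g - h) 2 (μ.restrict K) := by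
        refine (eLpNorm_add_le ?_ ?_ (by norm_num)).trans ?_
        · exact (hmhg.add (hmg.sub hgm.1)).restrict
        · exact (hgm.1.sub hmem.1).restrict
        · gcongr
          exact eLpNorm_add_le hmhg.restrict (hmg.sub hgm.1).restrict (by norm_num)
    _ ≤ ε / 3 + ε / 3 + ε / 3 := by gcongr
    _ = ε := ENNReal.add_thirds ε

end Mollify

/-! ### Functions as distributions -/

theorem integrable_mul_testFn {n : ℕ} {u : Spacetime n → ℂ} (hu : LocallyIntegrable u)
    (φ : TestFn n) : Integrable fun Z => u Z * φ Z :=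
  hu.integrable_smul_right_of_hasCompactSupport φ.contDiff.continuous φ.hasCompactSupport

/-- The distribution given by a locally integrable function. -/
def distOf {n : ℕ} (u : Spacetime n → ℂ) (hu : LocallyIntegrable u) : Distr n where
  toFun φ := ∫ Z, u Z * φ Z
  map_add' φ ψ := by
    rw [← integral_add (integrable_mul_testFn hu φ) (integrable_mul_testFn hu ψ)]
    refine integral_congr_ae (Filter.Eventually.of_forall fun Z => ?_)
    exact mul_add _ _ _
  map_smul' c φ := by
    rw [RingHom.id_apply, smul_eq_mul, ← integral_const_mul]
    refine integral_congr_ae (Filter.Eventually.of_forall fun Z => ?_)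
    exact mul_left_comm _ _ _

theorem represents_distOf {n : ℕ} {u : Spacetime n → ℂ} (hu : LocallyIntegrable u) :
    Represents u (distOf u hu) := ⟨hu, fun _ => rfl⟩

instance (n : ℕ) : (volume : Measure (Spacetime n)).IsAddHaarMeasure := by
  rw [Measure.volume_eq_prod]
  infer_instance

namespace Represents

variable {n : ℕ} {u v : Spacetime n → ℂ} {S T : Distr n}

theorem unique_distr (hS : Represents u S) (hT : Represents u T) : S = T :=
  LinearMap.ext fun φ => by rw [hS.2, hT.2]

theorem congr_fun (h : Represents u T) (e : ∀ Z, v Z = u Z) : Represents v T := by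
  rwa [funext e]

/-- Up to null sets, a function is determined by its distribution. -/
theorem ae_eq (hu : Represents u T) (hv : Represents v T) : u =ᵐ[volume] v := by
  refine ae_eq_of_integral_contDiff_smul_eq hu.1 hv.1 fun g hg hg' => ?_
  let φ : TestFn n :=
    { toFun := fun Z => (g Z : ℂ)
      contDiff' := hg.ofReal_comp
      hasCompactSupport' := hg'.comp_left (g := fun x : ℝ => (x : ℂ)) Complex.ofReal_zero
      tsupport_subset' := fun _ _ => trivial }
  have h1 := hu.2 φ
  rw [hv.2 φ] at h1
  have e : ∀ w : Spacetime n → ℂ, ∫ Z, g Z • w Z = ∫ Z, w Z * φ Z := fun w =>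
    integral_congr_ae (Filter.Eventually.of_forall fun Z => by
      change g Z • w Z = w Z * (g Z : ℂ)
      rw [Complex.real_smul, mul_comm])
  rw [e, e, h1]

theorem add (hu : Represents u S) (hv : Represents v T) :
    Represents (fun Z => u Z + v Z) (S + T) := by
  refine ⟨hu.1.add hv.1, fun φ => ?_⟩
  rw [LinearMap.add_apply, hu.2, hv.2,
    ← integral_add (integrable_mul_testFn hu.1 φ) (integrable_mul_testFn hv.1 φ)]
  exact integral_congr_ae (Filter.Eventually.of_forall fun Z => (add_mul _ _ _).symm)

theorem const_smul (hu : Represents u T) (c : ℂ) : Represents (fun Z => c * u Z) (c • T) := by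
  refine ⟨hu.1.smul c, fun φ => ?_⟩
  rw [LinearMap.smul_apply, hu.2, smul_eq_mul, ← integral_const_mul]
  exact integral_congr_ae (Filter.Eventually.of_forall fun Z => (mul_assoc _ _ _).symm)

theorem sub (hu : Represents u S) (hv : Represents v T) :
    Represents (fun Z => u Z - v Z) (S - T) := by
  have := hu.add (hv.const_smul (-1))
  simpa [sub_eq_add_neg] using this

theorem sum {ι : Type*} (s : Finset ι) {u : ι → Spacetime n → ℂ} {T : ι → Distr n}
    (h : ∀ i ∈ s, Represents (u i) (T i)) :
    Represents (fun Z => ∑ i ∈ s, u i Z) (∑ i ∈ s, T i) := by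
  classical
  induction s using Finset.induction_on with
  | empty => exact ⟨by simpa using locallyIntegrable_zero, fun φ => by simp⟩
  | insert i s his ih =>
    simp only [Finset.sum_insert his]
    exact (h i (by simp)).add (ih fun j hj => h j (by simp [hj]))

theorem mulOp (hu : Represents u T) {a : Spacetime n → ℂ} (ha : ContDiff ℝ ∞ a) :
    Represents (fun Z => a Z * u Z) (_root_.mulOp a ha T) := by
  refine ⟨?_, fun φ => ?_⟩
  · rw [locallyIntegrable_iff]
    exact fun K hK =>
      (hu.1.integrableOn_isCompact hK).continuousOn_mul ha.continuous.continuousOn hK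
  · rw [mulOp_apply, hu.2]
    refine integral_congr_ae (Filter.Eventually.of_forall fun Z => ?_)
    simp only [mulTest_apply]
    ring

/-- Integration by parts. -/
theorem dOp (hu : Represents u T) (hs : ContDiff ℝ ∞ u) (v : Spacetime n) :
    Represents (fun Z => -Complex.I * fderiv ℝ u Z v) (_root_.dOp v T) := by
  have hd : ContDiff ℝ ∞ fun Z => fderiv ℝ u Z v :=
    (hs.fderiv_right (m := ∞) (by simp)).clm_apply contDiff_const
  refine ⟨(hs.fderiv_field contDiff_const).continuous.locallyIntegrable, fun φ => ?_⟩
  rw [dOp_apply, hu.2]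
  have hφ : Continuous fun Z => fderiv ℝ φ Z v :=
    (φ.contDiff.continuous_fderiv (by simp)).clm_apply continuous_const
  have hφc : HasCompactSupport fun Z => fderiv ℝ φ Z v := φ.hasCompactSupport.fderiv_apply ℝ v
  have hp := integral_mul_fderiv_eq_neg_fderiv_mul_of_integrable
    (μ := (volume : Measure (Spacetime n)))
    (f := u) (g := φ) (v := v)
    (integrable_mul_testFn hd.continuous.locallyIntegrable φ)
    (hu.1.integrable_smul_right_of_hasCompactSupport hφ hφc)
    (integrable_mul_testFn hu.1 φ) (fun Z _ => hs.differentiable (by simp) Z)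
    (fun Z _ => φ.differentiable Z)
  have e1 : ∫ Z, u Z * (Complex.I • (TestFunction.lineDerivCLM ℂ v φ : TestFn n)) Z =
      Complex.I * ∫ Z, u Z * fderiv ℝ φ Z v := by
    rw [← integral_const_mul]
    refine integral_congr_ae (Filter.Eventually.of_forall fun Z => ?_)
    simp only [smul_testFn_apply, lineDeriv_testFn]
    ring
  rw [e1, hp, mul_neg, ← neg_mul, ← integral_const_mul]
  exact integral_congr_ae (Filter.Eventually.of_forall fun Z => (mul_assoc _ _ _).symm)

theorem act (hu : Represents u T) (hs : ContDiff ℝ ∞ u) (g : FlatGen n) :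
    Represents (g.act u) (g.op T) := by
  cases g with
  | dz j =>
    have h := (hu.dOp hs (EuclideanSpace.single j 1, 0)).mulOp (contDiff_bracketT n).ofReal_comp
    refine h.congr_fun fun Z => ?_
    rw [FlatGen.act_eq_der (by simp), FlatGen.der]
    have : (FlatGen.dz j).vec Z =
        bracketT Z • ((EuclideanSpace.single j 1, 0) : Spacetime n) := by
      simp [FlatGen.vec]
    rw [this, map_smul, Complex.real_smul]
    ring
  | weight =>
    have h := hu.mulOp (FlatGen.contDiff_pot .weight)
    refine h.congr_fun fun Z => ?_
    rw [FlatGen.weight_act]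
    rfl
  | dt =>
    have h := (hu.dOp hs (0, 1)).mulOp (contDiff_bracketT n).ofReal_comp
    refine h.congr_fun fun Z => ?_
    rw [FlatGen.act_eq_der (by simp), FlatGen.der]
    have : (FlatGen.dt).vec Z = bracketT Z • ((0, 1) : Spacetime n) := by
      simp [FlatGen.vec]
    rw [this, map_smul, Complex.real_smul]
    ring
  | rot j k =>
    have h := ((hu.dOp hs (EuclideanSpace.single k 1, 0)).mulOp
      (contDiff_coord j).ofReal_comp).sub
      ((hu.dOp hs (EuclideanSpace.single j 1, 0)).mulOp (contDiff_coord k).ofReal_comp)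
    refine h.congr_fun fun Z => ?_
    rw [FlatGen.act_eq_der (by simp), FlatGen.der]
    have : (FlatGen.rot j k).vec Z =
        Z.1 j • ((EuclideanSpace.single k 1, 0) : Spacetime n) -
          Z.1 k • ((EuclideanSpace.single j 1, 0) : Spacetime n) := by
      simp [FlatGen.vec]
    rw [this, map_sub, map_smul, map_smul, Complex.real_smul, Complex.real_smul]
    ring

theorem wordAct (hu : Represents u T) (hs : ContDiff ℝ ∞ u) (l : List (FlatGen n)) :
    Represents (wordAct l u) (wordOp l T) := by
  induction l with
  | nil => simpa [wordOp] using hu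
  | cons g l ih =>
    rw [wordAct_cons, wordOp_cons]
    exact ih.act (hs.wordAct l) g

end Represents

/-- Operators which are transposes of operators on test functions. -/
def HasTranspose {n : ℕ} (A : DistrOp n) : Prop := ∃ B : TestFn n →ₗ[ℂ] TestFn n, A = B.dualMap

theorem HasTranspose.mul {n : ℕ} {A A' : DistrOp n} (h : HasTranspose A) (h' : HasTranspose A') :
    HasTranspose (A * A') := by
  obtain ⟨B, rfl⟩ := h
  obtain ⟨B', rfl⟩ := h'
  exact ⟨B' ∘ₗ B, rfl⟩

theorem HasTranspose.sub {n : ℕ} {A A' : DistrOp n} (h : HasTranspose A) (h' : HasTranspose A') :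
    HasTranspose (A - A') := by
  obtain ⟨B, rfl⟩ := h
  obtain ⟨B', rfl⟩ := h'
  exact ⟨B - B', LinearMap.ext fun T => LinearMap.ext fun φ => (map_sub T _ _).symm⟩

theorem hasTranspose_op {n : ℕ} (g : FlatGen n) : HasTranspose g.op := by
  cases g with
  | dz j => exact HasTranspose.mul ⟨_, rfl⟩ ⟨_, rfl⟩
  | weight => exact ⟨_, rfl⟩
  | dt => exact HasTranspose.mul ⟨_, rfl⟩ ⟨_, rfl⟩
  | rot j k => exact (HasTranspose.mul ⟨_, rfl⟩ ⟨_, rfl⟩).sub (HasTranspose.mul ⟨_, rfl⟩ ⟨_, rfl⟩)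

theorem hasTranspose_wordOp {n : ℕ} (l : List (FlatGen n)) : HasTranspose (wordOp l) := by
  induction l with
  | nil => exact ⟨LinearMap.id, rfl⟩
  | cons g l ih =>
    rw [wordOp_cons]
    exact (hasTranspose_op g).mul ih

theorem tendsto_integral_mul_testFn {n : ℕ} {u : ℕ → Spacetime n → ℂ} {v : Spacetime n → ℂ}
    (hu : ∀ N, LocallyIntegrable (u N)) (hv : LocallyIntegrable v)
    (h : ∀ K : Set (Spacetime n), IsCompact K →
      Filter.Tendsto (fun N => eLpNorm (u N - v) 1 (volume.restrict K)) Filter.atTop (nhds 0))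
    (φ : TestFn n) :
    Filter.Tendsto (fun N => ∫ Z, u N Z * φ Z) Filter.atTop (nhds (∫ Z, v Z * φ Z)) := by
  refine tendsto_integral_of_L1' _ (integrable_mul_testFn hv φ).1
    (Filter.Eventually.of_forall fun N => integrable_mul_testFn (hu N) φ) ?_
  set K := tsupport (φ : Spacetime n → ℂ)
  have hK : IsCompact K := φ.hasCompactSupport
  obtain ⟨C, hC⟩ := hK.exists_bound_of_continuousOn φ.contDiff.continuous.continuousOn
  have hb : ∀ N, eLpNorm ((fun Z => u N Z * φ Z) - fun Z => v Z * φ Z) 1 volume ≤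
      ENNReal.ofReal C * eLpNorm (u N - v) 1 (volume.restrict K) := by
    intro N
    rw [← eLpNorm_indicator_eq_eLpNorm_restrict hK.measurableSet]
    refine eLpNorm_le_mul_eLpNorm_of_ae_le_mul (Filter.Eventually.of_forall fun Z => ?_) 1
    by_cases hZ : Z ∈ K
    · rw [Set.indicator_of_mem hZ, Pi.sub_apply, Pi.sub_apply, ← sub_mul, norm_mul, mul_comm]
      gcongr
      exact hC Z hZ
    · simp [image_eq_zero_of_notMem_tsupport hZ, Set.indicator_of_notMem hZ]
  refine tendsto_of_tendsto_of_tendsto_of_le_of_le tendsto_const_nhds ?_ (fun _ => zero_le) hb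
  simpa using ENNReal.Tendsto.const_mul (h K hK) (Or.inr (ENNReal.ofReal_ne_top (r := C)))

/-- Weak equations pass to limits in `L¹` on compact sets. -/
theorem represents_of_tendsto {n : ℕ} {A : DistrOp n} (hA : HasTranspose A)
    {u a : ℕ → Spacetime n → ℂ} {v b : Spacetime n → ℂ} {S : ℕ → Distr n} {T : Distr n}
    (hu : ∀ N, Represents (u N) (S N)) (ha : ∀ N, Represents (a N) (A (S N)))
    (hv : Represents v T) (hb : LocallyIntegrable b)
    (huv : ∀ K : Set (Spacetime n), IsCompact K →
      Filter.Tendsto (fun N => eLpNorm (u N - v) 1 (volume.restrict K)) Filter.atTop (nhds 0))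
    (hab : ∀ K : Set (Spacetime n), IsCompact K →
      Filter.Tendsto (fun N => eLpNorm (a N - b) 1 (volume.restrict K)) Filter.atTop (nhds 0)) :
    Represents b (A T) := by
  obtain ⟨B, rfl⟩ := hA
  refine ⟨hb, fun φ => ?_⟩
  have h1 := tendsto_integral_mul_testFn (fun N => (hu N).1) hv.1 huv (B φ)
  have h2 := tendsto_integral_mul_testFn (fun N => (ha N).1) hb hab φ
  have e : ∀ N, ∫ Z, a N Z * φ Z = ∫ Z, u N Z * (B φ) Z := fun N => by
    rw [← (ha N).2, ← (hu N).2]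
    rfl
  simp only [e] at h2
  rw [LinearMap.dualMap_apply, hv.2]
  exact tendsto_nhds_unique h1 h2

/-! ### Local approximation by smooth functions -/

/-- The functions `a m` converge to the distribution `T` in `L²` on compact sets. -/
def ConvL2 {n : ℕ} (a : ℕ → Spacetime n → ℂ) (T : Distr n) : Prop :=
  ∃ w : Spacetime n → ℂ, Represents w T ∧
    (∀ K : Set (Spacetime n), IsCompact K → MemLp w 2 (volume.restrict K)) ∧
    ∀ K : Set (Spacetime n), IsCompact K →
      Filter.Tendsto (fun m => eLpNorm (a m - w) 2 (volume.restrict K)) Filter.atTop (nhds 0)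

theorem ConvL2.add {n : ℕ} {a b : ℕ → Spacetime n → ℂ} {S T : Distr n}
    (ha' : ∀ m, Continuous (a m)) (hb' : ∀ m, Continuous (b m))
    (ha : ConvL2 a S) (hb : ConvL2 b T) : ConvL2 (fun m Z => a m Z + b m Z) (S + T) := by
  obtain ⟨v, hv, hv2, hav⟩ := ha
  obtain ⟨w, hw, hw2, hbw⟩ := hb
  refine ⟨_, hv.add hw, fun K hK => (hv2 K hK).add (hw2 K hK), fun K hK => ?_⟩
  have h : Filter.Tendsto (fun m => eLpNorm (a m - v) 2 (volume.restrict K) +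
      eLpNorm (b m - w) 2 (volume.restrict K)) Filter.atTop (nhds 0) := by
    simpa using (hav K hK).add (hbw K hK)
  refine tendsto_of_tendsto_of_tendsto_of_le_of_le tendsto_const_nhds h (fun _ => zero_le)
    fun m => ?_
  have e : ((fun Z => a m Z + b m Z) - fun Z => v Z + w Z) = (a m - v) + (b m - w) := by
    funext Z
    simp only [Pi.sub_apply, Pi.add_apply]
    ring
  rw [e]
  exact eLpNorm_add_le ((ha' m).aestronglyMeasurable.sub (hv2 K hK).1)
    ((hb' m).aestronglyMeasurable.sub (hw2 K hK).1) (by norm_num)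

theorem ConvL2.mulOp {n : ℕ} {a : ℕ → Spacetime n → ℂ} {T : Distr n} (ha : ConvL2 a T)
    {b : Spacetime n → ℂ} (hb : ContDiff ℝ ∞ b) :
    ConvL2 (fun m Z => b Z * a m Z) (_root_.mulOp b hb T) := by
  obtain ⟨v, hv, hv2, hav⟩ := ha
  have key : ∀ K : Set (Spacetime n), IsCompact K → ∃ C : ℝ, ∀ h : Spacetime n → ℂ,
      ∀ᵐ Z ∂volume.restrict K, ‖b Z * h Z‖ ≤ C * ‖h Z‖ := by
    intro K hK
    obtain ⟨C, hC⟩ := hK.exists_bound_of_continuousOn hb.continuous.continuousOn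
    refine ⟨C, fun h => (ae_restrict_iff' hK.measurableSet).2
      (Filter.Eventually.of_forall fun Z hZ => ?_)⟩
    rw [norm_mul]
    gcongr
    exact hC Z hZ
  refine ⟨_, hv.mulOp hb, fun K hK => ?_, fun K hK => ?_⟩
  · obtain ⟨C, hC⟩ := key K hK
    exact (hv2 K hK).of_le_mul (hb.continuous.aestronglyMeasurable.mul (hv2 K hK).1) (hC v)
  · obtain ⟨C, hC⟩ := key K hK
    have h := ENNReal.Tendsto.const_mul (a := ENNReal.ofReal C) (hav K hK)
      (Or.inr ENNReal.ofReal_ne_top)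
    rw [mul_zero] at h
    refine tendsto_of_tendsto_of_tendsto_of_le_of_le tendsto_const_nhds h (fun _ => zero_le)
      fun m => ?_
    refine eLpNorm_le_mul_eLpNorm_of_ae_le_mul ((hC (a m - v)).mono fun Z hZ => ?_) 2
    simpa only [Pi.sub_apply, mul_sub] using hZ

/-- The coordinate directions of spacetime. -/
def coordVec {n : ℕ} : Option (Fin n) → Spacetime n
  | none => (0, 1)
  | some j => (EuclideanSpace.single j 1, 0)

/-- `D = -i ∂` in a coordinate direction. -/
def coordD {n : ℕ} (i : Option (Fin n)) (a : Spacetime n → ℂ) (Z : Spacetime n) : ℂ :=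
  -Complex.I * fderiv ℝ a Z (coordVec i)

/-- A product of coordinate derivatives acting on functions. -/
def constAct {n : ℕ} : List (Option (Fin n)) → (Spacetime n → ℂ) → Spacetime n → ℂ
  | [], a => a
  | i :: c, a => constAct c (coordD i a)

/-- A product of coordinate derivatives acting on distributions. -/
def constOp {n : ℕ} : List (Option (Fin n)) → Distr n → Distr n
  | [], T => T
  | i :: c, T => constOp c (dOp (coordVec i) T)

theorem ContDiff.coordD {n : ℕ} {a : Spacetime n → ℂ} (ha : ContDiff ℝ ∞ a)
    (i : Option (Fin n)) : ContDiff ℝ ∞ (coordD i a) := ha.fderiv_field contDiff_const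

theorem ContDiff.constAct {n : ℕ} {a : Spacetime n → ℂ} (ha : ContDiff ℝ ∞ a)
    (c : List (Option (Fin n))) : ContDiff ℝ ∞ (constAct c a) := by
  induction c generalizing a with
  | nil => exact ha
  | cons i c ih => exact ih (ha.coordD i)

theorem constAct_add {n : ℕ} (c : List (Option (Fin n))) {a b : Spacetime n → ℂ}
    (ha : ContDiff ℝ ∞ a) (hb : ContDiff ℝ ∞ b) :
    constAct c (fun Z => a Z + b Z) = fun Z => constAct c a Z + constAct c b Z := by
  induction c generalizing a b with
  | nil => rfl
  | cons i c ih =>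
    simp only [constAct]
    rw [← ih (ha.coordD i) (hb.coordD i)]
    congr 1
    funext Z
    rw [coordD, fderiv_fun_add (ha.differentiable (by simp) Z) (hb.differentiable (by simp) Z),
      add_apply, mul_add]
    rfl

theorem constOp_add {n : ℕ} (c : List (Option (Fin n))) (S T : Distr n) :
    constOp c (S + T) = constOp c S + constOp c T := by
  induction c generalizing S T with
  | nil => rfl
  | cons i c ih => simp only [constOp, map_add, ih]

theorem coordD_mul {n : ℕ} (i : Option (Fin n)) {a b : Spacetime n → ℂ}
    (ha : ContDiff ℝ ∞ a) (hb : ContDiff ℝ ∞ b) :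
    coordD i (fun Z => b Z * a Z) = fun Z => b Z * coordD i a Z + coordD i b Z * a Z := by
  funext Z
  rw [coordD, fderiv_fun_mul (hb.differentiable (by simp) Z) (ha.differentiable (by simp) Z)]
  simp only [add_apply, smul_apply, smul_eq_mul, coordD]
  ring

theorem dOp_mulOp_apply {n : ℕ} (i : Option (Fin n)) {b : Spacetime n → ℂ} (hb : ContDiff ℝ ∞ b)
    (T : Distr n) : dOp (coordVec i) (mulOp b hb T) =
      mulOp b hb (dOp (coordVec i) T) + mulOp (coordD i b) (hb.coordD i) T :=
  LinearMap.congr_fun (dOp_mul_mulOp (coordVec i) hb) T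

/-- All coordinate derivatives of order at most `j` of `a m` converge to those of `T` in `L²` on
compact sets. -/
def ConvWords {n : ℕ} (j : ℕ) (a : ℕ → Spacetime n → ℂ) (T : Distr n) : Prop :=
  (∀ m, ContDiff ℝ ∞ (a m)) ∧
    ∀ c, coordOrd c ≤ j → ConvL2 (fun m => constAct c (a m)) (constOp c T)

namespace ConvWords

variable {n j : ℕ} {a b : ℕ → Spacetime n → ℂ} {S T : Distr n}

theorem mono (h : ConvWords j a T) {j' : ℕ} (hj : j' ≤ j) : ConvWords j' a T :=
  ⟨h.1, fun c hc => h.2 c (hc.trans hj)⟩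

theorem add (ha : ConvWords j a S) (hb : ConvWords j b T) :
    ConvWords j (fun m Z => a m Z + b m Z) (S + T) := by
  refine ⟨fun m => (ha.1 m).add (hb.1 m), fun c hc => ?_⟩
  simp only [constAct_add c (ha.1 _) (hb.1 _), constOp_add]
  exact (ha.2 c hc).add (fun m => ((ha.1 m).constAct c).continuous)
    (fun m => ((hb.1 m).constAct c).continuous) (hb.2 c hc)

theorem coordD {i : Option (Fin n)} (h : ConvWords (j + coordOrd [i]) a T) :
    ConvWords j (fun m => _root_.coordD i (a m)) (dOp (coordVec i) T) := by
  refine ⟨fun m => (h.1 m).coordD i, fun c hc => h.2 (i :: c) ?_⟩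
  cases i <;> simp at * <;> omega

theorem mulOp (h : ConvWords j a T) {b : Spacetime n → ℂ} (hb : ContDiff ℝ ∞ b) :
    ConvWords j (fun m Z => b Z * a m Z) (_root_.mulOp b hb T) := by
  refine ⟨fun m => hb.mul (h.1 m), fun c => ?_⟩
  induction c generalizing j a b T with
  | nil => exact fun _ => (h.2 [] (by simp)).mulOp hb
  | cons i c ih =>
    intro hc
    simp only [constAct, constOp, coordD_mul i (h.1 _) hb, dOp_mulOp_apply, constOp_add,
      constAct_add c (hb.mul ((h.1 _).coordD i)) ((hb.coordD i).mul (h.1 _))]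
    have hci : coordOrd [i] + coordOrd c ≤ j := by
      cases i <;> simp at * <;> omega
    have h1 : ConvWords (coordOrd c) (fun m => _root_.coordD i (a m)) (dOp (coordVec i) T) :=
      ConvWords.coordD (h.mono (by omega))
    have h2 : ConvWords (coordOrd c) a T := h.mono (by omega)
    exact ConvL2.add (fun m => ((hb.mul ((h.1 m).coordD i)).constAct c).continuous)
      (fun m => (((hb.coordD i).mul (h.1 m)).constAct c).continuous)
      (ih h1 hb le_rfl) (ih h2 (hb.coordD i) le_rfl)

theorem act (g : FlatGen n) (h : ConvWords (j + g.order) a T) :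
    ConvWords j (fun m => g.act (a m)) (g.op T) := by
  cases g with
  | dz i =>
    have h1 := (ConvWords.coordD (i := some i) h).mulOp (contDiff_bracketT n).ofReal_comp
    have e : (fun m => (FlatGen.dz i).act (a m)) =
        fun m Z => (bracketT Z : ℂ) * _root_.coordD (some i) (a m) Z := by
      funext m Z
      rw [FlatGen.act_eq_der (by simp), FlatGen.der]
      have : (FlatGen.dz i).vec Z = bracketT Z • (coordVec (some i) : Spacetime n) := by
        simp [FlatGen.vec, coordVec]
      rw [this, map_smul, Complex.real_smul, _root_.coordD]
      ring
    rw [e]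
    exact h1
  | weight =>
    have h1 := (h.mono (Nat.le_add_right j _)).mulOp (FlatGen.contDiff_pot .weight)
    have e : (fun m => (FlatGen.weight).act (a m)) =
        fun m Z => FlatGen.pot .weight Z * a m Z := by
      funext m Z
      rw [FlatGen.weight_act]
      rfl
    rw [e]
    exact h1
  | dt =>
    have h1 := (ConvWords.coordD (i := none) h).mulOp (contDiff_bracketT n).ofReal_comp
    have e : (fun m => (FlatGen.dt).act (a m)) =
        fun m Z => (bracketT Z : ℂ) * _root_.coordD none (a m) Z := by
      funext m Z
      rw [FlatGen.act_eq_der (by simp), FlatGen.der]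
      have : (FlatGen.dt).vec Z = bracketT Z • (coordVec none : Spacetime n) := by
        simp [FlatGen.vec, coordVec]
      rw [this, map_smul, Complex.real_smul, _root_.coordD]
      ring
    rw [e]
    exact h1
  | rot i k =>
    have h1 := (ConvWords.coordD (i := some k) h).mulOp (contDiff_coord i).ofReal_comp
    have h2 := (ConvWords.coordD (i := some i) h).mulOp (contDiff_coord k).ofReal_comp
    have h3 := h1.add (h2.mulOp (contDiff_const (c := (-1 : ℂ))))
    have e : (fun m => (FlatGen.rot i k).act (a m)) = fun m Z =>
        (Z.1 i : ℂ) * _root_.coordD (some k) (a m) Z +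
          -1 * ((Z.1 k : ℂ) * _root_.coordD (some i) (a m) Z) := by
      funext m Z
      rw [FlatGen.act_eq_der (by simp), FlatGen.der]
      have : (FlatGen.rot i k).vec Z = Z.1 i • (coordVec (some k) : Spacetime n) -
          Z.1 k • (coordVec (some i) : Spacetime n) := by
        simp [FlatGen.vec, coordVec]
      rw [this, map_sub, map_smul, map_smul, Complex.real_smul, Complex.real_smul, _root_.coordD,
        _root_.coordD]
      ring
    have e2 : (FlatGen.rot i k).op T =
        _root_.mulOp (fun Z : Spacetime n => (Z.1 i : ℂ)) (contDiff_coord i).ofReal_comp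
          (dOp (coordVec (some k)) T) +
        _root_.mulOp (fun _ : Spacetime n => (-1 : ℂ)) contDiff_const
          (_root_.mulOp (fun Z : Spacetime n => (Z.1 k : ℂ)) (contDiff_coord k).ofReal_comp
          (dOp (coordVec (some i)) T)) := by
      rw [mulOp_const, LinearMap.smul_apply, neg_one_smul, ← sub_eq_add_neg]
      rfl
    rw [e, e2]
    exact h3

theorem wordAct (l : List (FlatGen n)) (h : ConvWords (j + wordOrd l) a T) :
    ConvWords j (fun m => wordAct l (a m)) (wordOp l T) := by
  induction l generalizing j with
  | nil => simpa [wordOp, wordOrd] using h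
  | cons g l ih =>
    rw [wordOp_cons]
    refine ConvWords.act g (ih (j := j + g.order) ?_)
    rwa [wordOrd_cons, ← add_assoc] at h

end ConvWords

theorem mollify_eq_integral_mul {n : ℕ} (m : ℕ) (u : Spacetime n → ℂ) (Z : Spacetime n) :
    mollify volume m u Z =
      ∫ W, u W * (((bumpSeq (Spacetime n) m).normed volume (Z - W) : ℝ) : ℂ) := by
  rw [mollify_eq_convolution, convolution_lsmul_swap]
  refine integral_congr_ae (Filter.Eventually.of_forall fun W => ?_)
  simp only [Complex.real_smul]
  ring

theorem contDiff_mollify {n : ℕ} (m : ℕ) {u : Spacetime n → ℂ} (hu : LocallyIntegrable u) :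
    ContDiff ℝ ∞ (mollify volume m u) :=
  HasCompactSupport.contDiff_convolution_left (n := ⊤) (ContinuousLinearMap.lsmul ℝ ℝ)
    (bumpSeq (Spacetime n) m).hasCompactSupport_normed
    ((bumpSeq (Spacetime n) m).contDiff_normed) hu

/-- Mollification commutes with derivatives with constant coefficients. -/
theorem mollify_dOp {n : ℕ} (m : ℕ) {u w : Spacetime n → ℂ} {T : Distr n} {v : Spacetime n}
    (hu : Represents u T) (hw : Represents w (dOp v T)) (Z : Spacetime n) :
    -Complex.I * fderiv ℝ (mollify volume m u) Z v = mollify volume m w Z := by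
  set φ : Spacetime n → ℝ := (bumpSeq (Spacetime n) m).normed volume with hφ
  have hφs : ContDiff ℝ ∞ φ := (bumpSeq (Spacetime n) m).contDiff_normed
  have hφc : HasCompactSupport φ := (bumpSeq (Spacetime n) m).hasCompactSupport_normed
  let ψ : TestFn n :=
    { toFun := fun W => (φ (Z - W) : ℂ)
      contDiff' := (hφs.comp (contDiff_const.sub contDiff_id)).ofReal_comp
      hasCompactSupport' := (hφc.comp_homeomorph (Homeomorph.subLeft Z)).comp_left
        (g := fun x : ℝ => (x : ℂ)) Complex.ofReal_zero
      tsupport_subset' := fun _ _ => trivial }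
  have hψ : ∀ W, fderiv ℝ ψ W v = -((fderiv ℝ φ (Z - W) v : ℝ) : ℂ) := by
    intro W
    have h1 : HasFDerivAt (fun W : Spacetime n => Z - W) (-ContinuousLinearMap.id ℝ _) W :=
      (hasFDerivAt_id W).const_sub Z
    have h2 := (Complex.ofRealCLM.hasFDerivAt (x := φ (Z - W))).comp W
      (((hφs.differentiable (by simp) (Z - W)).hasFDerivAt).comp W h1)
    have h3 : fderiv ℝ ψ W = _ := h2.fderiv
    rw [h3]
    simp
  have h1 := hw.2 ψ
  rw [dOp_apply, hu.2] at h1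
  have e1 : mollify volume m w Z = ∫ W, w W * ψ W := mollify_eq_integral_mul m w Z
  have e2 : mollify volume m u =
      convolution u φ (ContinuousLinearMap.lsmul ℝ ℝ).flip volume := by
    rw [mollify_eq_convolution, convolution_flip]
  have e3 := (hφc.hasFDerivAt_convolution_right (ContinuousLinearMap.lsmul ℝ ℝ).flip hu.1
    (hφs.of_le (by simp)) Z).fderiv
  rw [e1, ← h1, e2, e3, convolution_precompR_apply _ hu.1 (hφc.fderiv ℝ)
    (hφs.continuous_fderiv (by simp)), convolution_def, ← integral_const_mul]
  refine integral_congr_ae (Filter.Eventually.of_forall fun W => ?_)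
  simp only [smul_testFn_apply, lineDeriv_testFn, hψ, ContinuousLinearMap.flip_apply,
    ContinuousLinearMap.lsmul_apply, Complex.real_smul]
  ring

theorem convWords_mollify {n j : ℕ} {u : Spacetime n → ℂ} {T : Distr n} (hu : Represents u T)
    (h : ∀ c, coordOrd c ≤ j → ∃ w, Represents w (constOp c T) ∧
      ∀ K : Set (Spacetime n), IsCompact K → MemLp w 2 (volume.restrict K)) :
    ConvWords j (fun m => mollify volume m u) T := by
  refine ⟨fun m => contDiff_mollify m hu.1, fun c => ?_⟩
  induction c generalizing j u T with
  | nil =>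
    intro _
    obtain ⟨w, hw, hw2⟩ := h [] (by simp)
    have huw : u =ᵐ[volume] w := hu.ae_eq hw
    refine ⟨u, hu, fun K hK => (hw2 K hK).ae_eq (ae_restrict_of_ae huw.symm), fun K hK => ?_⟩
    exact tendsto_eLpNorm_mollify_sub volume
      (fun K hK => (hw2 K hK).ae_eq (ae_restrict_of_ae huw.symm)) hK
  | cons i c ih =>
    intro hc
    have hci : coordOrd [i] + coordOrd c ≤ j := by
      cases i <;> simp at * <;> omega
    obtain ⟨w, hw, -⟩ := h [i] (by omega)
    have e : ∀ m, coordD i (mollify volume m u) = mollify volume m w := fun m =>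
      funext fun Z => mollify_dOp m hu hw Z
    simp only [constAct, constOp, e]
    refine ih (j := coordOrd c) hw (fun c' hc' => h (i :: c') ?_) le_rfl
    cases i <;> simp at * <;> omega

/-! ### Weighted norms of weak derivatives -/

theorem MemWeightedL2.aestronglyMeasurable {n : ℕ} {r : ℝ} {v : Spacetime n → ℂ}
    (hv : MemWeightedL2 r v) : AEStronglyMeasurable v volume := by
  have hc : Continuous fun Z : Spacetime n => ((bracketZ Z ^ (-r) : ℝ) : ℂ) :=
    (contDiff_bracketZ_rpow n (-r)).ofReal_comp.continuous
  refine (hc.aestronglyMeasurable.mul hv.1).congr (Filter.Eventually.of_forall fun Z => ?_)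
  simp only [Pi.mul_apply]
  rw [← mul_assoc, ← Complex.ofReal_mul, ← Real.rpow_add (bracketZ_pos Z), neg_add_cancel,
    Real.rpow_zero, Complex.ofReal_one, one_mul]

theorem MemWeightedL2.memLp_restrict {n : ℕ} {r : ℝ} {v : Spacetime n → ℂ}
    (hv : MemWeightedL2 r v) {K : Set (Spacetime n)} (hK : IsCompact K) :
    MemLp v 2 (volume.restrict K) := by
  have hc : Continuous fun Z : Spacetime n => bracketZ Z ^ (-r) :=
    (contDiff_bracketZ_rpow n (-r)).continuous
  obtain ⟨C, hC⟩ := hK.exists_bound_of_continuousOn hc.continuousOn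
  refine (MemLp.restrict K hv).of_le_mul hv.aestronglyMeasurable.restrict (c := C)
    ((ae_restrict_iff' hK.measurableSet).2 (Filter.Eventually.of_forall fun Z hZ => ?_))
  have hpos : 0 < bracketZ Z ^ r := Real.rpow_pos_of_pos (bracketZ_pos Z) r
  rw [norm_mul, Complex.norm_real, Real.norm_of_nonneg hpos.le, ← mul_assoc]
  refine le_mul_of_one_le_left (norm_nonneg _) ?_
  have h := hC Z hZ
  rw [Real.rpow_neg (bracketZ_pos Z).le, Real.norm_of_nonneg (by positivity)] at h
  calc (1 : ℝ) = (bracketZ Z ^ r)⁻¹ * bracketZ Z ^ r := (inv_mul_cancel₀ hpos.ne').symm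
    _ ≤ C * bracketZ Z ^ r := by gcongr

theorem locallyIntegrable_of_memLp_restrict {n : ℕ} {v : Spacetime n → ℂ}
    (hv : ∀ K : Set (Spacetime n), IsCompact K → MemLp v 2 (volume.restrict K)) :
    LocallyIntegrable v := by
  rw [locallyIntegrable_iff]
  intro K hK
  have := hK.measure_lt_top (μ := (volume : Measure (Spacetime n)))
  have : IsFiniteMeasure ((volume : Measure (Spacetime n)).restrict K) :=
    ⟨by rwa [Measure.restrict_apply_univ]⟩
  exact (hv K hK).integrable (by norm_num)

theorem MemWeightedL2.locallyIntegrable {n : ℕ} {r : ℝ} {v : Spacetime n → ℂ}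
    (hv : MemWeightedL2 r v) : LocallyIntegrable v :=
  locallyIntegrable_of_memLp_restrict fun _ hK => hv.memLp_restrict hK

theorem weightedNorm_congr_ae {n : ℕ} (r : ℝ) {v w : Spacetime n → ℂ} (h : v =ᵐ[volume] w) :
    weightedNorm r v = weightedNorm r w :=
  eLpNorm_congr_ae (h.mono fun Z hZ => by simp only [hZ])

theorem aestronglyMeasurable_weight {n : ℕ} (r : ℝ) {v : Spacetime n → ℂ}
    (hv : AEStronglyMeasurable v volume) :
    AEStronglyMeasurable (fun Z : Spacetime n => ((bracketZ Z ^ r : ℝ) : ℂ) * v Z) volume :=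
  ((contDiff_bracketZ_rpow n r).ofReal_comp.continuous.aestronglyMeasurable).mul hv

theorem memWeightedL2_iff {n : ℕ} {r : ℝ} {v : Spacetime n → ℂ} :
    MemWeightedL2 r v ↔ AEStronglyMeasurable v volume ∧ weightedNorm r v < ⊤ :=
  ⟨fun h => ⟨h.aestronglyMeasurable, h.2⟩, fun h => ⟨aestronglyMeasurable_weight r h.1, h.2⟩⟩

theorem weightedNorm_sum_le {n : ℕ} (r : ℝ) {ι : Type*} (s : Finset ι)
    {v : ι → Spacetime n → ℂ} (hv : ∀ i ∈ s, AEStronglyMeasurable (v i) volume) :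
    weightedNorm r (fun Z => ∑ i ∈ s, v i Z) ≤ ∑ i ∈ s, weightedNorm r (v i) := by
  have e : (fun Z : Spacetime n => ((bracketZ Z ^ r : ℝ) : ℂ) * ∑ i ∈ s, v i Z) =
      ∑ i ∈ s, fun Z => ((bracketZ Z ^ r : ℝ) : ℂ) * v i Z := by
    funext Z
    rw [Finset.mul_sum, Finset.sum_apply]
  unfold weightedNorm
  rw [e]
  exact eLpNorm_sum_le (fun i hi => aestronglyMeasurable_weight r (hv i hi)) (by norm_num)

theorem weightedNorm_mul_le {n : ℕ} (r : ℝ) {a v : Spacetime n → ℂ} {C : ℝ≥0}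
    (ha : ∀ Z, ‖a Z‖ ≤ C) : weightedNorm r (fun Z => a Z * v Z) ≤ C * weightedNorm r v := by
  have h := eLpNorm_le_mul_eLpNorm_of_ae_le_mul (p := 2) (μ := (volume : Measure (Spacetime n)))
    (f := fun Z => ((bracketZ Z ^ r : ℝ) : ℂ) * (a Z * v Z))
    (g := fun Z => ((bracketZ Z ^ r : ℝ) : ℂ) * v Z) (c := C)
    (Filter.Eventually.of_forall fun Z => by
      rw [mul_left_comm, norm_mul]
      gcongr
      exact ha Z)
  rwa [ENNReal.ofReal_coe_nnreal] at h

theorem smoothX_bounded_nnreal {n : ℕ} {a : Spacetime n → ℂ} (ha : a ∈ smoothX n) :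
    ∃ C : ℝ≥0, ∀ Z, ‖a Z‖ ≤ C := by
  obtain ⟨C, hC, h⟩ := smoothX_bounded ha
  exact ⟨⟨C, hC⟩, h⟩

/-- Linear combinations with coefficients in `C^∞(X)` are bounded on weighted spaces. -/
theorem exists_weightedNorm_sum_le {n : ℕ} (r : ℝ) {ι : Type*} (s : Finset ι)
    {a : ι → Spacetime n → ℂ} (ha : ∀ i, a i ∈ smoothX n) :
    ∃ C : ℝ≥0, ∀ (v : ι → Spacetime n → ℂ) (M : ℝ≥0∞),
      (∀ i ∈ s, AEStronglyMeasurable (v i) volume) → (∀ i ∈ s, weightedNorm r (v i) ≤ M) →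
      weightedNorm r (fun Z => ∑ i ∈ s, a i Z * v i Z) ≤ C * M := by
  choose C hC using fun i => smoothX_bounded_nnreal (ha i)
  refine ⟨∑ i ∈ s, C i, fun v M hv hM => ?_⟩
  calc _ ≤ ∑ i ∈ s, weightedNorm r (fun Z => a i Z * v i Z) :=
        weightedNorm_sum_le r s fun i hi =>
          (contDiff_of_mem_smoothX (ha i)).continuous.aestronglyMeasurable.mul (hv i hi)
    _ ≤ ∑ i ∈ s, (C i : ℝ≥0∞) * M := Finset.sum_le_sum fun i hi =>
        (weightedNorm_mul_le r (hC i)).trans (by gcongr; exact hM i hi)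
    _ = _ := by rw [← Finset.sum_mul, ENNReal.ofNNReal_finsetSum]

/-! ### Weak derivatives of elements of the flat module spaces -/

theorem Represents.weakNorm_eq {n : ℕ} {u v : Spacetime n → ℂ} {T : Distr n} {A : DistrOp n}
    (hu : Represents u T) (hv : Represents v (A T)) (r : ℝ) :
    weakNorm r A u = weightedNorm r v := by
  refine le_antisymm (iInf₂_le v ⟨T, hu, hv⟩) (le_iInf₂ fun w hw => ?_)
  obtain ⟨S, hS, hwS⟩ := hw
  obtain rfl := hu.unique_distr hS
  exact (weightedNorm_congr_ae r (hv.ae_eq hwS)).le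

theorem weakNorm_le_flatNorm {n : ℕ} (r : ℝ) {k : ℕ} (u : Spacetime n → ℂ)
    {α : FlatGen n → ℕ} (hα : flatMonomialOrder α ≤ k) :
    weakNorm r (flatMonomial α) u ≤ flatNorm r k u := by
  have h : weakNorm r (flatMonomial α) u ^ 2 ≤
      ∑' β : {β : FlatGen n → ℕ // flatMonomialOrder β ≤ k},
        weakNorm r (flatMonomial β.1) u ^ 2 :=
    ENNReal.le_tsum (f := fun β : {β : FlatGen n → ℕ // flatMonomialOrder β ≤ k} =>
      weakNorm r (flatMonomial β.1) u ^ 2) ⟨α, hα⟩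
  calc weakNorm r (flatMonomial α) u = (weakNorm r (flatMonomial α) u ^ 2) ^ (1 / 2 : ℝ) := by
        rw [← ENNReal.rpow_natCast, ← ENNReal.rpow_mul]
        norm_num
    _ ≤ _ := ENNReal.rpow_le_rpow h (by norm_num)

theorem flatNorm_le {n : ℕ} (r : ℝ) {k : ℕ} {u : Spacetime n → ℂ} {M : ℝ≥0∞}
    (h : ∀ α : FlatGen n → ℕ, flatMonomialOrder α ≤ k → weakNorm r (flatMonomial α) u ≤ M) :
    flatNorm r k u ≤ ((monomials n k).card : ℝ≥0∞) * M := by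
  have hfin : Finite {α : FlatGen n → ℕ // flatMonomialOrder α ≤ k} := finite_monomials n k
  have hF := Fintype.ofFinite {α : FlatGen n → ℕ // flatMonomialOrder α ≤ k}
  have hc : Fintype.card {α : FlatGen n → ℕ // flatMonomialOrder α ≤ k} =
      (monomials n k).card :=
    Fintype.card_of_subtype _ fun α => mem_monomials
  have h1 : ∑' α : {α : FlatGen n → ℕ // flatMonomialOrder α ≤ k},
      weakNorm r (flatMonomial α.1) u ^ 2 ≤ (((monomials n k).card : ℝ≥0∞) * M) ^ 2 := by
    rw [tsum_fintype]
    calc _ ≤ ∑ α : {α : FlatGen n → ℕ // flatMonomialOrder α ≤ k}, M ^ 2 :=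
          Finset.sum_le_sum fun α _ => by
            gcongr
            exact h α.1 α.2
      _ = ((monomials n k).card : ℝ≥0∞) * M ^ 2 := by
          rw [Finset.sum_const, Finset.card_univ, hc, nsmul_eq_mul]
      _ ≤ _ := by
          rw [mul_pow]
          gcongr
          exact_mod_cast Nat.le_self_pow two_ne_zero _
  calc flatNorm r k u ≤ ((((monomials n k).card : ℝ≥0∞) * M) ^ 2) ^ (1 / 2 : ℝ) :=
        ENNReal.rpow_le_rpow h1 (by norm_num)
    _ = _ := by
        rw [← ENNReal.rpow_natCast, ← ENNReal.rpow_mul]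
        norm_num

theorem exists_represents_of_mem_flatSpace {n k : ℕ} {r : ℝ} {u : Spacetime n → ℂ}
    (hu : u ∈ flatSpace n r k) {T : Distr n} (hT : Represents u T) {A : DistrOp n}
    (hA : A ∈ flatReduced n k) : ∃ v, MemWeightedL2 r v ∧ Represents v (A T) := by
  obtain ⟨v, hv, S, hS, hvS⟩ := hu.2 A hA
  obtain rfl := hT.unique_distr hS
  exact ⟨v, hv, hvS⟩

theorem flatMonomial_mem_flatReduced {n k : ℕ} {α : FlatGen n → ℕ}
    (hα : flatMonomialOrder α ≤ k) : flatMonomial α ∈ flatReduced n k := by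
  rw [← wordOp_sortedWord]
  exact wordOp_mem_flatReduced (by rwa [wordOrd_sortedWord])

theorem flatNorm_lt_top {n k : ℕ} {r : ℝ} {u : Spacetime n → ℂ} (hu : u ∈ flatSpace n r k) :
    flatNorm r k u < ⊤ := by
  have hT := represents_distOf hu.1.locallyIntegrable
  have key : ∀ α : FlatGen n → ℕ, flatMonomialOrder α ≤ k →
      weakNorm r (flatMonomial α) u ≤
        ∑ β ∈ monomials n k, weakNorm r (flatMonomial β) u := fun α hα =>
    Finset.single_le_sum (f := fun β => weakNorm r (flatMonomial β) u)
      (fun _ _ => zero_le) (mem_monomials.2 hα)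
  refine (flatNorm_le r key).trans_lt (ENNReal.mul_lt_top (by simp) ?_)
  refine ENNReal.sum_lt_top.2 fun β hβ => ?_
  obtain ⟨v, hv, hvT⟩ := exists_represents_of_mem_flatSpace hu hT
    (flatMonomial_mem_flatReduced (mem_monomials.1 hβ))
  rw [hT.weakNorm_eq hvT]
  exact hv.2

/-- All words of order at most `k` in the generators are controlled by the norm, which involves
only the ordered ones. -/
theorem exists_weightedNorm_wordOp_le {n k : ℕ} (r : ℝ) {l : List (FlatGen n)}
    (hl : wordOrd l ≤ k) : ∃ C : ℝ≥0, ∀ u ∈ flatSpace n r k, ∀ T, Represents u T →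
      ∀ v, Represents v (wordOp l T) → weightedNorm r v ≤ C * flatNorm r k u := by
  obtain ⟨a, ha, hla⟩ := exists_coeff_wordOp hl
  obtain ⟨C, hC⟩ := exists_weightedNorm_sum_le r (monomials n k) ha
  refine ⟨C, fun u hu T hT v hv => ?_⟩
  have key : ∀ α : FlatGen n → ℕ, ∃ w, α ∈ monomials n k →
      MemWeightedL2 r w ∧ Represents w (flatMonomial α T) := fun α => by
    by_cases hα : α ∈ monomials n k
    · obtain ⟨w, hw⟩ := exists_represents_of_mem_flatSpace hu hT
        (flatMonomial_mem_flatReduced (mem_monomials.1 hα))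
      exact ⟨w, fun _ => hw⟩
    · exact ⟨0, fun h => absurd h hα⟩
  choose w hw using key
  have hsum : Represents (fun Z => ∑ α ∈ monomials n k, a α Z * w α Z) (wordOp l T) := by
    rw [hla, LinearMap.sum_apply]
    exact Represents.sum _ fun α hα => (hw α hα).2.mulOp (contDiff_of_mem_smoothX (ha α))
  rw [weightedNorm_congr_ae r (hv.ae_eq hsum)]
  refine hC w _ (fun α hα => (hw α hα).1.aestronglyMeasurable) fun α hα => ?_
  rw [← hT.weakNorm_eq (hw α hα).2]
  exact weakNorm_le_flatNorm r u (mem_monomials.1 hα)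

theorem inv_bracketT_mem_smoothX (n : ℕ) :
    (fun Z : Spacetime n => ((1 / bracketT Z : ℝ) : ℂ)) ∈ smoothX n :=
  smoothX_of_real (F := fun x : BlowupAmbient n => x.2.2.2.2.2) (by fun_prop) fun _ => rfl

theorem mulX_inv_mul_bracketTOp (n : ℕ) :
    mulX _ (inv_bracketT_mem_smoothX n) * bracketTOp n = 1 := by
  rw [mulX, bracketTOp_eq, mulOp_mul, ← one_smul ℂ (1 : DistrOp n), ← mulOp_const 1 contDiff_const]
  refine mulOp_congr _ _ fun Z => ?_
  rw [← Complex.ofReal_mul, one_div, inv_mul_cancel₀ (bracketT_pos Z).ne', Complex.ofReal_one]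

theorem dOp_coordVec_mem {n : ℕ} (i : Option (Fin n)) :
    dOp (coordVec i) ∈ flatModuleLE n (coordOrd [i]) := by
  cases i with
  | none =>
    have h := mulX_mul_op_mem_flatModuleLE (d := 2) (inv_bracketT_mem_smoothX n)
      (g := FlatGen.dt) le_rfl
    rw [FlatGen.op, ← mul_assoc, mulX_inv_mul_bracketTOp, one_mul] at h
    have e : coordOrd [(none : Option (Fin n))] = 2 := by simp
    rw [e]
    exact h
  | some j =>
    have h := mulX_mul_op_mem_flatModuleLE (d := 1) (inv_bracketT_mem_smoothX n)
      (g := FlatGen.dz j) le_rfl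
    rw [FlatGen.op, ← mul_assoc, mulX_inv_mul_bracketTOp, one_mul] at h
    have e : coordOrd [some j] = 1 := by simp
    rw [e]
    exact h

/-- Coordinate derivatives belong to the reduced powers, since `1/⟨t⟩` is smooth on `X`. -/
theorem exists_constOp_eq {n k : ℕ} {c : List (Option (Fin n))} (hc : coordOrd c ≤ k) :
    ∃ A ∈ flatReduced n k, ∀ T, constOp c T = A T := by
  suffices h : ∃ l : List (ℕ × DistrOp n),
      (∀ p ∈ l, 1 ≤ p.1 ∧ p.1 ≤ 2 ∧ p.2 ∈ flatModuleLE n p.1) ∧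
      (l.map Prod.fst).sum = coordOrd c ∧ ∀ T, constOp c T = (l.map Prod.snd).prod T by
    obtain ⟨l, h1, h2, h3⟩ := h
    exact ⟨_, prod_mem_flatReduced l h1 (h2.le.trans hc), h3⟩
  clear hc
  induction c with
  | nil => exact ⟨[], by simp, by simp, fun T => rfl⟩
  | cons i c ih =>
    obtain ⟨l, h1, h2, h3⟩ := ih
    refine ⟨l ++ [(coordOrd [i], dOp (coordVec i))], fun p hp => ?_, ?_, fun T => ?_⟩
    · rcases List.mem_append.1 hp with hp | hp
      · exact h1 p hp
      · obtain rfl := List.mem_singleton.1 hp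
        refine ⟨?_, ?_, dOp_coordVec_mem i⟩ <;> cases i <;> simp
    · cases i <;> simp [h2] <;> omega
    · simp [constOp, h3]

theorem convWords_mollify_of_mem_flatSpace {n k : ℕ} {r : ℝ} {u : Spacetime n → ℂ}
    (hu : u ∈ flatSpace n r k) {T : Distr n} (hT : Represents u T) :
    ConvWords k (fun m => mollify volume m u) T := by
  refine convWords_mollify hT fun c hc => ?_
  obtain ⟨A, hA, hAT⟩ := exists_constOp_eq hc
  obtain ⟨v, hv, hvT⟩ := exists_represents_of_mem_flatSpace hu hT hA
  exact ⟨v, by rwa [hAT], fun K hK => hv.memLp_restrict hK⟩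

/-- Words of order at most `k` applied to mollifications converge in `L²` on compact sets. -/
theorem tendsto_wordAct_mollify {n k : ℕ} {r : ℝ} {u : Spacetime n → ℂ}
    (hu : u ∈ flatSpace n r k) {T : Distr n} (hT : Represents u T) {l : List (FlatGen n)}
    (hl : wordOrd l ≤ k) {v : Spacetime n → ℂ} (hv : Represents v (wordOp l T))
    {K : Set (Spacetime n)} (hK : IsCompact K) :
    Filter.Tendsto (fun m => eLpNorm (wordAct l (mollify volume m u) - v) 2 (volume.restrict K))
      Filter.atTop (nhds 0) := by
  obtain ⟨w, hw, -, h⟩ := (((convWords_mollify_of_mem_flatSpace hu hT).mono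
    (j' := 0 + wordOrd l) (by omega)).wordAct l).2 [] (by simp)
  refine (h K hK).congr fun m => eLpNorm_congr_ae (ae_restrict_of_ae ?_)
  filter_upwards [hw.ae_eq hv] with Z hZ
  simp only [Pi.sub_apply, hZ, constAct]

/-! ### The Leibniz rule for words -/

theorem FlatGen.der_mul {n : ℕ} (g : FlatGen n) {f h : Spacetime n → ℂ} (hf : ContDiff ℝ ∞ f)
    (hh : ContDiff ℝ ∞ h) (Z : Spacetime n) :
    g.der (fun Z => f Z * h Z) Z = g.der f Z * h Z + f Z * g.der h Z := by
  unfold FlatGen.der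
  rw [fderiv_fun_mul (hf.differentiable (by simp) Z) (hh.differentiable (by simp) Z)]
  simp only [add_apply, smul_apply, smul_eq_mul]
  ring

theorem FlatGen.act_mul {n : ℕ} (g : FlatGen n) {f h : Spacetime n → ℂ} (hf : ContDiff ℝ ∞ f)
    (hh : ContDiff ℝ ∞ h) (Z : Spacetime n) :
    g.act (fun Z => f Z * h Z) Z = g.der f Z * h Z + f Z * g.act h Z := by
  unfold FlatGen.act
  rw [g.der_mul hf hh]
  ring

theorem FlatGen.act_sum {n : ℕ} (g : FlatGen n) {ι : Type*} (s : Finset ι)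
    {f : ι → Spacetime n → ℂ} (hf : ∀ i, ContDiff ℝ ∞ (f i)) (Z : Spacetime n) :
    g.act (fun Z => ∑ i ∈ s, f i Z) Z = ∑ i ∈ s, g.act (f i) Z := by
  unfold FlatGen.act FlatGen.der
  rw [fderiv_fun_sum fun i _ => (hf i).differentiable (by simp) Z]
  simp only [sum_apply, Finset.mul_sum, Finset.sum_add_distrib]

/-- A word applied to a product is a sum of products of words whose orders add up to that of the
given one. The weight, which is not a derivation, may be put on the second factor. -/
theorem exists_leibniz {n : ℕ} (l : List (FlatGen n)) :
    ∃ (ι : Type) (_ : Fintype ι) (p q : ι → List (FlatGen n)),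
      (∀ i, wordOrd (p i) + wordOrd (q i) = wordOrd l ∧ FlatGen.weight ∉ p i) ∧
      ∀ f h : Spacetime n → ℂ, ContDiff ℝ ∞ f → ContDiff ℝ ∞ h → ∀ Z,
        wordAct l (fun Z => f Z * h Z) Z = ∑ i, wordAct (p i) f Z * wordAct (q i) h Z := by
  induction l with
  | nil => exact ⟨Unit, inferInstance, fun _ => [], fun _ => [], by simp [wordOrd], by simp⟩
  | cons g l ih =>
    obtain ⟨ι, _, p, q, hpq, hsum⟩ := ih
    have key : ∀ f h : Spacetime n → ℂ, ContDiff ℝ ∞ f → ContDiff ℝ ∞ h → ∀ Z,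
        wordAct (g :: l) (fun Z => f Z * h Z) Z = ∑ i, (g.der (wordAct (p i) f) Z *
          wordAct (q i) h Z + wordAct (p i) f Z * g.act (wordAct (q i) h) Z) := by
      intro f h hf hh Z
      rw [wordAct_cons, funext (hsum f h hf hh),
        g.act_sum _ fun i => (hf.wordAct (p i)).mul (hh.wordAct (q i))]
      exact Finset.sum_congr rfl fun i _ => g.act_mul (hf.wordAct (p i)) (hh.wordAct (q i)) Z
    by_cases hg : g = .weight
    · subst hg
      refine ⟨ι, inferInstance, p, fun i => .weight :: q i, fun i => ⟨?_, (hpq i).2⟩,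
        fun f h hf hh Z => ?_⟩
      · rw [wordOrd_cons, wordOrd_cons, ← (hpq i).1]
        ring
      · rw [key f h hf hh]
        simp only [FlatGen.weight_der, zero_mul, zero_add, wordAct_cons]
    · refine ⟨ι ⊕ ι, inferInstance, Sum.elim (fun i => g :: p i) p,
        Sum.elim q (fun i => g :: q i), ?_, fun f h hf hh Z => ?_⟩
      · rintro (i | i)
        · refine ⟨?_, ?_⟩
          · simp only [Sum.elim_inl, wordOrd_cons, ← (hpq i).1, add_assoc]
          · simp only [Sum.elim_inl, List.mem_cons, not_or]
            exact ⟨Ne.symm hg, (hpq i).2⟩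
        · refine ⟨?_, (hpq i).2⟩
          simp only [Sum.elim_inr, wordOrd_cons, ← (hpq i).1]
          ring
      · rw [key f h hf hh, Finset.sum_add_distrib, Fintype.sum_sum_type]
        simp only [Sum.elim_inl, Sum.elim_inr, wordAct_cons, FlatGen.act_eq_der hg]

/-! ### Cutoff functions -/

/-- Families of functions of the form `∑ a(Z) θ(⟨Z⟩/(N+1))`, with `a` in `C^∞(X)` and `θ` smooth
and supported in `(-∞, 2]`. -/
inductive CutFamily {n : ℕ} : (ℕ → Spacetime n → ℂ) → Prop
  | base {ψ : ℕ → Spacetime n → ℂ} (a : Spacetime n → ℂ) (θ : ℝ → ℝ) (ha : a ∈ smoothX n)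
      (hθ : ContDiff ℝ ∞ θ) (h0 : ∀ x, 2 < x → θ x = 0)
      (hψ : ∀ N Z, ψ N Z = a Z * (θ (bracketZ Z / ((N : ℝ) + 1)) : ℂ)) : CutFamily ψ
  | add {ψ ψ₁ ψ₂ : ℕ → Spacetime n → ℂ} (h₁ : CutFamily ψ₁) (h₂ : CutFamily ψ₂)
      (hψ : ∀ N Z, ψ N Z = ψ₁ N Z + ψ₂ N Z) : CutFamily ψ

namespace CutFamily

variable {n : ℕ} {ψ : ℕ → Spacetime n → ℂ}

theorem contDiff_comp_bracketZ {θ : ℝ → ℝ} (hθ : ContDiff ℝ ∞ θ) (N : ℕ) :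
    ContDiff ℝ ∞ fun Z : Spacetime n => θ (bracketZ Z / ((N : ℝ) + 1)) :=
  hθ.comp ((contDiff_bracketZ n).div_const _)

theorem contDiff (h : CutFamily ψ) (N : ℕ) : ContDiff ℝ ∞ (ψ N) := by
  induction h with
  | base a θ ha hθ h0 hψ =>
    rw [funext (hψ N)]
    exact (contDiff_of_mem_smoothX ha).mul (contDiff_comp_bracketZ hθ N).ofReal_comp
  | add h₁ h₂ hψ ih₁ ih₂ =>
    rw [funext (hψ N)]
    exact ih₁.add ih₂

theorem exists_bound (h : CutFamily ψ) : ∃ C : ℝ≥0, ∀ N Z, ‖ψ N Z‖ ≤ C := by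
  induction h with
  | base a θ ha hθ h0 hψ =>
    obtain ⟨A, hA⟩ := smoothX_bounded_nnreal ha
    obtain ⟨B, hB⟩ := (isCompact_Icc (a := (0 : ℝ)) (b := 2)).exists_bound_of_continuousOn
      hθ.continuous.continuousOn
    refine ⟨A * B.toNNReal, fun N Z => ?_⟩
    rw [hψ, norm_mul, Complex.norm_real, NNReal.coe_mul]
    refine mul_le_mul (hA Z) ?_ (norm_nonneg _) A.2
    rw [Real.coe_toNNReal']
    by_cases hx : bracketZ Z / ((N : ℝ) + 1) ≤ 2
    · exact (hB _ ⟨div_nonneg (bracketZ_pos Z).le (by positivity), hx⟩).trans (le_max_left _ _)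
    · rw [h0 _ (not_le.1 hx), norm_zero]
      exact le_max_right _ _
  | add h₁ h₂ hψ ih₁ ih₂ =>
    obtain ⟨A, hA⟩ := ih₁
    obtain ⟨B, hB⟩ := ih₂
    refine ⟨A + B, fun N Z => ?_⟩
    rw [hψ]
    exact (norm_add_le _ _).trans (add_le_add (hA N Z) (hB N Z))

theorem eq_zero (h : CutFamily ψ) {N : ℕ} {Z : Spacetime n}
    (hZ : 2 * ((N : ℝ) + 1) < bracketZ Z) : ψ N Z = 0 := by
  induction h with
  | base a θ ha hθ h0 hψ =>
    rw [hψ, h0 _ ((lt_div_iff₀ (by positivity)).2 hZ), Complex.ofReal_zero, mul_zero]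
  | add h₁ h₂ hψ ih₁ ih₂ => rw [hψ, ih₁, ih₂, add_zero]

theorem act (h : CutFamily ψ) {g : FlatGen n} (hg : g ≠ .weight) :
    CutFamily fun N => g.act (ψ N) := by
  induction h with
  | @base ψ a θ ha hθ h0 hψ =>
    have hθ' : ContDiff ℝ ∞ (deriv θ) := (contDiff_infty_iff_deriv.1 hθ).2
    have h0' : ∀ x, 2 < x → deriv θ x = 0 := fun x hx => by
      have : θ =ᶠ[nhds x] fun _ => 0 := by
        filter_upwards [lt_mem_nhds hx] with y hy using h0 y hy
      rw [this.deriv_eq, deriv_const]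
    refine add (base (g.der a) θ (smoothX_der g ha) hθ h0 fun N Z => rfl)
      (base (fun Z => a Z * (-Complex.I * (g.logZ (toAmbient Z) : ℂ)))
        (fun x => x * deriv θ x) (smoothX_mul ha (smoothX_mul (smoothX_const _) (smoothX_logZ g)))
        (contDiff_id.mul hθ') (fun x hx => by rw [h0' x hx, mul_zero]) fun N Z => rfl)
      fun N Z => ?_
    rw [FlatGen.act_eq_der hg, funext (hψ N), FlatGen.der_mul g (contDiff_of_mem_smoothX ha)
      (contDiff_comp_bracketZ hθ N).ofReal_comp]
    have hd : g.der (fun Z => ((θ (bracketZ Z / ((N : ℝ) + 1)) : ℝ) : ℂ)) Z =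
        -Complex.I * (((g.logZ (toAmbient Z)) * (bracketZ Z / ((N : ℝ) + 1) *
          deriv θ (bracketZ Z / ((N : ℝ) + 1))) : ℝ) : ℂ) := by
      unfold FlatGen.der
      congr 1
      refine fderiv_eq_of_hasDerivAt_line
        ((contDiff_comp_bracketZ hθ N).ofReal_comp.differentiable (by simp) Z) ?_
      have h1 := (hasDerivAt_bracketZ_gen g Z).div_const ((N : ℝ) + 1)
      have h2 : HasDerivAt θ (deriv θ (bracketZ Z / ((N : ℝ) + 1)))
          (bracketZ (Z + (0 : ℝ) • g.vec Z) / ((N : ℝ) + 1)) := by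
        rw [zero_smul, add_zero]
        exact (hθ.differentiable (by simp) _).hasDerivAt
      refine (h2.comp 0 h1).ofReal_comp.congr_deriv ?_
      push_cast
      ring
    rw [hd]
    push_cast
    ring
  | @add ψ ψ₁ ψ₂ h₁ h₂ hψ ih₁ ih₂ =>
    refine add ih₁ ih₂ fun N Z => ?_
    rw [funext (hψ N)]
    simp only [FlatGen.act_eq_der hg, FlatGen.der]
    rw [fderiv_fun_add ((h₁.contDiff N).differentiable (by simp) Z)
      ((h₂.contDiff N).differentiable (by simp) Z), add_apply, mul_add]

theorem wordAct (h : CutFamily ψ) {l : List (FlatGen n)} (hl : FlatGen.weight ∉ l) :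
    CutFamily fun N => wordAct l (ψ N) := by
  induction l with
  | nil => exact h
  | cons g l ih =>
    rw [List.mem_cons, not_or] at hl
    exact (ih hl.2).act (Ne.symm hl.1)

end CutFamily

/-- A cutoff equal to `1` for `⟨Z⟩ ≤ N + 1` and to `0` for `⟨Z⟩ ≥ 2 (N + 1)`. -/
def radialCutoff {n : ℕ} (N : ℕ) (Z : Spacetime n) : ℂ :=
  (Real.smoothTransition (2 - bracketZ Z / ((N : ℝ) + 1)) : ℂ)

theorem cutFamily_radialCutoff (n : ℕ) : CutFamily (radialCutoff (n := n)) :=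
  .base (fun _ => 1) (fun x => Real.smoothTransition (2 - x)) (smoothX_const 1)
    (Real.smoothTransition.contDiff.comp (contDiff_const.sub contDiff_id))
    (fun x hx => Real.smoothTransition.zero_of_nonpos (by linarith))
    fun N Z => (one_mul _).symm

theorem radialCutoff_eq_one {n : ℕ} {N : ℕ} {Z : Spacetime n} (h : bracketZ Z ≤ (N : ℝ) + 1) :
    radialCutoff N Z = 1 := by
  rw [radialCutoff, Real.smoothTransition.one_of_one_le, Complex.ofReal_one]
  have : bracketZ Z / ((N : ℝ) + 1) ≤ 1 := (div_le_one (by positivity)).2 h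
  linarith

theorem isCompact_bracketZ_le (n : ℕ) (c : ℝ) : IsCompact {Z : Spacetime n | bracketZ Z ≤ c} := by
  refine Metric.isCompact_of_isClosed_isBounded
    (isClosed_le (contDiff_bracketZ n).continuous continuous_const)
    ((Metric.isBounded_closedBall (x := 0) (r := c)).subset fun Z hZ => ?_)
  rw [mem_closedBall_zero_iff, Prod.norm_def]
  exact max_le ((norm_fst_le_bracketZ Z).trans hZ)
    (((abs_snd_le_bracketT Z).trans (bracketT_le_bracketZ Z)).trans hZ)

theorem wordAct_congr_eventually {n : ℕ} (l : List (FlatGen n)) {f h : Spacetime n → ℂ}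
    {Z : Spacetime n} (hfh : f =ᶠ[nhds Z] h) : wordAct l f =ᶠ[nhds Z] wordAct l h := by
  induction l with
  | nil => exact hfh
  | cons g l ih =>
    filter_upwards [ih.eventuallyEq_nhds] with W hW
    simp only [wordAct_cons, FlatGen.act, FlatGen.der, hW.fderiv_eq, hW.eq_of_nhds]

/-! ### Approximation by test functions -/

/-- Cutting off costs a constant uniform in the radius, since the generators applied to the
cutoffs are uniformly bounded. -/
theorem exists_weightedNorm_radialCutoff_le {n : ℕ} (r : ℝ) (l : List (FlatGen n)) :
    ∃ C : ℝ≥0, ∀ (N : ℕ) (f : Spacetime n → ℂ) (M : ℝ≥0∞), ContDiff ℝ ∞ f →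
      (∀ l' : List (FlatGen n), wordOrd l' ≤ wordOrd l →
        eLpNorm (fun Z => ((bracketZ Z ^ r : ℝ) : ℂ) * wordAct l' f Z) 2
          (volume.restrict {Z | bracketZ Z ≤ 2 * ((N : ℝ) + 1)}) ≤ M) →
      weightedNorm r (wordAct l fun Z => radialCutoff N Z * f Z) ≤ C * M := by
  obtain ⟨ι, _, p, q, hpq, hsum⟩ := exists_leibniz l
  have hcut := fun i => (cutFamily_radialCutoff n).wordAct (hpq i).2
  choose C hC using fun i => (hcut i).exists_bound
  refine ⟨∑ i, C i, fun N f M hf hM => ?_⟩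
  rw [funext (hsum _ f ((cutFamily_radialCutoff n).contDiff N) hf)]
  have hK := isCompact_bracketZ_le n (2 * ((N : ℝ) + 1))
  calc _ ≤ ∑ i, weightedNorm r (fun Z => wordAct (p i) (radialCutoff N) Z * wordAct (q i) f Z) :=
        weightedNorm_sum_le r _ fun i _ =>
          (((hcut i).contDiff N).mul (hf.wordAct (q i))).continuous.aestronglyMeasurable
    _ ≤ ∑ i, (C i : ℝ≥0∞) * M := by
        refine Finset.sum_le_sum fun i _ => ?_
        have h := hM (q i) (by have := (hpq i).1; omega)
        rw [← eLpNorm_indicator_eq_eLpNorm_restrict hK.measurableSet] at h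
        refine (eLpNorm_le_mul_eLpNorm_of_ae_le_mul (c := C i)
          (g := {Z : Spacetime n | bracketZ Z ≤ 2 * ((N : ℝ) + 1)}.indicator fun Z =>
            ((bracketZ Z ^ r : ℝ) : ℂ) * wordAct (q i) f Z)
          (Filter.Eventually.of_forall fun Z => ?_) 2).trans ?_
        · by_cases hZ : bracketZ Z ≤ 2 * ((N : ℝ) + 1)
          · rw [Set.indicator_of_mem (s := {Z | bracketZ Z ≤ 2 * ((N : ℝ) + 1)}) hZ, mul_left_comm,
              norm_mul]
            gcongr
            exact hC i N Z
          · simp only [(hcut i).eq_zero (not_le.1 hZ), zero_mul, mul_zero, norm_zero]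
            positivity
        · rw [ENNReal.ofReal_coe_nnreal]
          gcongr
    _ = _ := by rw [← Finset.sum_mul, ENNReal.ofNNReal_finsetSum]

/-- Elements of the flat module spaces are limits of test functions, in `L²` on compact sets with
all derivatives along words of order at most `k`, with norms controlled in the limit. -/
theorem exists_approx (n k : ℕ) (r : ℝ) : ∃ C : ℝ≥0, ∀ u ∈ flatSpace n r k, ∀ T,
    Represents u T → ∃ U : ℕ → Spacetime n → ℂ,
      (∀ N, ContDiff ℝ ∞ (U N) ∧ HasCompactSupport (U N)) ∧
      (∀ N, wordNorm r k (U N) ≤ C * (flatNorm r k u + ((N : ℝ≥0∞) + 1)⁻¹)) ∧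
      ∀ l, wordOrd l ≤ k → ∀ v, Represents v (wordOp l T) →
        ∀ K : Set (Spacetime n), IsCompact K →
        Filter.Tendsto (fun N => eLpNorm (wordAct l (U N) - v) 2 (volume.restrict K))
          Filter.atTop (nhds 0) := by
  choose! A hA using fun (l : List (FlatGen n)) (hl : wordOrd l ≤ k) =>
    exists_weightedNorm_wordOp_le r hl
  choose B hB using fun l : List (FlatGen n) => exists_weightedNorm_radialCutoff_le r l
  set A' : ℝ≥0 := ∑ l ∈ words n k, A l
  have hA' : ∀ l ∈ words n k, A l ≤ A' := fun l hl =>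
    Finset.single_le_sum (f := A) (fun _ _ => zero_le) hl
  refine ⟨(∑ l ∈ words n k, B l) * (A' + 1), fun u hu T hT => ?_⟩
  have hex : ∀ l, ∃ v, wordOrd l ≤ k → MemWeightedL2 r v ∧ Represents v (wordOp l T) := fun l => by
    by_cases hl : wordOrd l ≤ k
    · obtain ⟨v, hv⟩ := exists_represents_of_mem_flatSpace hu hT (wordOp_mem_flatReduced hl)
      exact ⟨v, fun _ => hv⟩
    · exact ⟨0, fun h => absurd h hl⟩
  choose v hv using hex
  set f : ℕ → Spacetime n → ℂ := fun m => mollify volume m u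
  have hf : ∀ m, ContDiff ℝ ∞ (f m) := fun m => contDiff_mollify m hT.1
  -- The mollification parameter is chosen depending on the radius of the cutoff.
  have hm : ∀ N : ℕ, ∃ m, N ≤ m ∧ ∀ l ∈ words n k,
      eLpNorm (fun Z => ((bracketZ Z ^ r : ℝ) : ℂ) * (wordAct l (f m) Z - v l Z)) 2
        (volume.restrict {Z | bracketZ Z ≤ 2 * ((N : ℝ) + 1)}) ≤ ((N : ℝ≥0∞) + 1)⁻¹ := by
    intro N
    have hK := isCompact_bracketZ_le n (2 * ((N : ℝ) + 1))
    obtain ⟨c, hc⟩ := hK.exists_bound_of_continuousOn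
      (contDiff_bracketZ_rpow n r).ofReal_comp.continuous.continuousOn
    have hev : ∀ l ∈ words n k, ∀ᶠ m in Filter.atTop,
        eLpNorm (fun Z => ((bracketZ Z ^ r : ℝ) : ℂ) * (wordAct l (f m) Z - v l Z)) 2
        (volume.restrict {Z | bracketZ Z ≤ 2 * ((N : ℝ) + 1)}) ≤ ((N : ℝ≥0∞) + 1)⁻¹ := by
      intro l hl
      have hl' := mem_words.1 hl
      have ht := ENNReal.Tendsto.const_mul (a := ENNReal.ofReal c)
        (tendsto_wordAct_mollify hu hT hl' (hv l hl').2 hK) (Or.inr ENNReal.ofReal_ne_top)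
      rw [mul_zero] at ht
      have hpos : (0 : ℝ≥0∞) < ((N : ℝ≥0∞) + 1)⁻¹ := by
        rw [ENNReal.inv_pos]
        exact (ENNReal.add_lt_top.2 ⟨ENNReal.natCast_lt_top N, ENNReal.one_lt_top⟩).ne
      filter_upwards [ENNReal.tendsto_nhds_zero.1 ht _ hpos] with m hm
      refine (eLpNorm_le_mul_eLpNorm_of_ae_le_mul ((ae_restrict_iff' hK.measurableSet).2
        (Filter.Eventually.of_forall fun Z hZ => ?_)) 2).trans hm
      rw [norm_mul]
      exact mul_le_mul_of_nonneg_right (hc Z hZ) (norm_nonneg _)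
    obtain ⟨m, h1, h2⟩ := ((Filter.eventually_ge_atTop N).and
      ((Finset.eventually_all _).2 hev)).exists
    exact ⟨m, h1, h2⟩
  choose m hmN hm using hm
  have hcs : ∀ N, ContDiff ℝ ∞ (radialCutoff N : Spacetime n → ℂ) :=
    (cutFamily_radialCutoff n).contDiff
  refine ⟨fun N Z => radialCutoff N Z * f (m N) Z, fun N => ⟨(hcs N).mul (hf _), ?_⟩, fun N => ?_,
    fun l hl w hw K hK => ?_⟩
  · refine HasCompactSupport.intro (isCompact_bracketZ_le n (2 * ((N : ℝ) + 1))) fun Z hZ => ?_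
    change radialCutoff N Z * f (m N) Z = 0
    rw [(cutFamily_radialCutoff n).eq_zero (not_le.1 hZ), zero_mul]
  · have key : ∀ l ∈ words n k,
        eLpNorm (fun Z => ((bracketZ Z ^ r : ℝ) : ℂ) * wordAct l (f (m N)) Z) 2
          (volume.restrict {Z | bracketZ Z ≤ 2 * ((N : ℝ) + 1)}) ≤
        (A' + 1 : ℝ≥0) * (flatNorm r k u + ((N : ℝ≥0∞) + 1)⁻¹) := by
      intro l hl
      have hl' := mem_words.1 hl
      have hvl := (hv l hl').1.aestronglyMeasurable
      have e : (fun Z => ((bracketZ Z ^ r : ℝ) : ℂ) * wordAct l (f (m N)) Z) =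
          (fun Z => ((bracketZ Z ^ r : ℝ) : ℂ) * v l Z) +
          fun Z => ((bracketZ Z ^ r : ℝ) : ℂ) * (wordAct l (f (m N)) Z - v l Z) := by
        funext Z
        simp only [Pi.add_apply]
        ring
      rw [e]
      refine (eLpNorm_add_le (aestronglyMeasurable_weight r hvl).restrict
        (aestronglyMeasurable_weight r
          (((hf (m N)).wordAct l).continuous.aestronglyMeasurable.sub hvl)).restrict
        (by norm_num)).trans ?_
      have h1 : eLpNorm (fun Z => ((bracketZ Z ^ r : ℝ) : ℂ) * v l Z) 2
          (volume.restrict {Z | bracketZ Z ≤ 2 * ((N : ℝ) + 1)}) ≤ A' * flatNorm r k u :=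
        (eLpNorm_mono_measure _ Measure.restrict_le_self).trans
          ((hA l hl' u hu T hT _ (hv l hl').2).trans (by gcongr; exact hA' l hl))
      calc _ ≤ A' * flatNorm r k u + ((N : ℝ≥0∞) + 1)⁻¹ := add_le_add h1 (hm N l hl)
        _ ≤ (A' + 1 : ℝ≥0) * flatNorm r k u + (A' + 1 : ℝ≥0) * ((N : ℝ≥0∞) + 1)⁻¹ := by
            refine add_le_add ?_ ?_
            · gcongr
              exact le_self_add
            · refine le_mul_of_one_le_left zero_le ?_
              exact_mod_cast le_add_self
        _ = _ := (mul_add _ _ _).symm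
    calc wordNorm r k _ ≤ ∑ l ∈ words n k, (B l : ℝ≥0∞) *
          ((A' + 1 : ℝ≥0) * (flatNorm r k u + ((N : ℝ≥0∞) + 1)⁻¹)) :=
          Finset.sum_le_sum fun l hl => hB l N _ _ (hf _) fun l' hl' =>
            key l' (mem_words.2 (hl'.trans (mem_words.1 hl)))
      _ = _ := by
          rw [← Finset.sum_mul, ← ENNReal.ofNNReal_finsetSum, ENNReal.coe_mul, mul_assoc]
  · -- On a compact set the cutoff is eventually equal to `1`.
    have hlim := tendsto_wordAct_mollify hu hT hl hw hK
    have hmt : Filter.Tendsto m Filter.atTop Filter.atTop :=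
      Filter.tendsto_atTop_mono hmN Filter.tendsto_id
    obtain ⟨c, hc⟩ := hK.exists_bound_of_continuousOn (contDiff_bracketZ n).continuous.continuousOn
    obtain ⟨N₀, hN₀⟩ := exists_nat_ge c
    refine (hlim.comp hmt).congr' ?_
    filter_upwards [Filter.eventually_ge_atTop N₀] with N hN
    refine eLpNorm_congr_ae ((ae_restrict_iff' hK.measurableSet).2
      (Filter.Eventually.of_forall fun Z hZ => ?_))
    have hlt : bracketZ Z < (N : ℝ) + 1 := by
      have h1 : bracketZ Z ≤ c := (le_abs_self _).trans (hc Z hZ)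
      have h2 : (N₀ : ℝ) ≤ N := by exact_mod_cast hN
      linarith
    have hev : (fun Z => radialCutoff N Z * f (m N) Z) =ᶠ[nhds Z] f (m N) := by
      filter_upwards [(contDiff_bracketZ n).continuous.tendsto Z |>.eventually_lt_const hlt]
        with W hW
      rw [radialCutoff_eq_one hW.le, one_mul]
    simp only [Pi.sub_apply, (wordAct_congr_eventually l hev).eq_of_nhds, f]

/-! ### Products of limits -/

theorem eLpNorm_mul_le_mul_eLpNorm {E : Type*} [MeasurableSpace E] {μ : Measure E} {f g : E → ℂ}
    (hf : AEStronglyMeasurable f μ) (hg : AEStronglyMeasurable g μ) :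
    eLpNorm (fun x => f x * g x) 1 μ ≤ eLpNorm f 2 μ * eLpNorm g 2 μ := by
  have h : eLpNorm (f • g) 1 μ ≤ eLpNorm f 2 μ * eLpNorm g 2 μ :=
    eLpNorm_smul_le_mul_eLpNorm hg hf
  exact h

theorem tendsto_eLpNorm_mul_sub {E : Type*} [MeasurableSpace E] {μ : Measure E}
    {a b : ℕ → E → ℂ} {v w : E → ℂ} (ha : ∀ N, AEStronglyMeasurable (a N) μ)
    (hb : ∀ N, AEStronglyMeasurable (b N) μ) (hv : MemLp v 2 μ) (hw : MemLp w 2 μ)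
    (hav : Filter.Tendsto (fun N => eLpNorm (a N - v) 2 μ) Filter.atTop (nhds 0))
    (hbw : Filter.Tendsto (fun N => eLpNorm (b N - w) 2 μ) Filter.atTop (nhds 0)) :
    Filter.Tendsto (fun N => eLpNorm ((fun x => a N x * b N x) - fun x => v x * w x) 1 μ)
      Filter.atTop (nhds 0) := by
  have h1 := ENNReal.Tendsto.mul hav (Or.inr ENNReal.zero_ne_top) hbw (Or.inr ENNReal.zero_ne_top)
  have h2 := ENNReal.Tendsto.mul_const hav (b := eLpNorm w 2 μ) (Or.inr hw.2.ne)
  have h3 := ENNReal.Tendsto.const_mul hbw (a := eLpNorm v 2 μ) (Or.inr hv.2.ne)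
  have h := (h1.add h2).add h3
  simp only [mul_zero, zero_mul, add_zero] at h
  refine tendsto_of_tendsto_of_tendsto_of_le_of_le tendsto_const_nhds h (fun _ => zero_le)
    fun N => ?_
  have e : ((fun x => a N x * b N x) - fun x => v x * w x) =
      ((fun x => (a N - v) x * (b N - w) x) + fun x => (a N - v) x * w x) +
        fun x => v x * (b N - w) x := by
    funext x
    simp only [Pi.sub_apply, Pi.add_apply]
    ring
  have ma := (ha N).sub hv.1
  have mb := (hb N).sub hw.1
  rw [e]
  refine (eLpNorm_add_le ((ma.mul mb).add (ma.mul hw.1)) (hv.1.mul mb) le_rfl).trans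
    (add_le_add ((eLpNorm_add_le (ma.mul mb) (ma.mul hw.1) le_rfl).trans (add_le_add ?_ ?_)) ?_)
  · exact eLpNorm_mul_le_mul_eLpNorm ma mb
  · exact eLpNorm_mul_le_mul_eLpNorm ma hw.1
  · exact eLpNorm_mul_le_mul_eLpNorm hv.1 mb

theorem tendsto_eLpNorm_sum_sub {E ι : Type*} [Fintype ι] [MeasurableSpace E] {μ : Measure E}
    {a : ι → ℕ → E → ℂ} {v : ι → E → ℂ} (ha : ∀ i N, AEStronglyMeasurable (a i N) μ)
    (hv : ∀ i, AEStronglyMeasurable (v i) μ)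
    (h : ∀ i, Filter.Tendsto (fun N => eLpNorm (a i N - v i) 1 μ) Filter.atTop (nhds 0)) :
    Filter.Tendsto (fun N => eLpNorm ((fun x => ∑ i, a i N x) - fun x => ∑ i, v i x) 1 μ)
      Filter.atTop (nhds 0) := by
  have hs := tendsto_finsetSum Finset.univ fun i _ => h i
  rw [Finset.sum_const_zero] at hs
  refine tendsto_of_tendsto_of_tendsto_of_le_of_le tendsto_const_nhds hs (fun _ => zero_le)
    fun N => ?_
  have e : ((fun x => ∑ i, a i N x) - fun x => ∑ i, v i x) = ∑ i, (a i N - v i) := by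
    funext x
    simp only [Pi.sub_apply, Finset.sum_apply, Finset.sum_sub_distrib]
  rw [e]
  exact eLpNorm_sum_le (fun i _ => (ha i N).sub (hv i)) le_rfl

/-- Lower semicontinuity of the weighted norm under local convergence. -/
theorem weightedNorm_le_of_tendsto {n : ℕ} (r : ℝ) {a : ℕ → Spacetime n → ℂ}
    {b : Spacetime n → ℂ} {M : ℕ → ℝ≥0∞} {M' : ℝ≥0∞}
    (ha : ∀ N, AEStronglyMeasurable (a N) volume) (hb : AEStronglyMeasurable b volume)
    (hab : ∀ K : Set (Spacetime n), IsCompact K →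
      Filter.Tendsto (fun N => eLpNorm (a N - b) 1 (volume.restrict K)) Filter.atTop (nhds 0))
    (hM : ∀ N, weightedNorm r (a N) ≤ M N) (hM' : Filter.Tendsto M Filter.atTop (nhds M')) :
    weightedNorm r b ≤ M' := by
  have key : ∀ K : Set (Spacetime n), IsCompact K →
      eLpNorm (fun Z => ((bracketZ Z ^ r : ℝ) : ℂ) * b Z) 2 (volume.restrict K) ≤ M' := by
    intro K hK
    obtain ⟨ns, hns, hlim⟩ := (tendstoInMeasure_of_tendsto_eLpNorm one_ne_zero
      (fun N => (ha N).restrict) hb.restrict (hab K hK)).exists_seq_tendsto_ae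
    refine (Lp.eLpNorm_lim_le_liminf_eLpNorm
      (f := fun N Z => ((bracketZ Z ^ r : ℝ) : ℂ) * a (ns N) Z)
      (fun N => (aestronglyMeasurable_weight r (ha _)).restrict) _
      (hlim.mono fun Z hZ => hZ.const_mul _)).trans ?_
    rw [← (hM'.comp hns.tendsto_atTop).liminf_eq]
    exact Filter.liminf_le_liminf (Filter.Eventually.of_forall fun N =>
      (eLpNorm_mono_measure _ Measure.restrict_le_self).trans (hM _))
  refine (Lp.eLpNorm_lim_le_liminf_eLpNorm (p := 2)
    (f := fun N : ℕ => {Z : Spacetime n | bracketZ Z ≤ N}.indicator fun Z =>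
      ((bracketZ Z ^ r : ℝ) : ℂ) * b Z)
    (fun N => (aestronglyMeasurable_weight r hb).indicator
      (isCompact_bracketZ_le n N).measurableSet) _
    (Filter.Eventually.of_forall fun Z => ?_)).trans ?_
  · obtain ⟨N₀, hN₀⟩ := exists_nat_ge (bracketZ Z)
    refine tendsto_const_nhds.congr' ?_
    filter_upwards [Filter.eventually_ge_atTop N₀] with N hN
    have hZ : Z ∈ {Z : Spacetime n | bracketZ Z ≤ N} :=
      hN₀.trans (Nat.cast_le.2 hN)
    rw [Set.indicator_of_mem hZ]
  · calc _ ≤ Filter.liminf (fun _ : ℕ => M') Filter.atTop :=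
          Filter.liminf_le_liminf (Filter.Eventually.of_forall fun N => by
            rw [eLpNorm_indicator_eq_eLpNorm_restrict (isCompact_bracketZ_le n N).measurableSet]
            exact key _ (isCompact_bracketZ_le n N))
      _ = M' := Filter.liminf_const _

/-! ### Multiplication in the flat module spaces -/

section Product

variable {n k : ℕ}

theorem locallyIntegrable_mul {r₁ r₂ : ℝ} {u v : Spacetime n → ℂ} (hu : MemWeightedL2 r₁ u)
    (hv : MemWeightedL2 r₂ v) : LocallyIntegrable fun Z => u Z * v Z := by
  rw [locallyIntegrable_iff]
  exact fun K hK => (hu.memLp_restrict hK).integrable_mul (hv.memLp_restrict hK)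

/-- The weak derivative of a product along a word, by the Leibniz rule, with its bound. -/
theorem exists_represents_wordOp_mul (hn : 1 ≤ n) (hk : 4 ≤ k) (hkn : n + 5 ≤ 2 * k)
    (r₁ r₂ : ℝ) {l : List (FlatGen n)} (hl : wordOrd l ≤ k) :
    ∃ C : ℝ≥0, ∀ u ∈ flatSpace n r₁ k, ∀ v ∈ flatSpace n r₂ k, ∀ T,
      Represents (fun Z => u Z * v Z) T → ∃ h, Represents h (wordOp l T) ∧
        weightedNorm (r₁ + r₂ + ((n : ℝ) + 1) / 2) h ≤
          C * flatNorm r₁ k u * flatNorm r₂ k v := by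
  obtain ⟨ι, _, p, q, hpq, hsum⟩ := exists_leibniz l
  obtain ⟨A, hA⟩ := exists_approx n k r₁
  obtain ⟨B, hB⟩ := exists_approx n k r₂
  have hp : ∀ i, wordOrd (p i) ≤ k := fun i => by have := (hpq i).1; omega
  have hq : ∀ i, wordOrd (q i) ≤ k := fun i => by have := (hpq i).1; omega
  choose C hC using fun i =>
    exists_weightedNorm_mul_le hn hk hkn r₁ r₂ (p i) (q i) (by rw [(hpq i).1]; exact hl)
  refine ⟨(∑ i, C i) * A * B, fun u hu v hv T hT => ?_⟩
  have hTu := represents_distOf hu.1.locallyIntegrable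
  have hTv := represents_distOf hv.1.locallyIntegrable
  obtain ⟨U, hU, hUn, hUt⟩ := hA u hu _ hTu
  obtain ⟨V, hV, hVn, hVt⟩ := hB v hv _ hTv
  choose a ha haT using fun i =>
    exists_represents_of_mem_flatSpace hu hTu (wordOp_mem_flatReduced (hp i))
  choose b hb hbT using fun i =>
    exists_represents_of_mem_flatSpace hv hTv (wordOp_mem_flatReduced (hq i))
  have hUV : ∀ N, ContDiff ℝ ∞ fun Z => U N Z * V N Z := fun N => (hU N).1.mul (hV N).1
  have hS := fun N => represents_distOf (hUV N).continuous.locallyIntegrable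
  have hcu : ∀ i N, Continuous (wordAct (p i) (U N)) := fun i N => ((hU N).1.wordAct _).continuous
  have hcv : ∀ i N, Continuous (wordAct (q i) (V N)) := fun i N => ((hV N).1.wordAct _).continuous
  have hlim : ∀ K : Set (Spacetime n), IsCompact K → Filter.Tendsto
      (fun N => eLpNorm ((fun Z => ∑ i, wordAct (p i) (U N) Z * wordAct (q i) (V N) Z) -
        fun Z => ∑ i, a i Z * b i Z) 1 (volume.restrict K)) Filter.atTop (nhds 0) := by
    intro K hK
    refine tendsto_eLpNorm_sum_sub
      (fun i N => ((hcu i N).mul (hcv i N)).aestronglyMeasurable)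
      (fun i => (ha i).aestronglyMeasurable.restrict.mul (hb i).aestronglyMeasurable.restrict)
      fun i => ?_
    exact tendsto_eLpNorm_mul_sub (fun N => (hcu i N).aestronglyMeasurable)
      (fun N => (hcv i N).aestronglyMeasurable) ((ha i).memLp_restrict hK)
      ((hb i).memLp_restrict hK) (hUt _ (hp i) _ (haT i) K hK) (hVt _ (hq i) _ (hbT i) K hK)
  have hwl : ∀ N, wordAct l (fun Z => U N Z * V N Z) =
      fun Z => ∑ i, wordAct (p i) (U N) Z * wordAct (q i) (V N) Z := fun N =>
    funext (hsum _ _ (hU N).1 (hV N).1)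
  refine ⟨fun Z => ∑ i, a i Z * b i Z, represents_of_tendsto (hasTranspose_wordOp l) hS
    (fun N => (hS N).wordAct (hUV N) l) hT ?_ (fun K hK => ?_) (fun K hK => ?_), ?_⟩
  · rw [locallyIntegrable_iff]
    intro K hK
    exact integrable_finsetSum _ fun i _ =>
      ((ha i).memLp_restrict hK).integrable_mul ((hb i).memLp_restrict hK)
  · exact tendsto_eLpNorm_mul_sub (fun N => (hU N).1.continuous.aestronglyMeasurable)
      (fun N => (hV N).1.continuous.aestronglyMeasurable) (hu.1.memLp_restrict hK)
      (hv.1.memLp_restrict hK) (hUt [] (by simp [wordOrd]) u hTu K hK)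
      (hVt [] (by simp [wordOrd]) v hTv K hK)
  · simp only [hwl]
    exact hlim K hK
  · refine weightedNorm_le_of_tendsto _
      (M := fun N : ℕ => (∑ i, (C i : ℝ≥0∞)) *
        (A * (flatNorm r₁ k u + ((N : ℝ≥0∞) + 1)⁻¹)) *
        (B * (flatNorm r₂ k v + ((N : ℝ≥0∞) + 1)⁻¹)))
      (fun N => (continuous_finsetSum _ fun i _ =>
        (hcu i N).mul (hcv i N)).aestronglyMeasurable)
      (Finset.aestronglyMeasurable_fun_sum _ fun i _ =>
        (ha i).aestronglyMeasurable.mul (hb i).aestronglyMeasurable) hlim (fun N => ?_) ?_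
    · calc _ ≤ ∑ i, weightedNorm (r₁ + r₂ + ((n : ℝ) + 1) / 2)
            (fun Z => wordAct (p i) (U N) Z * wordAct (q i) (V N) Z) :=
            weightedNorm_sum_le _ _ fun i _ => ((hcu i N).mul (hcv i N)).aestronglyMeasurable
        _ ≤ ∑ i, (C i : ℝ≥0∞) * wordNorm r₁ k (U N) * wordNorm r₂ k (V N) :=
            Finset.sum_le_sum fun i _ => hC i _ _ (hU N).1 (hU N).2 (hV N).1 (hV N).2
        _ = (∑ i, (C i : ℝ≥0∞)) * wordNorm r₁ k (U N) * wordNorm r₂ k (V N) := by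
            rw [Finset.sum_mul, Finset.sum_mul]
        _ ≤ _ := by
            gcongr
            · exact hUn N
            · exact hVn N
    · have hε : Filter.Tendsto (fun N : ℕ => ((N : ℝ≥0∞) + 1)⁻¹) Filter.atTop (nhds 0) := by
        have := ENNReal.tendsto_inv_nat_nhds_zero.comp (Filter.tendsto_add_atTop_nat 1)
        refine this.congr fun N => ?_
        simp
      have hfin : ∀ (D : ℝ≥0) (x : ℝ≥0∞), x < ⊤ → (D : ℝ≥0∞) * x ≠ ⊤ := fun D x hx =>
        (ENNReal.mul_lt_top ENNReal.coe_lt_top hx).ne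
      have key : ∀ (D : ℝ≥0) (x : ℝ≥0∞), Filter.Tendsto
          (fun N : ℕ => (D : ℝ≥0∞) * (x + ((N : ℝ≥0∞) + 1)⁻¹)) Filter.atTop (nhds (D * x)) :=
        fun D x => by
          have h := ENNReal.Tendsto.const_mul (a := (D : ℝ≥0∞)) (hε.const_add x)
            (Or.inr ENNReal.coe_ne_top)
          rwa [add_zero] at h
      have h1 := ENNReal.Tendsto.const_mul (a := ((∑ i, C i : ℝ≥0) : ℝ≥0∞))
        (key A (flatNorm r₁ k u)) (Or.inr ENNReal.coe_ne_top)
      have h2 := ENNReal.Tendsto.mul h1 (Or.inr (hfin _ _ (flatNorm_lt_top hv)))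
        (key B (flatNorm r₂ k v)) (Or.inr (ENNReal.mul_lt_top ENNReal.coe_lt_top
          (hfin _ _ (flatNorm_lt_top hu)).lt_top).ne)
      rw [← ENNReal.ofNNReal_finsetSum]
      convert h2 using 2
      push_cast
      ring

/-- The product of elements of the flat module spaces, without support conditions. -/
theorem exists_flatNorm_mul_le (hn : 1 ≤ n) (hk : 4 ≤ k) (hkn : n + 5 ≤ 2 * k) (r₁ r₂ : ℝ) :
    ∃ C : ℝ≥0, ∀ u ∈ flatSpace n r₁ k, ∀ v ∈ flatSpace n r₂ k,
      (fun Z => u Z * v Z) ∈ flatSpace n (r₁ + r₂ + ((n : ℝ) + 1) / 2) k ∧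
      flatNorm (r₁ + r₂ + ((n : ℝ) + 1) / 2) k (fun Z => u Z * v Z) ≤
        C * flatNorm r₁ k u * flatNorm r₂ k v := by
  choose! C hC using fun (l : List (FlatGen n)) (hl : wordOrd l ≤ k) =>
    exists_represents_wordOp_mul hn hk hkn r₁ r₂ hl
  set C' : ℝ≥0 := ∑ l ∈ words n k, C l
  have hC' : ∀ l ∈ words n k, C l ≤ C' := fun l hl =>
    Finset.single_le_sum (f := C) (fun _ _ => zero_le) hl
  refine ⟨(monomials n k).card * C', fun u hu v hv => ?_⟩
  have hT := represents_distOf (locallyIntegrable_mul hu.1 hv.1)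
  set T := distOf _ (locallyIntegrable_mul hu.1 hv.1)
  set M := (C' : ℝ≥0∞) * flatNorm r₁ k u * flatNorm r₂ k v with hM
  have hMtop : M < ⊤ := ENNReal.mul_lt_top
    (ENNReal.mul_lt_top ENNReal.coe_lt_top (flatNorm_lt_top hu)) (flatNorm_lt_top hv)
  have key : ∀ l, ∃ h, l ∈ words n k → Represents h (wordOp l T) ∧
      weightedNorm (r₁ + r₂ + ((n : ℝ) + 1) / 2) h ≤ M := fun l => by
    by_cases hl : l ∈ words n k
    · obtain ⟨h, h1, h2⟩ := hC l (mem_words.1 hl) u hu v hv T hT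
      refine ⟨h, fun _ => ⟨h1, h2.trans ?_⟩⟩
      rw [hM]
      gcongr
      exact hC' l hl
    · exact ⟨0, fun h => absurd h hl⟩
  choose h hh using key
  refine ⟨⟨memWeightedL2_iff.2 ⟨hT.1.aestronglyMeasurable, ?_⟩, fun P hP => ?_⟩, ?_⟩
  · have h0 := hh [] (mem_words.2 (by simp [wordOrd]))
    exact (weightedNorm_congr_ae _ (hT.ae_eq h0.1)).trans_lt (h0.2.trans_lt hMtop)
  · obtain ⟨a, ha, rfl⟩ := exists_coeff_of_mem_wordSpan (flatOrdLE_le_wordSpan n k hP.2)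
    obtain ⟨D, hD⟩ := exists_weightedNorm_sum_le (r₁ + r₂ + ((n : ℝ) + 1) / 2) (words n k) ha
    have hrep : Represents (fun Z => ∑ l ∈ words n k, a l Z * h l Z)
        ((∑ l ∈ words n k, mulX (a l) (ha l) * wordOp l) T) := by
      rw [LinearMap.sum_apply]
      exact Represents.sum _ fun l hl => (hh l hl).1.mulOp (contDiff_of_mem_smoothX (ha l))
    refine ⟨_, memWeightedL2_iff.2 ⟨hrep.1.aestronglyMeasurable, ?_⟩, T, hT, hrep⟩
    exact (hD h M (fun l hl => (hh l hl).1.1.aestronglyMeasurable)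
      fun l hl => (hh l hl).2).trans_lt (ENNReal.mul_lt_top ENNReal.coe_lt_top hMtop)
  · refine (flatNorm_le (M := M) _ fun α hα => ?_).trans_eq ?_
    · have hα' := hh (sortedWord α) (mem_words.2 (by rwa [wordOrd_sortedWord]))
      rw [wordOp_sortedWord] at hα'
      rw [hT.weakNorm_eq hα'.1]
      exact hα'.2
    · rw [hM, ENNReal.coe_mul, ENNReal.coe_natCast]
      ring

end Product

end

theorem mainTheorem7 (n : ℕ) (hn : 1 ≤ n) (t₀ t₀' r₁ r₂ : ℝ) (k : ℕ)
    (hk : max ((n : ℝ) / 2 + 2) 3 < (k : ℝ)) :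
    ProductContained (flatSpaceGE n r₁ k t₀) (flatSpaceGE n r₂ k t₀)
      (flatSpaceGE n (r₁ + r₂ + ((n : ℝ) + 1) / 2) k t₀)
      (flatNorm r₁ k) (flatNorm r₂ k) (flatNorm (r₁ + r₂ + ((n : ℝ) + 1) / 2) k) ∧
    ProductContained (flatSpaceLE n r₁ k t₀) (flatSpaceLE n r₂ k t₀)
      (flatSpaceLE n (r₁ + r₂ + ((n : ℝ) + 1) / 2) k t₀)
      (flatNorm r₁ k) (flatNorm r₂ k) (flatNorm (r₁ + r₂ + ((n : ℝ) + 1) / 2) k) ∧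
    ProductContained (flatSpaceGE n r₁ k t₀) (flatSpaceLE n r₂ k t₀')
      (flatSpaceGE n (r₁ + r₂ + ((n : ℝ) + 1) / 2) k t₀)
      (flatNorm r₁ k) (flatNorm r₂ k) (flatNorm (r₁ + r₂ + ((n : ℝ) + 1) / 2) k) := by
  have hk3 : (3 : ℝ) < k := (le_max_right _ _).trans_lt hk
  have hk2 : (n : ℝ) / 2 + 2 < k := (le_max_left _ _).trans_lt hk
  have hk4 : 4 ≤ k := by
    have : 3 < k := by exact_mod_cast hk3
    omega
  have hkn : n + 5 ≤ 2 * k := by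
    have h : (n : ℝ) + 4 < 2 * k := by linarith
    have : n + 4 < 2 * k := by exact_mod_cast h
    omega
  obtain ⟨C, hC⟩ := exists_flatNorm_mul_le hn hk4 hkn r₁ r₂
  refine ⟨⟨fun u hu v hv => ⟨(hC u hu.1 v hv.1).1, ?_⟩, C, fun u hu v hv => (hC u hu.1 v hv.1).2⟩,
    ⟨fun u hu v hv => ⟨(hC u hu.1 v hv.1).1, ?_⟩, C, fun u hu v hv => (hC u hu.1 v hv.1).2⟩,
    ⟨fun u hu v hv => ⟨(hC u hu.1 v hv.1).1, ?_⟩, C, fun u hu v hv => (hC u hu.1 v hv.1).2⟩⟩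
  all_goals
    filter_upwards [hu.2] with Z hZ ht
    rw [hZ ht, zero_mul]
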